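/- **Conventions.** Composites of arrows are written $g f$ ($f$ first). An arrow $f\colon X\to Y$ of a bicategory is an *equivalence* if there is $g\colon Y\to X$ with $gf\cong \mathrm{id}_X$ and $fg\cong\mathrm{id}_Y$; it is a *quasiequivalence* if for every object $Z$ the functors $f_*\colon\mathcal C(Z,X)\to\mathcal C(Z,Y)$ and $f^*\colon\mathcal C(Y,Z)\to\mathcal C(X,Z)$ are full and faithful. Limits with a capital letter (Initial and Terminal objects, Pullbacks, Pushouts) are bilimits, i.e. their universal property is an equivalence (not an isomorphism) of categories. For bicategories $\mathcal C,\mathcal D$, $Hom(\mathcal C,\mathcal D)$ is the bicategory of pseudofunctors, pseudonatural transformations and modifications; a pseudonatural equivalence is an equivalence of this bicategory. A pseudofunctor $F\colon\mathcal A\to\mathcal B$ is a *pseudoequivalence* if there are a pseudofunctor $G\colon\mathcal B\to\mathcal A$ and pseudonatural equivalences $GF\Rightarrow \mathrm{id}_{\mathcal A}$, $FG\Rightarrow\mathrm{id}_{\mathcal B}$. **Lifting property.** A pair of arrows $i\colon A\to X$, $p\colon Y\to B$ has the lifting property if: (LP1) every invertible 2-cell $\gamma\colon pa\Rightarrow bi$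 (with $a\colon A\to Y$, $b\colon X\to B$) has a *filler*, i.e. an arrow $f\colon X\to Y$ with invertible 2-cells $\lambda\colon a\Rightarrow fi$, $\rho\colon pf\Rightarrow b$ whose pasting $(\rho i)\circ(p\lambda)$ is $\gamma$; (LP2) for two such squares $\gamma_1\colon pa_1\Rightarrow b_1i$, $\gamma_2\colon pa_2\Rightarrow b_2i$ with fillers $(f_1,\lambda_1,\rho_1)$, $(f_2,\lambda_2,\rho_2)$ and 2-cells $\alpha\colon a_1\Rightarrow a_2$, $\beta\colon b_1\Rightarrow b_2$ with $\gamma_2\circ p\alpha=\beta i\circ\gamma_1$, there is a 2-cell $\delta\colon f_1\Rightarrow f_2$ with $\lambda_2\circ\alpha=\delta i\circ\lambda_1$ and $\rho_2\circ p\delta=\beta\circ\rho_1$. **Model bicategories.** A *model bicategory* is a bicategory $\mathcal C$ with three classes of arrows, the fibrations, the cofibrations and the weak equivalences $\mathcal W$, such that: (M0) $\mathcal C$ has Initial and Terminal objects, Pullbacks and Pushouts; (M1) if $i$ is a cofibration, $p$ is a fibration and one of them is a weak equivalence, then $(i,p)$ has the lifting property; (M2) every arrow $f$ admits $f\cong pi$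 with $i$ a cofibration and $p$ a fibration, and either $i$ or $p$ may be required to be a weak equivalence; (M3) fibrations (cofibrations) are closed under composition, Pullback (Pushout) and invertible 2-cells, and every equivalence is a fibration and a cofibration; (M4) Pullbacks of fibrations that are weak equivalences, and Pushouts of cofibrations that are weak equivalences, are weak equivalences; (M5) if $gf\cong h$ and two of $f,g,h$ are weak equivalences, so is the third, and every equivalence is a weak equivalence. A *trivial* (co)fibration is a (co)fibration that is a weak equivalence. An object $X$ is *fibrant* (*cofibrant*) if the arrow from $X$ to the Terminal object (from the Initial object to $X$) is a fibration (cofibration). **The homotopy bicategory.** A *$\sigma$-cylinder* for $X$ consists of arrows $d_0,d_1\colon X\to V$, $x\colon X\to Z$, a weak equivalence $s\colon V\to Z$ and invertible 2-cells $\alpha_0\colon sd_0\Rightarrow x$, $\alpha_1\colon sd_1\Rightarrow x$. A *$\sigma$-homotopy* $H$ from $f$ to $g$ ($f,g\colon X\to Y$) consists of a $\sigma$-cylinder for $X$, an arrow $h\colon V\to Y$ and 2-cells $\eta\colon f\Rightarrow hd_0$, $\varepsilon\colon hd_1\Rightarrow g$. If $F\colon\mathcal C\to\mathcal B$ is a (strict)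 2-functor into a bicategory that maps $\mathcal W$ to quasiequivalences, let $\widehat{FC}\colon Fd_0\Rightarrow Fd_1$ be the unique 2-cell with $Fs*\widehat{FC}=F(\alpha_1^{-1}\circ\alpha_0)$ and let $\widehat{FH}=F\varepsilon\circ (Fh*\widehat{FC})\circ F\eta\colon Ff\Rightarrow Fg$. For a finite sequence of composable $\sigma$-homotopies take the vertical composite of these 2-cells; two finite sequences from $f$ to $g$ are *in the same class* if every such $F$ (with any $\mathcal B$) assigns the same 2-cell to both. The bicategory $\mathcal Ho(\mathcal C,\mathcal W)$ has the objects and arrows of $\mathcal C$, and as 2-cells the classes of finite sequences of $\sigma$-homotopies, composed vertically by juxtaposition and whiskered with arrows termwise; the projection $i\colon\mathcal C\to\mathcal Ho(\mathcal C,\mathcal W)$ is the identity on objects and arrows and sends a 2-cell $\mu$ to the class of a $\sigma$-homotopy on which every such $F$ takes the value $F\mu$. Finally $\mathcal Ho(\mathcal C)$ is the full sub-bicategory of $\mathcal Ho(\mathcal C,\mathcal W)$ on the objects that are both fibrant and cofibrant. **Replacement.** A *cofibrant replacement* $Q$ is a choice of: for each object $X$ a trivial fibration $p_X\colon QX\to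 X$ with $QX$ cofibrant; for each arrow $f\colon X\to Y$ an arrow $Qf\colon QX\to QY$ and an invertible 2-cell $\rho_f\colon p_Y\,Qf\Rightarrow f\,p_X$; for each 2-cell $\mu\colon f\Rightarrow g$ a 2-cell $Q\mu\colon Qf\Rightarrow Qg$ with $p_Y*Q\mu=\rho_g^{-1}\circ(\mu*p_X)\circ\rho_f$. Dually, a *fibrant replacement* $R$ is a choice of trivial cofibrations $i_X\colon X\to RX$ with $RX$ fibrant, arrows $Rf$ with invertible 2-cells $\lambda_f\colon i_Yf\Rightarrow Rf\,i_X$, and 2-cells $R\mu$ with $R\mu*i_X=\lambda_g\circ(i_Y*\mu)\circ\lambda_f^{-1}$. **Theorem.** Let $\mathcal C$ be a model bicategory with weak equivalences $\mathcal W$. Cofibrant and fibrant replacements $Q$, $R$ exist, and for every choice of them there is a pseudofunctor $r\colon\mathcal C\to\mathcal Ho(\mathcal C)$ with $$rX=RQX,\qquad rf=RQf,\qquad r\mu=i(RQ\mu),$$ whose structural 2-cells $\xi_X\colon \mathrm{id}_{rX}\Rightarrow r(\mathrm{id}_X)$ and $\phi_{f,g}\colon rg\,rf\Rightarrow r(gf)$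 are those induced by the replacements. That is, there are 2-cells $\xi^Q_X\colon \mathrm{id}_{QX}\Rightarrow Q(\mathrm{id}_X)$ and $\phi^Q_{f,g}\colon Qg\,Qf\Rightarrow Q(gf)$ of $\mathcal Ho(\mathcal C,\mathcal W)$ such that, in $\mathcal Ho(\mathcal C,\mathcal W)$ and omitting $i$ and the structural isomorphisms of $\mathcal C$, $$p_X*\xi^Q_X=\rho_{\mathrm{id}_X}^{-1},\qquad p_Z*\phi^Q_{f,g}=\rho_{gf}^{-1}\circ(g*\rho_f)\circ(\rho_g*Qf),$$ $$\xi_X*i_{QX}=\lambda_{Q(\mathrm{id}_X)}\circ(i_{QX}*\xi^Q_X),\qquad \phi_{f,g}*i_{QX}=\lambda_{Q(gf)}\circ(i_{QZ}*\phi^Q_{f,g})\circ(\lambda_{Qg}^{-1}*Qf)\circ(RQg*\lambda_{Qf}^{-1})$$ for $f\colon X\to Y$, $g\colon Y\to Z$. Every such $r$ is the localization of $\mathcal C$ with respect to $\mathcal W$: it maps the arrows of $\mathcal W$ to equivalences, and for every bicategory $\mathcal D$ the pseudofunctor given by precomposition with $r$, $$Hom(\mathcal Ho(\mathcal C),\mathcal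 D)\xrightarrow{\ r^*\ }Hom_{\mathcal W,\Theta}(\mathcal C,\mathcal D),$$ is a pseudoequivalence of bicategories, where $Hom_{\mathcal W,\Theta}(\mathcal C,\mathcal D)$ is the full sub-bicategory of $Hom(\mathcal C,\mathcal D)$ on the pseudofunctors that map the arrows of $\mathcal W$ to equivalences. Moreover, explicitly: 1. For every pseudofunctor $F\colon\mathcal C\to\mathcal D$ that maps the weak equivalences to equivalences there are a pseudofunctor $\overline F\colon\mathcal Ho(\mathcal C)\to\mathcal D$ and a pseudonatural equivalence $\overline F r\Rightarrow F$. 2. For all pseudofunctors $\overline F,\overline G\colon\mathcal Ho(\mathcal C)\to\mathcal D$ and every pseudonatural transformation $\theta\colon\overline F r\Rightarrow\overline G r$ there are a pseudonatural transformation $\overline\theta\colon\overline F\Rightarrow\overline G$ and an invertible modification $\overline\theta r\cong\theta$. 3. For all pseudofunctors $\overline F,\overline G\colon\mathcal Ho(\mathcal C)\to\mathcal D$, all pseudonatural transformations $\overline\theta,\overline\eta\colon\overline F\Rightarrow\overline G$ and every modification $\rho\colon\overline\theta r\to\overline\eta r$ there is a unique modification $\overline\rho\colon\overline\theta\to\overline\eta$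 with $\overline\rho r=\rho$. -/

import Mathlib

open CategoryTheory Bicategory
open scoped Pseudofunctor.StrongTrans

universe w v u w₁ v₁ u₁

namespace ModelBicat

section Basic

variable {C : Type u} [Bicategory.{w, v} C]

/-- A family of arrows of a bicategory. -/
abbrev ArrowClass (C : Type u) [Bicategory.{w, v} C] : Type (max u v) :=
  ∀ ⦃X Y : C⦄, (X ⟶ Y) → Prop

/-- An arrow which has a quasi-inverse. -/
def IsEquiv {X Y : C} (f : X ⟶ Y) : Prop :=
  ∃ g : Y ⟶ X, Nonempty (f ≫ g ≅ 𝟙 X) ∧ Nonempty (g ≫ f ≅ 𝟙 Y)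

/-- An arrow such that composing with it, on either side, is full and faithful on 2-cells. -/
def IsQuasiequiv {X Y : C} (f : X ⟶ Y) : Prop :=
  (∀ (Z : C) (g h : Z ⟶ X), Function.Bijective (fun α : g ⟶ h => α ▷ f)) ∧
  (∀ (Z : C) (g h : Y ⟶ Z), Function.Bijective (fun α : g ⟶ h => f ◁ α))

/-- Terminal object in the bicategorical sense: every hom-category into it is equivalent to the
terminal category. -/
def IsBiterminal (T : C) : Prop :=
  ∀ X : C, Nonempty (X ⟶ T) ∧ ∀ f g : X ⟶ T, ∃! _α : f ⟶ g, True

/-- Initial object in the bicategorical sense. -/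
def IsBiinitial (I : C) : Prop :=
  ∀ X : C, Nonempty (I ⟶ X) ∧ ∀ f g : I ⟶ X, ∃! _α : f ⟶ g, True

/-- A square filled with an invertible 2-cell is a Pullback (bipullback) if, for every `X`, the
induced functor from `X ⟶ P` to the category of squares on `X` over the cospan `(f, g)` is an
equivalence: it is essentially surjective (`exists_lift`), full and faithful (`existsUnique`). -/
structure IsBipullback {P A B E : C} (p : P ⟶ A) (q : P ⟶ B) (f : A ⟶ E) (g : B ⟶ E)
    (γ : p ≫ f ≅ q ≫ g) : Prop where
  exists_lift : ∀ (X : C) (a : X ⟶ A) (b : X ⟶ B) (σ : a ≫ f ≅ b ≫ g),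
    ∃ (t : X ⟶ P) (α : t ≫ p ≅ a) (β : t ≫ q ≅ b),
      t ◁ γ.hom =
        (α_ t p f).inv ≫ α.hom ▷ f ≫ σ.hom ≫ β.inv ▷ g ≫ (α_ t q g).hom
  existsUnique : ∀ (X : C) (s t : X ⟶ P) (μ : s ≫ p ⟶ t ≫ p) (ν : s ≫ q ⟶ t ≫ q),
    (α_ s p f).inv ≫ μ ▷ f ≫ (α_ t p f).hom ≫ t ◁ γ.hom =
        s ◁ γ.hom ≫ (α_ s q g).inv ≫ ν ▷ g ≫ (α_ t q g).hom →
      ∃! δ : s ⟶ t, δ ▷ p = μ ∧ δ ▷ q = ν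

/-- A square filled with an invertible 2-cell is a Pushout (bipushout). -/
structure IsBipushout {E A B P : C} (f : E ⟶ A) (g : E ⟶ B) (i : A ⟶ P) (j : B ⟶ P)
    (γ : f ≫ i ≅ g ≫ j) : Prop where
  exists_desc : ∀ (X : C) (a : A ⟶ X) (b : B ⟶ X) (σ : f ≫ a ≅ g ≫ b),
    ∃ (t : P ⟶ X) (α : i ≫ t ≅ a) (β : j ≫ t ≅ b),
      γ.hom ▷ t =
        (α_ f i t).hom ≫ f ◁ α.hom ≫ σ.hom ≫ g ◁ β.inv ≫ (α_ g j t).inv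
  existsUnique : ∀ (X : C) (s t : P ⟶ X) (μ : i ≫ s ⟶ i ≫ t) (ν : j ≫ s ⟶ j ≫ t),
    (α_ f i s).hom ≫ f ◁ μ ≫ (α_ f i t).inv ≫ γ.hom ▷ t =
        γ.hom ▷ s ≫ (α_ g j s).hom ≫ g ◁ ν ≫ (α_ g j t).inv →
      ∃! δ : s ⟶ t, i ◁ δ = μ ∧ j ◁ δ = ν

/-- A filler of a square `γ : a ≫ p ≅ i ≫ b`: a diagonal with two invertible 2-cells whose
pasting is `γ`. -/
structure Filler {A X Y B : C} (i : A ⟶ X) (p : Y ⟶ B) {a : A ⟶ Y} {b : X ⟶ B}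
    (γ : a ≫ p ≅ i ≫ b) where
  diag : X ⟶ Y
  upper : a ≅ i ≫ diag
  lower : diag ≫ p ≅ b
  fac : upper.hom ▷ p ≫ (α_ i diag p).hom ≫ i ◁ lower.hom = γ.hom

/-- The lifting property of a pair of arrows, in its one- and two-dimensional aspects. -/
structure HasLifting {A X Y B : C} (i : A ⟶ X) (p : Y ⟶ B) : Prop where
  exists_filler : ∀ {a : A ⟶ Y} {b : X ⟶ B} (γ : a ≫ p ≅ i ≫ b), Nonempty (Filler i p γ)
  exists_cell : ∀ {a₁ a₂ : A ⟶ Y} {b₁ b₂ : X ⟶ B} (γ₁ : a₁ ≫ p ≅ i ≫ b₁)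
    (γ₂ : a₂ ≫ p ≅ i ≫ b₂) (L₁ : Filler i p γ₁) (L₂ : Filler i p γ₂)
    (α : a₁ ⟶ a₂) (β : b₁ ⟶ b₂), α ▷ p ≫ γ₂.hom = γ₁.hom ≫ i ◁ β →
      ∃ δ : L₁.diag ⟶ L₂.diag,
        α ≫ L₂.upper.hom = L₁.upper.hom ≫ i ◁ δ ∧ δ ▷ p ≫ L₂.lower.hom = L₁.lower.hom ≫ β

end Basic

/-- The structure of a model bicategory on a bicategory. -/
structure ModelStructure (C : Type u) [Bicategory.{w, v} C] where
  /-- the fibrations -/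
  Fib : ArrowClass C
  /-- the cofibrations -/
  Cof : ArrowClass C
  /-- the weak equivalences -/
  W : ArrowClass C
  exists_terminal : ∃ T : C, IsBiterminal T
  exists_initial : ∃ I : C, IsBiinitial I
  exists_pullback : ∀ {A B E : C} (f : A ⟶ E) (g : B ⟶ E),
    ∃ (P : C) (p : P ⟶ A) (q : P ⟶ B) (γ : p ≫ f ≅ q ≫ g), IsBipullback p q f g γ
  exists_pushout : ∀ {E A B : C} (f : E ⟶ A) (g : E ⟶ B),
    ∃ (P : C) (i : A ⟶ P) (j : B ⟶ P) (γ : f ≫ i ≅ g ≫ j), IsBipushout f g i j γ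
  lifting : ∀ {A X Y B : C} (i : A ⟶ X) (p : Y ⟶ B), Cof i → Fib p → (W i ∨ W p) →
    HasLifting i p
  factor_trivCof_fib : ∀ {X Y : C} (f : X ⟶ Y), ∃ (Z : C) (i : X ⟶ Z) (p : Z ⟶ Y),
    Cof i ∧ W i ∧ Fib p ∧ Nonempty (f ≅ i ≫ p)
  factor_cof_trivFib : ∀ {X Y : C} (f : X ⟶ Y), ∃ (Z : C) (i : X ⟶ Z) (p : Z ⟶ Y),
    Cof i ∧ Fib p ∧ W p ∧ Nonempty (f ≅ i ≫ p)
  fib_comp : ∀ {X Y Z : C} (f : X ⟶ Y) (g : Y ⟶ Z), Fib f → Fib g → Fib (f ≫ g)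
  cof_comp : ∀ {X Y Z : C} (f : X ⟶ Y) (g : Y ⟶ Z), Cof f → Cof g → Cof (f ≫ g)
  fib_pullback : ∀ {P A B E : C} (p : P ⟶ A) (q : P ⟶ B) (f : A ⟶ E) (g : B ⟶ E)
    (γ : p ≫ f ≅ q ≫ g), IsBipullback p q f g γ → Fib g → Fib p
  cof_pushout : ∀ {E A B P : C} (f : E ⟶ A) (g : E ⟶ B) (i : A ⟶ P) (j : B ⟶ P)
    (γ : f ≫ i ≅ g ≫ j), IsBipushout f g i j γ → Cof g → Cof i
  fib_of_equiv : ∀ {X Y : C} (f : X ⟶ Y), IsEquiv f → Fib f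
  cof_of_equiv : ∀ {X Y : C} (f : X ⟶ Y), IsEquiv f → Cof f
  fib_of_iso : ∀ {X Y : C} {f g : X ⟶ Y}, (f ≅ g) → Fib f → Fib g
  cof_of_iso : ∀ {X Y : C} {f g : X ⟶ Y}, (f ≅ g) → Cof f → Cof g
  trivFib_pullback : ∀ {P A B E : C} (p : P ⟶ A) (q : P ⟶ B) (f : A ⟶ E) (g : B ⟶ E)
    (γ : p ≫ f ≅ q ≫ g), IsBipullback p q f g γ → Fib g → W g → W p
  trivCof_pushout : ∀ {E A B P : C} (f : E ⟶ A) (g : E ⟶ B) (i : A ⟶ P) (j : B ⟶ P)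
    (γ : f ≫ i ≅ g ≫ j), IsBipushout f g i j γ → Cof g → W g → W i
  w_comp : ∀ {X Y Z : C} (f : X ⟶ Y) (g : Y ⟶ Z) (h : X ⟶ Z), (f ≫ g ≅ h) → W f → W g → W h
  w_of_comp_left : ∀ {X Y Z : C} (f : X ⟶ Y) (g : Y ⟶ Z) (h : X ⟶ Z), (f ≫ g ≅ h) →
    W f → W h → W g
  w_of_comp_right : ∀ {X Y Z : C} (f : X ⟶ Y) (g : Y ⟶ Z) (h : X ⟶ Z), (f ≫ g ≅ h) →
    W g → W h → W f
  w_of_equiv : ∀ {X Y : C} (f : X ⟶ Y), IsEquiv f → W f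

section Homotopies

variable {C : Type u} [Bicategory.{w, v} C]

/-- A (left) `σ`-cylinder for `X` with respect to a family `W` of arrows. -/
structure Cylinder (W : ArrowClass C) (X : C) where
  cyl : C
  base : C
  d₀ : X ⟶ cyl
  d₁ : X ⟶ cyl
  x : X ⟶ base
  s : cyl ⟶ base
  s_mem : W s
  α₀ : d₀ ≫ s ≅ x
  α₁ : d₁ ≫ s ≅ x

/-- A (left) `σ`-homotopy from `f` to `g` with respect to a family `W` of arrows. -/
structure Homotopy (W : ArrowClass C) {X Y : C} (f g : X ⟶ Y) where
  C : Cylinder W X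
  h : C.cyl ⟶ Y
  start : f ⟶ C.d₀ ≫ h
  finish : C.d₁ ≫ h ⟶ g

/-- Finite composable sequences of `σ`-homotopies. -/
inductive HomotopySeq (W : ArrowClass C) {X Y : C} : (X ⟶ Y) → (X ⟶ Y) → Type (max u v w)
  | nil (f : X ⟶ Y) : HomotopySeq W f f
  | cons {f g k : X ⟶ Y} (H : Homotopy W f g) (S : HomotopySeq W g k) : HomotopySeq W f k

variable {W : ArrowClass C}

/-- The 2-cell `α₀ ≫ α₁⁻¹` of a cylinder. -/
def Cylinder.tilde {X : C} (K : Cylinder W X) : K.d₀ ≫ K.s ⟶ K.d₁ ≫ K.s :=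
  K.α₀.hom ≫ K.α₁.inv

section Hat

variable {D : Type u₁} [Bicategory.{w₁, v₁} D] (F : C ⥤ᵖ D)
  (hF : ∀ ⦃X Y : C⦄ (f : X ⟶ Y), W f → IsQuasiequiv (F.map f))

/-- If `F` maps `W` to quasiequivalences, this is the unique 2-cell `F d₀ ⟶ F d₁` whose
whiskering with `F s` is the image of `α₀ ≫ α₁⁻¹`, see `Cylinder.hat_whiskerRight`. -/
noncomputable def Cylinder.hat {X : C} (K : Cylinder W X) : F.map K.d₀ ⟶ F.map K.d₁ :=
  (((hF K.s K.s_mem).1 _ (F.map K.d₀) (F.map K.d₁)).2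
    ((F.mapComp K.d₀ K.s).inv ≫ F.map₂ K.tilde ≫ (F.mapComp K.d₁ K.s).hom)).choose

/-- The 2-cell of `D` associated with a `σ`-homotopy by a pseudofunctor which maps `W` to
quasiequivalences. -/
noncomputable def Homotopy.hat {X Y : C} {f g : X ⟶ Y} (H : Homotopy W f g) :
    F.map f ⟶ F.map g :=
  F.map₂ H.start ≫ (F.mapComp H.C.d₀ H.h).hom ≫ H.C.hat F hF ▷ F.map H.h ≫
    (F.mapComp H.C.d₁ H.h).inv ≫ F.map₂ H.finish

/-- The vertical composite of the 2-cells associated with the members of a sequence. -/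
noncomputable def HomotopySeq.hat {X Y : C} : {f g : X ⟶ Y} → HomotopySeq W f g →
    (F.map f ⟶ F.map g)
  | _, _, .nil f => 𝟙 (F.map f)
  | _, _, .cons H S => H.hat F hF ≫ S.hat

lemma Cylinder.hat_whiskerRight {X : C} (K : Cylinder W X) :
    K.hat F hF ▷ F.map K.s =
      (F.mapComp K.d₀ K.s).inv ≫ F.map₂ K.tilde ≫ (F.mapComp K.d₁ K.s).hom :=
  (((hF K.s K.s_mem).1 _ (F.map K.d₀) (F.map K.d₁)).2
    ((F.mapComp K.d₀ K.s).inv ≫ F.map₂ K.tilde ≫ (F.mapComp K.d₁ K.s).hom)).choose_spec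

lemma Cylinder.hat_unique {X : C} (K : Cylinder W X) (κ : F.map K.d₀ ⟶ F.map K.d₁)
    (hκ : κ ▷ F.map K.s =
      (F.mapComp K.d₀ K.s).inv ≫ F.map₂ K.tilde ≫ (F.mapComp K.d₁ K.s).hom) :
    K.hat F hF = κ :=
  ((hF K.s K.s_mem).1 _ (F.map K.d₀) (F.map K.d₁)).1
    ((K.hat_whiskerRight F hF).trans hκ.symm)

end Hat

/-- Composition of a cylinder with an arrow into its source. -/
def Cylinder.precomp {X' X : C} (l : X' ⟶ X) (K : Cylinder W X) : Cylinder W X' where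
  cyl := K.cyl
  base := K.base
  d₀ := l ≫ K.d₀
  d₁ := l ≫ K.d₁
  x := l ≫ K.x
  s := K.s
  s_mem := K.s_mem
  α₀ := α_ l K.d₀ K.s ≪≫ whiskerLeftIso l K.α₀
  α₁ := α_ l K.d₁ K.s ≪≫ whiskerLeftIso l K.α₁

/-- Composition of a homotopy with an arrow into its source. -/
def Homotopy.precomp {X' X Y : C} (l : X' ⟶ X) {f g : X ⟶ Y} (H : Homotopy W f g) :
    Homotopy W (l ≫ f) (l ≫ g) where
  C := H.C.precomp l
  h := H.h
  start := l ◁ H.start ≫ (α_ l H.C.d₀ H.h).inv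
  finish := (α_ l H.C.d₁ H.h).hom ≫ l ◁ H.finish

/-- Composition of a homotopy with an arrow out of its target. -/
def Homotopy.postcomp {X Y Y' : C} {f g : X ⟶ Y} (H : Homotopy W f g) (r : Y ⟶ Y') :
    Homotopy W (f ≫ r) (g ≫ r) where
  C := H.C
  h := H.h ≫ r
  start := H.start ▷ r ≫ (α_ H.C.d₀ H.h r).hom
  finish := (α_ H.C.d₁ H.h r).inv ≫ H.finish ▷ r

/-- The trivial homotopy given by a 2-cell. -/
def Homotopy.ofCell (hW : ∀ X : C, W (𝟙 X)) {X Y : C} {f g : X ⟶ Y} (μ : f ⟶ g) :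
    Homotopy W f g where
  C := { cyl := X, base := X, d₀ := 𝟙 X, d₁ := 𝟙 X, x := 𝟙 X, s := 𝟙 X, s_mem := hW X
         α₀ := λ_ (𝟙 X), α₁ := λ_ (𝟙 X) }
  h := f
  start := (λ_ f).inv
  finish := (λ_ f).hom ≫ μ

namespace HomotopySeq

/-- The one-term sequence. -/
def single {X Y : C} {f g : X ⟶ Y} (H : Homotopy W f g) : HomotopySeq W f g :=
  .cons H (.nil g)

/-- Juxtaposition of sequences. -/
def append {X Y : C} : {f g k : X ⟶ Y} → HomotopySeq W f g → HomotopySeq W g k →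
    HomotopySeq W f k
  | _, _, _, .nil _, T => T
  | _, _, _, .cons H S, T => .cons H (S.append T)

/-- Termwise composition with an arrow into the source. -/
def precomp {X' X Y : C} (l : X' ⟶ X) : {f g : X ⟶ Y} → HomotopySeq W f g →
    HomotopySeq W (l ≫ f) (l ≫ g)
  | _, _, .nil f => .nil (l ≫ f)
  | _, _, .cons H S => .cons (H.precomp l) (S.precomp l)

/-- Termwise composition with an arrow out of the target. -/
def postcomp {X Y Y' : C} (r : Y ⟶ Y') : {f g : X ⟶ Y} → HomotopySeq W f g →
    HomotopySeq W (f ≫ r) (g ≫ r)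
  | _, _, .nil f => .nil (f ≫ r)
  | _, _, .cons H S => .cons (H.postcomp r) (S.postcomp r)

end HomotopySeq

section HatLemmas

variable {D : Type u₁} [Bicategory.{w₁, v₁} D] (F : C ⥤ᵖ D)
  (hF : ∀ ⦃X Y : C⦄ (f : X ⟶ Y), W f → IsQuasiequiv (F.map f))

lemma map₂_associator_inv' {X Y Z T : C} (f : X ⟶ Y) (g : Y ⟶ Z) (h : Z ⟶ T) :
    F.map₂ (α_ f g h).inv =
      (F.mapComp f (g ≫ h)).hom ≫ F.map f ◁ (F.mapComp g h).hom ≫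
        (α_ (F.map f) (F.map g) (F.map h)).inv ≫ (F.mapComp f g).inv ▷ F.map h ≫
          (F.mapComp (f ≫ g) h).inv := by
  rw [Pseudofunctor.mapComp_assoc_right_hom_assoc]
  simp

lemma map₂_leftUnitor_inv' {X Y : C} (f : X ⟶ Y) :
    F.map₂ (λ_ f).inv =
      (λ_ (F.map f)).inv ≫ (F.mapId X).inv ▷ F.map f ≫ (F.mapComp (𝟙 X) f).inv := by
  rw [Pseudofunctor.mapComp_id_left_inv]
  simp

lemma map₂_rightUnitor_inv' {X Y : C} (f : X ⟶ Y) :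
    F.map₂ (ρ_ f).inv =
      (ρ_ (F.map f)).inv ≫ F.map f ◁ (F.mapId Y).inv ≫ (F.mapComp f (𝟙 Y)).inv := by
  rw [Pseudofunctor.mapComp_id_right_inv]
  simp

lemma Cylinder.hat_precomp {X' X : C} (l : X' ⟶ X) (K : Cylinder W X) :
    (K.precomp l).hat F hF =
      (F.mapComp l K.d₀).hom ≫ F.map l ◁ K.hat F hF ≫ (F.mapComp l K.d₁).inv := by
  apply Cylinder.hat_unique
  have ht : (K.precomp l).tilde =
      (α_ l K.d₀ K.s).hom ≫ l ◁ K.tilde ≫ (α_ l K.d₁ K.s).inv := by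
    simp only [Cylinder.tilde, Cylinder.precomp, Iso.trans_hom, Iso.trans_inv, whiskerLeftIso_hom,
      whiskerLeftIso_inv, whiskerLeft_comp]
    exact (Category.assoc _ _ _).trans (by simp only [Category.assoc])
  rw [ht]
  change _ ▷ F.map K.s = (F.mapComp (l ≫ K.d₀) K.s).inv ≫
    F.map₂ ((α_ l K.d₀ K.s).hom ≫ l ◁ K.tilde ≫ (α_ l K.d₁ K.s).inv) ≫
      (F.mapComp (l ≫ K.d₁) K.s).hom
  simp [map₂_associator_inv', K.hat_whiskerRight F hF]

lemma Homotopy.hat_precomp {X' X Y : C} (l : X' ⟶ X) {f g : X ⟶ Y} (H : Homotopy W f g) :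
    (H.precomp l).hat F hF =
      (F.mapComp l f).hom ≫ F.map l ◁ H.hat F hF ≫ (F.mapComp l g).inv := by
  have := Cylinder.hat_precomp F hF l H.C
  simp only [Homotopy.hat, Homotopy.precomp, this]
  simp [Cylinder.precomp, map₂_associator_inv']

lemma Homotopy.hat_postcomp {X Y Y' : C} {f g : X ⟶ Y} (H : Homotopy W f g) (r : Y ⟶ Y') :
    (H.postcomp r).hat F hF =
      (F.mapComp f r).hom ≫ H.hat F hF ▷ F.map r ≫ (F.mapComp g r).inv := by
  simp only [Homotopy.hat, Homotopy.postcomp]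
  simp [map₂_associator_inv', whisker_exchange_assoc]

lemma Homotopy.hat_ofCell (hW : ∀ X : C, W (𝟙 X)) {X Y : C} {f g : X ⟶ Y} (μ : f ⟶ g) :
    (Homotopy.ofCell hW μ).hat F hF = F.map₂ μ := by
  have h : (Homotopy.ofCell hW μ).C.hat F hF = 𝟙 (F.map (𝟙 X)) := by
    apply Cylinder.hat_unique
    change _ ▷ F.map (𝟙 X) = (F.mapComp (𝟙 X) (𝟙 X)).inv ≫
      F.map₂ ((λ_ (𝟙 X)).hom ≫ (λ_ (𝟙 X)).inv) ≫ (F.mapComp (𝟙 X) (𝟙 X)).hom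
    simp only [Iso.hom_inv_id, PrelaxFunctor.map₂_id, Category.id_comp, Iso.inv_hom_id,
      id_whiskerRight]
  refine Eq.trans (congrArg (fun κ : F.map (𝟙 X) ⟶ F.map (𝟙 X) =>
    F.map₂ (λ_ f).inv ≫ (F.mapComp (𝟙 X) f).hom ≫ κ ▷ F.map f ≫
      (F.mapComp (𝟙 X) f).inv ≫ F.map₂ ((λ_ f).hom ≫ μ)) h) ?_
  simp only [id_whiskerRight, Category.id_comp, Iso.hom_inv_id_assoc, ← F.map₂_comp,
    Iso.inv_hom_id_assoc]

lemma HomotopySeq.hat_single {X Y : C} {f g : X ⟶ Y} (H : Homotopy W f g) :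
    (single H).hat F hF = H.hat F hF := by
  simp [single, HomotopySeq.hat]

lemma HomotopySeq.hat_append {X Y : C} {f g k : X ⟶ Y} (S : HomotopySeq W f g)
    (T : HomotopySeq W g k) : (S.append T).hat F hF = S.hat F hF ≫ T.hat F hF := by
  induction S with
  | nil f => simp [append, HomotopySeq.hat]
  | cons H S ih => simp [append, HomotopySeq.hat, ih]

lemma HomotopySeq.hat_precomp {X' X Y : C} (l : X' ⟶ X) {f g : X ⟶ Y} (S : HomotopySeq W f g) :
    (S.precomp l).hat F hF =
      (F.mapComp l f).hom ≫ F.map l ◁ S.hat F hF ≫ (F.mapComp l g).inv := by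
  induction S with
  | nil f => simp [precomp, HomotopySeq.hat]
  | cons H S ih => simp [precomp, HomotopySeq.hat, ih, Homotopy.hat_precomp]

lemma HomotopySeq.hat_postcomp {X Y Y' : C} (r : Y ⟶ Y') {f g : X ⟶ Y}
    (S : HomotopySeq W f g) :
    (S.postcomp r).hat F hF =
      (F.mapComp f r).hom ≫ S.hat F hF ▷ F.map r ≫ (F.mapComp g r).inv := by
  induction S with
  | nil f => simp [postcomp, HomotopySeq.hat]
  | cons H S ih => simp [postcomp, HomotopySeq.hat, ih, Homotopy.hat_postcomp]

end HatLemmas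

end Homotopies


section SigmaBicategory

variable {C : Type u} [Bicategory.{w, v} C]

/-- A 2-functor out of `C` which maps the arrows of `W` to quasiequivalences. For the target it is
enough to consider bicategories with as many objects and arrows as `C` and with 2-cells in
`max u v w`: any other target can be replaced by the bicategory with the objects and arrows of `C`
and those 2-cells of the target which are generated, under compositions and under cancellation of
images of arrows of `W`, by the images of 2-cells of `C`. -/
structure TestFunctor (W : ArrowClass C) where
  D : Type u
  [bicategory : Bicategory.{max u v w, v} D]
  F : StrictPseudofunctor C D
  inverts : ∀ ⦃X Y : C⦄ (f : X ⟶ Y), W f → IsQuasiequiv (F.map f)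

attribute [instance] TestFunctor.bicategory

/-- The underlying pseudofunctor of a test functor. -/
abbrev TestFunctor.psf {W : ArrowClass C} (T : TestFunctor W) : C ⥤ᵖ T.D :=
  T.F.toPseudofunctor

/-- Two finite sequences of `σ`-homotopies are in the same class if they are sent to the same
2-cell by every 2-functor mapping `W` to quasiequivalences. -/
def HomotopySeq.setoid (W : ArrowClass C) {X Y : C} (f g : X ⟶ Y) :
    Setoid (HomotopySeq W f g) where
  r S S' := ∀ T : TestFunctor W, S.hat T.psf T.inverts = S'.hat T.psf T.inverts
  iseqv :=
    { refl := fun _ _ => rfl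
      symm := fun h T => (h T).symm
      trans := fun h h' T => (h T).trans (h' T) }

/-- Classes of finite sequences of `σ`-homotopies. -/
def HomotopyClass (W : ArrowClass C) {X Y : C} (f g : X ⟶ Y) : Type (max u v w) :=
  Quotient (HomotopySeq.setoid W f g)

namespace HomotopyClass

variable {W : ArrowClass C}

/-- The class of a sequence. -/
def mk {X Y : C} {f g : X ⟶ Y} (S : HomotopySeq W f g) : HomotopyClass W f g :=
  Quotient.mk _ S

/-- The value of a test functor on a class. -/
noncomputable def ev (T : TestFunctor W) {X Y : C} {f g : X ⟶ Y} (a : HomotopyClass W f g) :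
    T.psf.map f ⟶ T.psf.map g :=
  Quotient.lift (fun S : HomotopySeq W f g => S.hat T.psf T.inverts)
    (fun (_ _ : HomotopySeq W f g) (h : (HomotopySeq.setoid W f g).r _ _) => h T) a

lemma ext {X Y : C} {f g : X ⟶ Y} {a b : HomotopyClass W f g} (h : ∀ T, ev T a = ev T b) :
    a = b := by
  induction a using Quotient.inductionOn with | _ S =>
  induction b using Quotient.inductionOn with | _ S' =>
  exact Quotient.sound h

/-- The identity class. -/
def id {X Y : C} (f : X ⟶ Y) : HomotopyClass W f f := mk (.nil f)

/-- Vertical composition. -/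
def comp {X Y : C} {f g k : X ⟶ Y} (a : HomotopyClass W f g) (b : HomotopyClass W g k) :
    HomotopyClass W f k :=
  Quotient.map₂ HomotopySeq.append (fun S S' h T T' h' t => by
    rw [HomotopySeq.hat_append, HomotopySeq.hat_append, h t, h' t]) a b

/-- Whiskering with an arrow into the source. -/
def whiskerLeft {X' X Y : C} (l : X' ⟶ X) {f g : X ⟶ Y} (a : HomotopyClass W f g) :
    HomotopyClass W (l ≫ f) (l ≫ g) :=
  Quotient.map (HomotopySeq.precomp l) (fun S S' h t => by
    rw [HomotopySeq.hat_precomp, HomotopySeq.hat_precomp, h t]) a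

/-- Whiskering with an arrow out of the target. -/
def whiskerRight {X Y Y' : C} {f g : X ⟶ Y} (a : HomotopyClass W f g) (r : Y ⟶ Y') :
    HomotopyClass W (f ≫ r) (g ≫ r) :=
  Quotient.map (HomotopySeq.postcomp r) (fun S S' h t => by
    rw [HomotopySeq.hat_postcomp, HomotopySeq.hat_postcomp, h t]) a

/-- The class of the trivial homotopy given by a 2-cell. -/
def ofCell (hW : ∀ X : C, W (𝟙 X)) {X Y : C} {f g : X ⟶ Y} (μ : f ⟶ g) : HomotopyClass W f g :=
  mk (.single (.ofCell hW μ))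

variable (T : TestFunctor W)

@[simp] lemma ev_id {X Y : C} (f : X ⟶ Y) : ev T (id f) = 𝟙 (T.psf.map f) := rfl

@[simp] lemma ev_comp {X Y : C} {f g k : X ⟶ Y} (a : HomotopyClass W f g)
    (b : HomotopyClass W g k) : ev T (a.comp b) = ev T a ≫ ev T b := by
  induction a using Quotient.inductionOn with | _ S =>
  induction b using Quotient.inductionOn with | _ S' =>
  exact HomotopySeq.hat_append _ _ S S'

@[simp] lemma ev_whiskerLeft {X' X Y : C} (l : X' ⟶ X) {f g : X ⟶ Y} (a : HomotopyClass W f g) :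
    ev T (a.whiskerLeft l) =
      (T.psf.mapComp l f).hom ≫ T.psf.map l ◁ ev T a ≫ (T.psf.mapComp l g).inv := by
  induction a using Quotient.inductionOn with | _ S =>
  exact HomotopySeq.hat_precomp _ _ l S

@[simp] lemma ev_whiskerRight {X Y Y' : C} {f g : X ⟶ Y} (a : HomotopyClass W f g)
    (r : Y ⟶ Y') :
    ev T (a.whiskerRight r) =
      (T.psf.mapComp f r).hom ≫ ev T a ▷ T.psf.map r ≫ (T.psf.mapComp g r).inv := by
  induction a using Quotient.inductionOn with | _ S =>
  exact HomotopySeq.hat_postcomp _ _ r S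

@[simp] lemma ev_ofCell (hW : ∀ X : C, W (𝟙 X)) {X Y : C} {f g : X ⟶ Y} (μ : f ⟶ g) :
    ev T (ofCell hW μ) = T.psf.map₂ μ :=
  (HomotopySeq.hat_single _ _ _).trans (Homotopy.hat_ofCell _ _ hW μ)

section Laws

variable {hW : ∀ X : C, W (𝟙 X)}

lemma ofCell_comp {X Y : C} {f g k : X ⟶ Y} (μ : f ⟶ g) (ν : g ⟶ k) :
    (ofCell hW μ).comp (ofCell hW ν) = ofCell hW (μ ≫ ν) :=
  ext fun T => by simp

lemma ofCell_id {X Y : C} (f : X ⟶ Y) : ofCell hW (𝟙 f) = id f :=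
  ext fun T => by simp

lemma whiskerLeft_ofCell {X Y Z : C} (l : X ⟶ Y) {f g : Y ⟶ Z} (μ : f ⟶ g) :
    (ofCell hW μ).whiskerLeft l = ofCell hW (l ◁ μ) :=
  ext fun T => by simp

lemma whiskerRight_ofCell {X Y Z : C} {f g : X ⟶ Y} (μ : f ⟶ g) (r : Y ⟶ Z) :
    (ofCell hW μ).whiskerRight r = ofCell hW (μ ▷ r) :=
  ext fun T => by simp

lemma id_comp {X Y : C} {f g : X ⟶ Y} (a : HomotopyClass W f g) : (id f).comp a = a :=
  ext fun T => by simp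

lemma comp_id {X Y : C} {f g : X ⟶ Y} (a : HomotopyClass W f g) : a.comp (id g) = a :=
  ext fun T => by simp

lemma comp_assoc {X Y : C} {f g h k : X ⟶ Y} (a : HomotopyClass W f g) (b : HomotopyClass W g h)
    (c : HomotopyClass W h k) : (a.comp b).comp c = a.comp (b.comp c) :=
  ext fun T => by simp

lemma whiskerLeft_id {X Y Z : C} (f : X ⟶ Y) (g : Y ⟶ Z) :
    (id g : HomotopyClass W g g).whiskerLeft f = id (f ≫ g) :=
  ext fun T => by simp

lemma id_whiskerRight {X Y Z : C} (f : X ⟶ Y) (g : Y ⟶ Z) :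
    (id f : HomotopyClass W f f).whiskerRight g = id (f ≫ g) :=
  ext fun T => by simp

lemma whiskerLeft_comp {X Y Z : C} (f : X ⟶ Y) {g h i : Y ⟶ Z} (a : HomotopyClass W g h)
    (b : HomotopyClass W h i) :
    (a.comp b).whiskerLeft f = (a.whiskerLeft f).comp (b.whiskerLeft f) :=
  ext fun T => by simp

lemma comp_whiskerRight {X Y Z : C} {g h i : X ⟶ Y} (a : HomotopyClass W g h)
    (b : HomotopyClass W h i) (r : Y ⟶ Z) :
    (a.comp b).whiskerRight r = (a.whiskerRight r).comp (b.whiskerRight r) :=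
  ext fun T => by simp

lemma id_whiskerLeft {X Y : C} {f g : X ⟶ Y} (a : HomotopyClass W f g) :
    a.whiskerLeft (𝟙 X) = (ofCell hW (λ_ f).hom).comp (a.comp (ofCell hW (λ_ g).inv)) :=
  ext fun T => by
    have h := Bicategory.whisker_exchange (T.psf.mapId X).hom (ev T a)
    simp only [ev_whiskerLeft, ev_comp, ev_ofCell, Pseudofunctor.map₂_left_unitor,
      map₂_leftUnitor_inv', Category.assoc]
    rw [Bicategory.id_whiskerLeft] at h
    simp [← reassoc_of% h]

lemma whiskerRight_id {X Y : C} {f g : X ⟶ Y} (a : HomotopyClass W f g) :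
    a.whiskerRight (𝟙 Y) = (ofCell hW (ρ_ f).hom).comp (a.comp (ofCell hW (ρ_ g).inv)) :=
  ext fun T => by
    have h := Bicategory.whisker_exchange (ev T a) (T.psf.mapId Y).hom
    simp only [ev_whiskerRight, ev_comp, ev_ofCell, Pseudofunctor.map₂_right_unitor,
      map₂_rightUnitor_inv', Category.assoc]
    rw [Bicategory.whiskerRight_id] at h
    simp [reassoc_of% h]

lemma comp_whiskerLeft {X Y Z V : C} (f : X ⟶ Y) (g : Y ⟶ Z) {h k : Z ⟶ V}
    (a : HomotopyClass W h k) :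
    a.whiskerLeft (f ≫ g) = (ofCell hW (α_ f g h).hom).comp
      (((a.whiskerLeft g).whiskerLeft f).comp (ofCell hW (α_ f g k).inv)) :=
  ext fun T => by
    have h := Bicategory.whisker_exchange (T.psf.mapComp f g).hom (ev T a)
    rw [Bicategory.comp_whiskerLeft] at h
    simp [map₂_associator_inv', ← reassoc_of% h]

lemma whiskerRight_comp {X Y Z V : C} {f k : X ⟶ Y} (a : HomotopyClass W f k) (g : Y ⟶ Z)
    (h : Z ⟶ V) :
    a.whiskerRight (g ≫ h) = (ofCell hW (α_ f g h).inv).comp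
      (((a.whiskerRight g).whiskerRight h).comp (ofCell hW (α_ k g h).hom)) :=
  ext fun T => by
    have h := Bicategory.whisker_exchange (ev T a) (T.psf.mapComp g h).hom
    rw [Bicategory.whiskerRight_comp] at h
    simp [map₂_associator_inv', reassoc_of% h]

lemma whisker_assoc {X Y Z V : C} (f : X ⟶ Y) {g k : Y ⟶ Z} (a : HomotopyClass W g k)
    (h : Z ⟶ V) :
    (a.whiskerLeft f).whiskerRight h = (ofCell hW (α_ f g h).hom).comp
      (((a.whiskerRight h).whiskerLeft f).comp (ofCell hW (α_ f k h).inv)) :=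
  ext fun T => by simp [map₂_associator_inv']

lemma whisker_exchange {X Y Z : C} {f g : X ⟶ Y} {h i : Y ⟶ Z} (a : HomotopyClass W f g)
    (b : HomotopyClass W h i) :
    (b.whiskerLeft f).comp (a.whiskerRight i) = (a.whiskerRight h).comp (b.whiskerLeft g) :=
  ext fun T => by simp [Bicategory.whisker_exchange_assoc]

end Laws

end HomotopyClass

end SigmaBicategory

namespace ModelStructure

variable {C : Type u} [Bicategory.{w, v} C]

lemma w_id (M : ModelStructure C) (X : C) : M.W (𝟙 X) :=
  M.w_of_equiv _ ⟨𝟙 X, ⟨λ_ (𝟙 X)⟩, ⟨λ_ (𝟙 X)⟩⟩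

/-- The objects of the bicategory `Ho(C, W)`: those of `C`. -/
structure HoSigma (M : ModelStructure C) : Type u where
  obj : C

namespace HoSigma

variable {M : ModelStructure C}

/-- The arrows of `Ho(C, W)`: those of `C`. -/
@[ext]
structure Hom (X Y : HoSigma M) : Type v where
  arrow : X.obj ⟶ Y.obj

instance : CategoryStruct (HoSigma M) where
  Hom X Y := Hom X Y
  id X := ⟨𝟙 X.obj⟩
  comp f g := ⟨f.arrow ≫ g.arrow⟩

/-- The 2-cells of `Ho(C, W)`: the classes of finite sequences of `σ`-homotopies. -/
@[ext]
structure Hom₂ {X Y : HoSigma M} (f g : X ⟶ Y) : Type (max u v w) where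
  cls : HomotopyClass M.W f.arrow g.arrow

instance homCategory (X Y : HoSigma M) : Category (X ⟶ Y) where
  Hom f g := Hom₂ f g
  id f := ⟨.id f.arrow⟩
  comp a b := ⟨a.cls.comp b.cls⟩
  id_comp a := Hom₂.ext (HomotopyClass.id_comp a.cls)
  comp_id a := Hom₂.ext (HomotopyClass.comp_id a.cls)
  assoc a b c := Hom₂.ext (HomotopyClass.comp_assoc a.cls b.cls c.cls)

/-- The 2-cell of `Ho(C, W)` given by a 2-cell of `C`. -/
def proj₂ {X Y : HoSigma M} {f g : X ⟶ Y} (μ : f.arrow ⟶ g.arrow) : f ⟶ g :=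
  Hom₂.mk (.ofCell M.w_id μ)

/-- The invertible 2-cell of `Ho(C, W)` given by an invertible 2-cell of `C`. -/
def projIso {X Y : HoSigma M} {f g : X ⟶ Y} (μ : f.arrow ≅ g.arrow) : f ≅ g where
  hom := proj₂ μ.hom
  inv := proj₂ μ.inv
  hom_inv_id := Hom₂.ext ((HomotopyClass.ofCell_comp μ.hom μ.inv).trans
    (by rw [μ.hom_inv_id]; exact HomotopyClass.ofCell_id _))
  inv_hom_id := Hom₂.ext ((HomotopyClass.ofCell_comp μ.inv μ.hom).trans
    (by rw [μ.inv_hom_id]; exact HomotopyClass.ofCell_id _))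

lemma pentagon_aux {V X Y Z T : C} (f : V ⟶ X) (g : X ⟶ Y) (h : Y ⟶ Z) (k : Z ⟶ T) :
    ((HomotopyClass.ofCell M.w_id (α_ f g h).hom).whiskerRight k).comp
      ((HomotopyClass.ofCell M.w_id (α_ f (g ≫ h) k).hom).comp
        ((HomotopyClass.ofCell M.w_id (α_ g h k).hom).whiskerLeft f)) =
    (HomotopyClass.ofCell M.w_id (α_ (f ≫ g) h k).hom).comp
      (HomotopyClass.ofCell M.w_id (α_ f g (h ≫ k)).hom) := by
  rw [HomotopyClass.whiskerRight_ofCell, HomotopyClass.whiskerLeft_ofCell,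
    HomotopyClass.ofCell_comp, HomotopyClass.ofCell_comp, HomotopyClass.ofCell_comp,
    Bicategory.pentagon]

lemma triangle_aux {X Y Z : C} (f : X ⟶ Y) (g : Y ⟶ Z) :
    (HomotopyClass.ofCell M.w_id (α_ f (𝟙 Y) g).hom).comp
      ((HomotopyClass.ofCell M.w_id (λ_ g).hom).whiskerLeft f) =
    (HomotopyClass.ofCell M.w_id (ρ_ f).hom).whiskerRight g := by
  rw [HomotopyClass.whiskerRight_ofCell, HomotopyClass.whiskerLeft_ofCell,
    HomotopyClass.ofCell_comp, Bicategory.triangle]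

/-- The bicategory `Ho(C, W)`. -/
instance bicategory : Bicategory.{max u v w, v} (HoSigma M) where
  homCategory := homCategory
  whiskerLeft l _ _ a := Hom₂.mk ((Hom₂.cls a).whiskerLeft l.arrow)
  whiskerRight a r := Hom₂.mk ((Hom₂.cls a).whiskerRight r.arrow)
  associator f g h := projIso (α_ f.arrow g.arrow h.arrow)
  leftUnitor f := projIso (λ_ f.arrow)
  rightUnitor f := projIso (ρ_ f.arrow)
  whiskerLeft_id f g := Hom₂.ext (HomotopyClass.whiskerLeft_id f.arrow g.arrow)
  whiskerLeft_comp f _ _ _ a b := Hom₂.ext (HomotopyClass.whiskerLeft_comp f.arrow a.cls b.cls)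
  id_whiskerLeft a := Hom₂.ext (HomotopyClass.id_whiskerLeft a.cls)
  comp_whiskerLeft f g _ _ a :=
    Hom₂.ext (HomotopyClass.comp_whiskerLeft f.arrow g.arrow a.cls)
  id_whiskerRight f g := Hom₂.ext (HomotopyClass.id_whiskerRight f.arrow g.arrow)
  comp_whiskerRight a b r :=
    Hom₂.ext (HomotopyClass.comp_whiskerRight a.cls b.cls r.arrow)
  whiskerRight_id a := Hom₂.ext (HomotopyClass.whiskerRight_id a.cls)
  whiskerRight_comp a g h :=
    Hom₂.ext (HomotopyClass.whiskerRight_comp a.cls g.arrow h.arrow)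
  whisker_assoc f _ _ a h := Hom₂.ext (HomotopyClass.whisker_assoc f.arrow a.cls h.arrow)
  whisker_exchange a b := Hom₂.ext (HomotopyClass.whisker_exchange a.cls b.cls)
  pentagon f g h k := Hom₂.ext (pentagon_aux f.arrow g.arrow h.arrow k.arrow)
  triangle f g := Hom₂.ext (triangle_aux f.arrow g.arrow)

end HoSigma

end ModelStructure


namespace ModelStructure

variable {C : Type u} [Bicategory.{w, v} C] (M : ModelStructure C)

/-- The arrow to a terminal object is a fibration. -/
def IsFibrant (X : C) : Prop :=
  ∃ (T : C) (f : X ⟶ T), IsBiterminal T ∧ M.Fib f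

/-- The arrow from an initial object is a cofibration. -/
def IsCofibrant (X : C) : Prop :=
  ∃ (I : C) (f : I ⟶ X), IsBiinitial I ∧ M.Cof f

/-- The homotopy bicategory: the full sub-bicategory of `Ho(C, W)` on the fibrant-cofibrant
objects of `C`. -/
abbrev Ho : Type u :=
  InducedBicategory (HoSigma M)
    (fun X : { X : C // M.IsFibrant X ∧ M.IsCofibrant X } => (⟨X.1⟩ : HoSigma M))

variable {M}

/-- The arrow of `Ho(C)` given by an arrow of `C`. -/
def Ho.ofArrow {X Y : Ho M} (f : X.1 ⟶ Y.1) : X ⟶ Y :=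
  InducedBicategory.mkHom ⟨f⟩

/-- The 2-cell of `Ho(C)` given by a 2-cell of `C`. -/
def Ho.ofCell {X Y : Ho M} {f g : X.1 ⟶ Y.1} (μ : f ⟶ g) :
    (Ho.ofArrow f : X ⟶ Y) ⟶ Ho.ofArrow g :=
  InducedBicategory.mkHom₂ (HoSigma.proj₂ μ)

variable (M)

/-- A cofibrant replacement: trivial fibrations `p X : Q X ⟶ X` with `Q X` cofibrant, together with
choices of fillers for arrows and for 2-cells. It is not required to be functorial. -/
structure CofibrantReplacement where
  obj : C → C
  p : ∀ X : C, obj X ⟶ X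
  cofibrant : ∀ X : C, M.IsCofibrant (obj X)
  fib : ∀ X : C, M.Fib (p X)
  weq : ∀ X : C, M.W (p X)
  map : ∀ {X Y : C}, (X ⟶ Y) → (obj X ⟶ obj Y)
  ρ : ∀ {X Y : C} (f : X ⟶ Y), map f ≫ p Y ≅ p X ≫ f
  map₂ : ∀ {X Y : C} {f g : X ⟶ Y}, (f ⟶ g) → (map f ⟶ map g)
  map₂_p : ∀ {X Y : C} {f g : X ⟶ Y} (μ : f ⟶ g),
    map₂ μ ▷ p Y = (ρ f).hom ≫ p X ◁ μ ≫ (ρ g).inv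

/-- A fibrant replacement: trivial cofibrations `i X : X ⟶ R X` with `R X` fibrant, together with
choices of fillers for arrows and for 2-cells. It is not required to be functorial. -/
structure FibrantReplacement where
  obj : C → C
  i : ∀ X : C, X ⟶ obj X
  fibrant : ∀ X : C, M.IsFibrant (obj X)
  cof : ∀ X : C, M.Cof (i X)
  weq : ∀ X : C, M.W (i X)
  map : ∀ {X Y : C}, (X ⟶ Y) → (obj X ⟶ obj Y)
  lam : ∀ {X Y : C} (f : X ⟶ Y), f ≫ i Y ≅ i X ≫ map f
  map₂ : ∀ {X Y : C} {f g : X ⟶ Y}, (f ⟶ g) → (map f ⟶ map g)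
  i_map₂ : ∀ {X Y : C} {f g : X ⟶ Y} (μ : f ⟶ g),
    i X ◁ map₂ μ = (lam f).inv ≫ μ ▷ i Y ≫ (lam g).hom

variable {M}

lemma IsCofibrant.comp {X Y : C} (hX : M.IsCofibrant X) (f : X ⟶ Y) (hf : M.Cof f) :
    M.IsCofibrant Y := by
  obtain ⟨I, g, hI, hg⟩ := hX
  exact ⟨I, g ≫ f, hI, M.cof_comp g f hg hf⟩

section Replacement

variable (Q : M.CofibrantReplacement) (R : M.FibrantReplacement)

/-- The fibrant-cofibrant replacement on objects. -/
def rqObj (X : C) : Ho M :=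
  ⟨R.obj (Q.obj X), R.fibrant _, (Q.cofibrant X).comp (R.i _) (R.cof _)⟩

/-- The fibrant-cofibrant replacement on arrows. -/
def rqMap {X Y : C} (f : X ⟶ Y) : rqObj Q R X ⟶ rqObj Q R Y :=
  Ho.ofArrow (X := rqObj Q R X) (Y := rqObj Q R Y) (R.map (Q.map f))

/-- The fibrant-cofibrant replacement on 2-cells, as 2-cells of `Ho(C)`. -/
def rqMap₂ {X Y : C} {f g : X ⟶ Y} (μ : f ⟶ g) : rqMap Q R f ⟶ rqMap Q R g :=
  Ho.ofCell (X := rqObj Q R X) (Y := rqObj Q R Y) (R.map₂ (Q.map₂ μ))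

/-- An arrow of `C`, as an arrow of `Ho(C, W)`. -/
abbrev arr {X Y : C} (f : X ⟶ Y) : (⟨X⟩ : HoSigma M) ⟶ ⟨Y⟩ :=
  HoSigma.Hom.mk f

/-- A 2-cell of `C`, as a 2-cell of `Ho(C, W)`. -/
abbrev cell {X Y : C} {f g : X ⟶ Y} (μ : f ⟶ g) : (arr f : (⟨X⟩ : HoSigma M) ⟶ ⟨Y⟩) ⟶ arr g :=
  HoSigma.proj₂ μ

/-- The pseudofunctor structures on the assignation `rqObj`, `rqMap`, `rqMap₂` whose structural
2-cells are those induced by the replacement: they are the lifts, first along the arrows `p` and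
then along the arrows `i`, of the identities. -/
structure ReplacementPseudofunctor where
  mapId : ∀ X : C, rqMap Q R (𝟙 X) ≅ 𝟙 (rqObj Q R X)
  mapComp : ∀ {X Y Z : C} (f : X ⟶ Y) (g : Y ⟶ Z),
    rqMap Q R (f ≫ g) ≅ rqMap Q R f ≫ rqMap Q R g
  map₂_id : ∀ {X Y : C} (f : X ⟶ Y), rqMap₂ Q R (𝟙 f) = 𝟙 (rqMap Q R f)
  map₂_comp : ∀ {X Y : C} {f g h : X ⟶ Y} (μ : f ⟶ g) (ν : g ⟶ h),
    rqMap₂ Q R (μ ≫ ν) = rqMap₂ Q R μ ≫ rqMap₂ Q R ν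
  map₂_whisker_left : ∀ {X Y Z : C} (f : X ⟶ Y) {g h : Y ⟶ Z} (μ : g ⟶ h),
    rqMap₂ Q R (f ◁ μ) =
      (mapComp f g).hom ≫ rqMap Q R f ◁ rqMap₂ Q R μ ≫ (mapComp f h).inv
  map₂_whisker_right : ∀ {X Y Z : C} {f g : X ⟶ Y} (μ : f ⟶ g) (h : Y ⟶ Z),
    rqMap₂ Q R (μ ▷ h) =
      (mapComp f h).hom ≫ rqMap₂ Q R μ ▷ rqMap Q R h ≫ (mapComp g h).inv
  map₂_associator : ∀ {X Y Z V : C} (f : X ⟶ Y) (g : Y ⟶ Z) (h : Z ⟶ V),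
    rqMap₂ Q R (α_ f g h).hom =
      (mapComp (f ≫ g) h).hom ≫ (mapComp f g).hom ▷ rqMap Q R h ≫
        (α_ (rqMap Q R f) (rqMap Q R g) (rqMap Q R h)).hom ≫
          rqMap Q R f ◁ (mapComp g h).inv ≫ (mapComp f (g ≫ h)).inv
  map₂_left_unitor : ∀ {X Y : C} (f : X ⟶ Y),
    rqMap₂ Q R (λ_ f).hom =
      (mapComp (𝟙 X) f).hom ≫ (mapId X).hom ▷ rqMap Q R f ≫ (λ_ (rqMap Q R f)).hom
  map₂_right_unitor : ∀ {X Y : C} (f : X ⟶ Y),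
    rqMap₂ Q R (ρ_ f).hom =
      (mapComp f (𝟙 Y)).hom ≫ rqMap Q R f ◁ (mapId Y).hom ≫ (ρ_ (rqMap Q R f)).hom
  /-- the lift `𝟙 (Q X) ⟶ Q (𝟙 X)` of the identity -/
  ξ : ∀ X : C, (arr (𝟙 (Q.obj X)) : (⟨Q.obj X⟩ : HoSigma M) ⟶ ⟨Q.obj X⟩) ⟶ arr (Q.map (𝟙 X))
  ξ_p : ∀ X : C, ξ X ▷ arr (Q.p X) =
    cell ((λ_ (Q.p X)).hom ≫ (ρ_ (Q.p X)).inv ≫ (Q.ρ (𝟙 X)).inv)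
  i_mapId : ∀ X : C, arr (R.i (Q.obj X)) ◁ (mapId X).inv.hom =
    cell ((ρ_ (R.i (Q.obj X))).hom ≫ (λ_ (R.i (Q.obj X))).inv) ≫
      ξ X ▷ arr (R.i (Q.obj X)) ≫ cell (R.lam (Q.map (𝟙 X))).hom
  /-- the lift `Q f ≫ Q g ⟶ Q (f ≫ g)` of the identity -/
  φ : ∀ {X Y Z : C} (f : X ⟶ Y) (g : Y ⟶ Z),
    (arr (Q.map f ≫ Q.map g) : (⟨Q.obj X⟩ : HoSigma M) ⟶ ⟨Q.obj Z⟩) ⟶ arr (Q.map (f ≫ g))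
  φ_p : ∀ {X Y Z : C} (f : X ⟶ Y) (g : Y ⟶ Z), φ f g ▷ arr (Q.p Z) =
    cell ((α_ _ _ _).hom ≫ Q.map f ◁ (Q.ρ g).hom ≫ (α_ _ _ _).inv ≫ (Q.ρ f).hom ▷ g ≫
      (α_ _ _ _).hom ≫ (Q.ρ (f ≫ g)).inv)
  i_mapComp : ∀ {X Y Z : C} (f : X ⟶ Y) (g : Y ⟶ Z),
    arr (R.i (Q.obj X)) ◁ (mapComp f g).inv.hom =
      cell ((α_ _ _ _).inv ≫ (R.lam (Q.map f)).inv ▷ R.map (Q.map g) ≫ (α_ _ _ _).hom ≫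
        Q.map f ◁ (R.lam (Q.map g)).inv ≫ (α_ _ _ _).inv) ≫
      φ f g ▷ arr (R.i (Q.obj Z)) ≫ cell (R.lam (Q.map (f ≫ g))).hom

variable {Q R}

/-- The pseudofunctor `r : C → Ho(C)`. -/
def ReplacementPseudofunctor.r (S : ReplacementPseudofunctor Q R) : C ⥤ᵖ Ho M where
  obj := rqObj Q R
  map := rqMap Q R
  map₂ := rqMap₂ Q R
  map₂_id := S.map₂_id
  map₂_comp := S.map₂_comp
  mapId := S.mapId
  mapComp := S.mapComp
  map₂_whisker_left := S.map₂_whisker_left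
  map₂_whisker_right := S.map₂_whisker_right
  map₂_associator := S.map₂_associator
  map₂_left_unitor := S.map₂_left_unitor
  map₂_right_unitor := S.map₂_right_unitor

end Replacement

end ModelStructure

section Universal

universe w₂ v₂ u₂

variable {B : Type u} [Bicategory.{w, v} B] {B' : Type u₁} [Bicategory.{w₁, v₁} B']
  {D : Type u₂} [Bicategory.{w₂, v₂} D]

/-- `F` maps the arrows of `W` to equivalences. -/
def Inverts (W : ArrowClass B) (F : B ⥤ᵖ D) : Prop :=
  ∀ ⦃X Y : B⦄ (f : X ⟶ Y), W f → IsEquiv (F.map f)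

/-- A pseudofunctor is a pseudoequivalence if it has an inverse up to pseudonatural
equivalences. -/
def IsPseudoequivalence (F : B ⥤ᵖ B') : Prop :=
  ∃ G : B' ⥤ᵖ B, (∃ α : F.comp G ⟶ Pseudofunctor.id B, IsEquiv α) ∧
    (∃ β : G.comp F ⟶ Pseudofunctor.id B', IsEquiv β)

/-- Precomposition of a pseudonatural transformation with a pseudofunctor. -/
def precompTrans (r : B ⥤ᵖ B') {F G : B' ⥤ᵖ D} (θ : F ⟶ G) : r.comp F ⟶ r.comp G where
  app X := θ.app (r.obj X)
  naturality f := θ.naturality (r.map f)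
  naturality_naturality η := θ.naturality_naturality (r.map₂ η)
  naturality_id X := by
    have h := θ.naturality_naturality (r.mapId X).hom
    have h' := θ.naturality_id (r.obj X)
    have key : (θ.naturality (r.map (𝟙 X))).hom ≫ θ.app (r.obj X) ◁
        (G.map₂ (r.mapId X).hom ≫ (G.mapId (r.obj X)).hom) =
        (F.map₂ (r.mapId X).hom ≫ (F.mapId (r.obj X)).hom) ▷ θ.app (r.obj X) ≫
          (λ_ (θ.app (r.obj X))).hom ≫ (ρ_ (θ.app (r.obj X))).inv := by
      rw [whiskerLeft_comp, ← reassoc_of% h, h', comp_whiskerRight, Category.assoc]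
    exact key
  naturality_comp {X Y Z} f g := by
    have h := θ.naturality_naturality (r.mapComp f g).hom
    have h' := θ.naturality_comp (r.map f) (r.map g)
    have key : (θ.naturality (r.map (f ≫ g))).hom ≫ θ.app (r.obj X) ◁
        (G.map₂ (r.mapComp f g).hom ≫ (G.mapComp (r.map f) (r.map g)).hom) =
        (F.map₂ (r.mapComp f g).hom ≫ (F.mapComp (r.map f) (r.map g)).hom) ▷ θ.app (r.obj Z) ≫
          (α_ _ _ _).hom ≫ F.map (r.map f) ◁ (θ.naturality (r.map g)).hom ≫
          (α_ _ _ _).inv ≫ (θ.naturality (r.map f)).hom ▷ G.map (r.map g) ≫ (α_ _ _ _).hom := by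
      rw [whiskerLeft_comp, ← reassoc_of% h, h', comp_whiskerRight, Category.assoc]
    exact key

/-- Precomposition of a modification with a pseudofunctor. -/
def precompMod (r : B ⥤ᵖ B') {F G : B' ⥤ᵖ D} {θ η : F ⟶ G} (Γ : θ ⟶ η) :
    precompTrans r θ ⟶ precompTrans r η where
  as :=
    { app := fun X => Γ.as.app (r.obj X)
      naturality := fun f => Γ.as.naturality (r.map f) }

lemma whiskerLeft_id_comp_eq {X Y Z : D} (f : X ⟶ Y) (g : Y ⟶ Z) {h : X ⟶ Z}
    (a : f ≫ g ⟶ h) : f ◁ 𝟙 g ≫ a = a := by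
  simp

lemma comp_id_whiskerRight_eq {X Y Z : D} (f : X ⟶ Y) (g : Y ⟶ Z) {h : X ⟶ Z}
    (a : h ⟶ f ≫ g) : a ≫ 𝟙 f ▷ g = a := by
  simp

lemma id_comp_comp_id {X Y : D} {f g : X ⟶ Y} (a : f ⟶ g) : 𝟙 f ≫ a ≫ 𝟙 g = a := by
  simp

lemma assoc_aux {X Y Z V : D} (f : X ⟶ Y) (g : Y ⟶ Z) (h : Z ⟶ V) :
    (α_ f g h).hom = 𝟙 ((f ≫ g) ≫ h) ≫ 𝟙 (f ≫ g) ▷ h ≫ (α_ f g h).hom ≫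
      f ◁ 𝟙 (g ≫ h) ≫ 𝟙 (f ≫ g ≫ h) := by
  simp

lemma leftUnitor_aux {X Y : D} (f : X ⟶ Y) :
    (λ_ f).hom = 𝟙 (𝟙 X ≫ f) ≫ 𝟙 (𝟙 X) ▷ f ≫ (λ_ f).hom := by
  simp

lemma rightUnitor_aux {X Y : D} (f : X ⟶ Y) :
    (ρ_ f).hom = 𝟙 (f ≫ 𝟙 Y) ≫ f ◁ 𝟙 (𝟙 Y) ≫ (ρ_ f).hom := by
  simp

/-- The pseudofunctor `r^*` between bicategories of pseudofunctors. -/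
def precomp (r : B ⥤ᵖ B') (D : Type u₂) [Bicategory.{w₂, v₂} D] : (B' ⥤ᵖ D) ⥤ᵖ (B ⥤ᵖ D) where
  obj F := r.comp F
  map θ := precompTrans r θ
  map₂ Γ := precompMod r Γ
  mapId F := Pseudofunctor.StrongTrans.isoMk (fun X => Iso.refl (𝟙 (F.obj (r.obj X))))
    (fun {X Y} f => by
      have key : F.map (r.map f) ◁ 𝟙 (𝟙 (F.obj (r.obj Y))) ≫ (ρ_ (F.map (r.map f))).hom ≫
          (λ_ (F.map (r.map f))).inv =
          ((ρ_ (F.map (r.map f))).hom ≫ (λ_ (F.map (r.map f))).inv) ≫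
            𝟙 (𝟙 (F.obj (r.obj X))) ▷ F.map (r.map f) := by
        simp only [whiskerLeft_id, id_whiskerRight, Category.id_comp, Category.comp_id]
      exact key)
  mapComp θ η := Pseudofunctor.StrongTrans.isoMk
    (fun X => Iso.refl (θ.app (r.obj X) ≫ η.app (r.obj X)))
    (fun {X Y} f => (whiskerLeft_id_comp_eq _ _ _).trans (comp_id_whiskerRight_eq _ _ _).symm)
  map₂_id θ := by ext X; rfl
  map₂_comp Γ Γ' := by ext X; rfl
  map₂_whisker_left θ _ _ Γ := by ext X; exact (id_comp_comp_id _).symm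
  map₂_whisker_right Γ θ := by ext X; exact (id_comp_comp_id _).symm
  map₂_associator θ η κ := by
    ext X
    exact assoc_aux (θ.app (r.obj X)) (η.app (r.obj X)) (κ.app (r.obj X))
  map₂_left_unitor θ := by ext X; exact leftUnitor_aux (θ.app (r.obj X))
  map₂_right_unitor θ := by ext X; exact rightUnitor_aux (θ.app (r.obj X))

lemma IsEquiv.map (F : B ⥤ᵖ D) {X Y : B} {f : X ⟶ Y} (hf : IsEquiv f) : IsEquiv (F.map f) := by
  obtain ⟨g, ⟨a⟩, ⟨b⟩⟩ := hf
  exact ⟨F.map g, ⟨(F.mapComp f g).symm ≪≫ F.map₂Iso a ≪≫ F.mapId X⟩,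
    ⟨(F.mapComp g f).symm ≪≫ F.map₂Iso b ≪≫ F.mapId Y⟩⟩

lemma Inverts.comp {W : ArrowClass B} {r : B ⥤ᵖ B'} (hr : Inverts W r) (F : B' ⥤ᵖ D) :
    Inverts W (r.comp F) :=
  fun _ _ f hf => (hr f hf).map F

/-- The full sub-bicategory of the bicategory of pseudofunctors `B ⥤ᵖ D` on those which map the
arrows of `W` to equivalences. -/
abbrev HomInv (W : ArrowClass B) (D : Type u₂) [Bicategory.{w₂, v₂} D] :=
  InducedBicategory (B ⥤ᵖ D) (fun F : { F : B ⥤ᵖ D // Inverts W F } => F.1)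

/-- The pseudofunctor `r^*`, with values in `HomInv W D`, for a pseudofunctor `r` which maps the
arrows of `W` to equivalences. -/
def precompInv {W : ArrowClass B} {r : B ⥤ᵖ B'} (hr : Inverts W r)
    (D : Type u₂) [Bicategory.{w₂, v₂} D] : (B' ⥤ᵖ D) ⥤ᵖ HomInv W D where
  obj F := ⟨r.comp F, hr.comp F⟩
  map θ := InducedBicategory.mkHom ((precomp r D).map θ)
  map₂ Γ := InducedBicategory.mkHom₂ ((precomp r D).map₂ Γ)
  mapId F := InducedBicategory.isoMk ((precomp r D).mapId F)
  mapComp θ η := InducedBicategory.isoMk ((precomp r D).mapComp θ η)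
  map₂_id θ := InducedBicategory.hom₂_ext ((precomp r D).map₂_id θ)
  map₂_comp Γ Γ' := InducedBicategory.hom₂_ext ((precomp r D).map₂_comp Γ Γ')
  map₂_whisker_left θ _ _ Γ :=
    InducedBicategory.hom₂_ext ((precomp r D).map₂_whisker_left θ Γ)
  map₂_whisker_right Γ θ :=
    InducedBicategory.hom₂_ext ((precomp r D).map₂_whisker_right Γ θ)
  map₂_associator θ η κ :=
    InducedBicategory.hom₂_ext ((precomp r D).map₂_associator θ η κ)
  map₂_left_unitor θ := InducedBicategory.hom₂_ext ((precomp r D).map₂_left_unitor θ)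
  map₂_right_unitor θ := InducedBicategory.hom₂_ext ((precomp r D).map₂_right_unitor θ)

end Universal

end ModelBicat

/-! By definition, 2-cells of `Ho(C, W)` are separated by the 2-functors which send `W` to
quasiequivalences, so weak equivalences can be cancelled there on either side
(`HoSigma.isCancellable`). The two-dimensional lifting property lifts 2-cells of `C` along trivial
fibrations out of cofibrant objects, and extends them along trivial cofibrations into fibrant
objects. Such lifts are not unique in `C`, but they become unique in `Ho(C, W)`. Hence the arbitrary
choices in `Q` and `R` assemble into pseudofunctors: each law for `Q` holds after whiskering with
`p`, each law for `RQ` after whiskering with `i`, and both can be cancelled (`LiftData`,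
`ColiftData`). The Whitehead argument `isEquiv_of_w` then shows that `r` inverts `W`.

A pseudofunctor on `C` which inverts `W` extends to `Ho(C, W)`, unchanged on objects and arrows
(`extend`). That its values on homotopies depend only on the class, whatever the universes of the
target, is `HomotopySeq.hat_eq_hat`. The 2-cells of `Ho(C, W)` are generated by those of `C` under
vertical composition, right whiskering and right cancellation of `W` (`HoSigma.induction_cell`), so
pseudonatural transformations extend as well.

For objects of the functor bicategory, let `F'` be the restriction to `Ho(C)` of the extension of
`F`. The zigzag of weak equivalences from `X` through `QX` to `RQX` becomes an equivalence between
`F' r` and `F`. The same zigzag inside `Ho(C)` is an equivalence `u` from the endomorphism `endo`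
induced by `r` to the identity (`exists_endo_equiv`). A transformation `θ` between restrictions
along `r` extends to `Ho(C, W)`, restricts to `Ho(C)`, and is conjugated by `u` into the required
transformation. For a modification, naturality along `u` determines the component at `A` from the
one at `rA`. On `C` itself, modifications are determined and constructed by their components at
fibrant-cofibrant objects (`modification_ext`, `exists_modification`).

Thus `r^*` is an equivalence on hom-categories and is surjective on objects up to equivalence. Any
such pseudofunctor is a pseudoequivalence (`IsLocalEquivalence.isPseudoequivalence`), because a
pseudonatural transformation with equivalences as components is an equivalence (`isEquiv_of_app`).
-/

namespace ModelBicat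

/-! ### Equivalences, quasiequivalences and cancellation of arrows. -/

section Equivalences

variable {B : Type u} [Bicategory.{w, v} B]

lemma IsEquiv.of_iso {X Y : B} {f g : X ⟶ Y} (hf : IsEquiv f) (φ : f ≅ g) : IsEquiv g := by
  obtain ⟨k, ⟨a⟩, ⟨b⟩⟩ := hf
  exact ⟨k, ⟨whiskerRightIso φ.symm k ≪≫ a⟩, ⟨whiskerLeftIso k φ.symm ≪≫ b⟩⟩

lemma IsEquiv.comp {X Y Z : B} {f : X ⟶ Y} {g : Y ⟶ Z} (hf : IsEquiv f) (hg : IsEquiv g) :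
    IsEquiv (f ≫ g) := by
  obtain ⟨f', ⟨a⟩, ⟨b⟩⟩ := hf
  obtain ⟨g', ⟨c⟩, ⟨d⟩⟩ := hg
  exact ⟨g' ≫ f', ⟨α_ _ _ _ ≪≫ whiskerLeftIso f ((α_ _ _ _).symm ≪≫ whiskerRightIso c f' ≪≫
      λ_ f') ≪≫ a⟩, ⟨α_ _ _ _ ≪≫ whiskerLeftIso g' ((α_ _ _ _).symm ≪≫ whiskerRightIso b g ≪≫
      λ_ g) ≪≫ d⟩⟩

/-- No triangle identity between `a` and `b` is needed. Faithfulness holds because whiskering with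
`f ≫ g` is conjugate to the identity. For fullness, the candidate is `γ ▷ g` conjugated by `a`; its
whiskering with `f` is compared with `γ` after a further whiskering with `g`, which is faithful by
`b`. -/
lemma whiskerRight_bijective_of_comp_iso_id {X Y : B} {f : X ⟶ Y} {g : Y ⟶ X}
    (a : f ≫ g ≅ 𝟙 X) (b : g ≫ f ≅ 𝟙 Y) (Z : B) (h k : Z ⟶ X) :
    Function.Bijective (fun α : h ⟶ k => α ▷ f) := by
  have inj : ∀ {X Y : B} {f : X ⟶ Y} {g : Y ⟶ X} (_ : f ≫ g ≅ 𝟙 X) {Z : B} {h k : Z ⟶ X}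
      {α β : h ⟶ k}, α ▷ f = β ▷ f → α = β := by
    intro X Y f g a Z h k α β e
    have e' : α ▷ (f ≫ g) = β ▷ (f ≫ g) := by
      rw [whiskerRight_comp, whiskerRight_comp, e]
    have e'' : α ▷ 𝟙 X = β ▷ 𝟙 X := by
      have h1 := whisker_exchange α a.hom
      have h2 := whisker_exchange β a.hom
      rw [e', ← h2] at h1
      exact (cancel_epi _).1 h1
    rw [whiskerRight_id, whiskerRight_id] at e''
    simpa using e''
  refine ⟨fun α β e => inj a e, fun γ => ?_⟩
  refine ⟨(ρ_ h).inv ≫ h ◁ a.inv ≫ (α_ h f g).inv ≫ γ ▷ g ≫ (α_ k f g).hom ≫ k ◁ a.hom ≫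
    (ρ_ k).hom, ?_⟩
  refine inj b ?_
  dsimp only
  generalize hδ : (ρ_ h).inv ≫ h ◁ a.inv ≫ (α_ h f g).inv ≫ γ ▷ g ≫ (α_ k f g).hom ≫ k ◁ a.hom ≫
    (ρ_ k).hom = δ
  have h1 : δ ▷ (f ≫ g) = (α_ h f g).inv ≫ γ ▷ g ≫ (α_ k f g).hom := by
    have h2 := whisker_exchange δ a.hom
    rw [whiskerRight_id, ← hδ] at h2
    rw [hδ] at h2
    rw [← cancel_mono (k ◁ a.hom), ← h2, ← hδ]
    simp
  rw [whiskerRight_comp] at h1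
  simpa using h1

lemma whiskerLeft_bijective_of_comp_iso_id {X Y : B} {f : X ⟶ Y} {g : Y ⟶ X}
    (a : f ≫ g ≅ 𝟙 X) (b : g ≫ f ≅ 𝟙 Y) (Z : B) (h k : Y ⟶ Z) :
    Function.Bijective (fun α : h ⟶ k => f ◁ α) := by
  have inj : ∀ {X Y : B} {f : X ⟶ Y} {g : Y ⟶ X} (_ : g ≫ f ≅ 𝟙 Y) {Z : B} {h k : Y ⟶ Z}
      {α β : h ⟶ k}, f ◁ α = f ◁ β → α = β := by
    intro X Y f g b Z h k α β e
    have e' : (g ≫ f) ◁ α = (g ≫ f) ◁ β := by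
      rw [comp_whiskerLeft, comp_whiskerLeft, e]
    have e'' : 𝟙 Y ◁ α = 𝟙 Y ◁ β := by
      have h1 := whisker_exchange b.hom α
      have h2 := whisker_exchange b.hom β
      rw [e', h2] at h1
      exact ((cancel_epi _).1 h1).symm
    rw [id_whiskerLeft, id_whiskerLeft] at e''
    simpa using e''
  refine ⟨fun α β e => inj b e, fun γ => ?_⟩
  refine ⟨(λ_ h).inv ≫ b.inv ▷ h ≫ (α_ g f h).hom ≫ g ◁ γ ≫ (α_ g f k).inv ≫ b.hom ▷ k ≫
    (λ_ k).hom, ?_⟩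
  refine inj a ?_
  dsimp only
  generalize hδ : (λ_ h).inv ≫ b.inv ▷ h ≫ (α_ g f h).hom ≫ g ◁ γ ≫ (α_ g f k).inv ≫ b.hom ▷ k ≫
    (λ_ k).hom = δ
  have h1 : (g ≫ f) ◁ δ = (α_ g f h).hom ≫ g ◁ γ ≫ (α_ g f k).inv := by
    have h2 := whisker_exchange b.hom δ
    rw [id_whiskerLeft] at h2
    rw [← cancel_mono (b.hom ▷ k), h2, ← hδ]
    simp
  rw [comp_whiskerLeft] at h1
  simpa using h1

lemma IsEquiv.isQuasiequiv {X Y : B} {f : X ⟶ Y} (hf : IsEquiv f) : IsQuasiequiv f := by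
  obtain ⟨g, ⟨a⟩, ⟨b⟩⟩ := hf
  exact ⟨whiskerRight_bijective_of_comp_iso_id a b, whiskerLeft_bijective_of_comp_iso_id a b⟩

/-- An arrow such that composing with it, on either side, is faithful on 2-cells. -/
structure IsCancellable {X Y : B} (f : X ⟶ Y) : Prop where
  right : ∀ {Z : B} {g h : Z ⟶ X} {α β : g ⟶ h}, α ▷ f = β ▷ f → α = β
  left : ∀ {Z : B} {g h : Y ⟶ Z} {α β : g ⟶ h}, f ◁ α = f ◁ β → α = β

lemma IsQuasiequiv.isCancellable {X Y : B} {f : X ⟶ Y} (hf : IsQuasiequiv f) :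
    IsCancellable f :=
  ⟨fun e => (hf.1 _ _ _).1 e, fun e => (hf.2 _ _ _).1 e⟩

lemma IsEquiv.isCancellable {X Y : B} {f : X ⟶ Y} (hf : IsEquiv f) : IsCancellable f :=
  hf.isQuasiequiv.isCancellable

/-- The isomorphism reflected by composition on the right with a quasiequivalence. -/
lemma IsQuasiequiv.exists_iso_right {X Y : B} {f : X ⟶ Y} (hf : IsQuasiequiv f) {Z : B}
    {g h : Z ⟶ X} (φ : g ≫ f ≅ h ≫ f) : ∃ ψ : g ≅ h, ψ.hom ▷ f = φ.hom := by
  obtain ⟨a, ha⟩ := (hf.1 _ _ _).2 φ.hom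
  obtain ⟨b, hb⟩ := (hf.1 _ _ _).2 φ.inv
  dsimp only at ha hb
  exact ⟨⟨a, b, hf.isCancellable.right (by simp [ha, hb]),
    hf.isCancellable.right (by simp [ha, hb])⟩, ha⟩

end Equivalences

/-! ### Transport of pseudofunctor laws along cancellable arrows. -/

section Transfer

variable {C : Type u} [Bicategory.{w, v} C] {B : Type u₁} [Bicategory.{w₁, v₁} B]

/-- The data of a pseudonatural transformation to a pseudofunctor `K`, with components `e` which
can be cancelled on the right, whose source is not known to satisfy the laws of a pseudofunctor. -/
structure LiftData (K : C ⥤ᵖ B) where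
  obj : C → B
  e : ∀ X : C, obj X ⟶ K.obj X
  cancel : ∀ {X : C} {Z : B} {g h : Z ⟶ obj X} {α β : g ⟶ h}, α ▷ e X = β ▷ e X → α = β
  map : ∀ {X Y : C}, (X ⟶ Y) → (obj X ⟶ obj Y)
  nat : ∀ {X Y : C} (f : X ⟶ Y), map f ≫ e Y ≅ e X ≫ K.map f
  map₂ : ∀ {X Y : C} {f g : X ⟶ Y}, (f ⟶ g) → (map f ⟶ map g)
  map₂_e : ∀ {X Y : C} {f g : X ⟶ Y} (μ : f ⟶ g),
    map₂ μ ▷ e Y ≫ (nat g).hom = (nat f).hom ≫ e X ◁ K.map₂ μ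
  mapId : ∀ X : C, map (𝟙 X) ≅ 𝟙 (obj X)
  mapId_e : ∀ X : C, (nat (𝟙 X)).hom ≫ e X ◁ (K.mapId X).hom =
    (mapId X).hom ▷ e X ≫ (λ_ (e X)).hom ≫ (ρ_ (e X)).inv
  mapComp : ∀ {X Y Z : C} (f : X ⟶ Y) (g : Y ⟶ Z), map (f ≫ g) ≅ map f ≫ map g
  mapComp_e : ∀ {X Y Z : C} (f : X ⟶ Y) (g : Y ⟶ Z),
    (nat (f ≫ g)).hom ≫ e X ◁ (K.mapComp f g).hom =
      (mapComp f g).hom ▷ e Z ≫ (α_ _ _ _).hom ≫ map f ◁ (nat g).hom ≫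
        (α_ _ _ _).inv ≫ (nat f).hom ▷ K.map g ≫ (α_ _ _ _).hom

namespace LiftData

variable {K : C ⥤ᵖ B} (L : LiftData K)

/-- Since `e` can be cancelled, `map₂ μ` is the only 2-cell compatible with the comparison cells
`nat`. Every law for `L` is proved by showing that its right-hand side has this compatibility. -/
lemma map₂_eq {X Y : C} {f g : X ⟶ Y} (μ : f ⟶ g) {a : L.map f ⟶ L.map g}
    (h : a ▷ L.e Y ≫ (L.nat g).hom = (L.nat f).hom ≫ L.e X ◁ K.map₂ μ) : L.map₂ μ = a := by
  refine L.cancel ((cancel_mono (L.nat g).hom).1 ?_)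
  rw [h, L.map₂_e]

lemma map₂_whisker_left {X Y Z : C} (f : X ⟶ Y) {g h : Y ⟶ Z} (μ : g ⟶ h) :
    L.map₂ (f ◁ μ) = (L.mapComp f g).hom ≫ L.map f ◁ L.map₂ μ ≫ (L.mapComp f h).inv := by
  refine L.map₂_eq _ ?_
  rw [← cancel_mono (L.e X ◁ (K.mapComp f h).hom)]
  have h1 := L.mapComp_e f h
  have h2 := L.mapComp_e f g
  have h3 := congrArg (fun z => (L.mapComp f g).hom ▷ L.e Z ≫ (α_ _ _ _).hom ≫
    L.map f ◁ z ≫ (α_ _ _ _).inv ≫ (L.nat f).hom ▷ K.map h ≫ (α_ _ _ _).hom) (L.map₂_e μ)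
  simp only [Bicategory.whiskerLeft_comp] at h3
  simp only [Category.assoc, h1, comp_whiskerRight, K.map₂_whisker_left, whisker_assoc,
    Bicategory.whiskerLeft_comp] at h3 ⊢
  simp only [inv_hom_whiskerRight_assoc, Iso.inv_hom_id_assoc]
  rw [h3, reassoc_of% h2, whiskerLeft_inv_hom, Category.comp_id, ← associator_naturality_right,
    ← whisker_exchange_assoc]
  simp

lemma map₂_whisker_right {X Y Z : C} {f g : X ⟶ Y} (μ : f ⟶ g) (h : Y ⟶ Z) :
    L.map₂ (μ ▷ h) = (L.mapComp f h).hom ≫ L.map₂ μ ▷ L.map h ≫ (L.mapComp g h).inv := by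
  refine L.map₂_eq _ ?_
  rw [← cancel_mono (L.e X ◁ (K.mapComp g h).hom)]
  have h1 := L.mapComp_e g h
  have h2 := L.mapComp_e f h
  have h3 := congrArg (fun z => z ▷ K.map h) (L.map₂_e μ)
  simp only [comp_whiskerRight] at h3
  simp only [Category.assoc, h1, comp_whiskerRight, K.map₂_whisker_right,
    Bicategory.whiskerLeft_comp]
  simp only [inv_hom_whiskerRight_assoc, whiskerLeft_inv_hom, Category.comp_id,
    reassoc_of% h2]
  have h4 := whisker_exchange (L.map₂ μ) (L.nat h).hom
  simp only [whiskerRight_comp, Category.assoc] at h4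
  have h5 : L.map₂ μ ▷ L.map h ▷ L.e Z ≫ (α_ (L.map g) (L.map h) (L.e Z)).hom ≫
      L.map g ◁ (L.nat h).hom = (α_ _ _ _).hom ≫ L.map f ◁ (L.nat h).hom ≫ (α_ _ _ _).inv ≫
      L.map₂ μ ▷ L.e Y ▷ K.map h ≫ (α_ _ _ _).hom := by
    rw [h4]; simp
  rw [reassoc_of% h5]
  simp only [Iso.hom_inv_id_assoc, reassoc_of% h3]
  simp

/-- After whiskering with `e` and pasting with the structural cells of `K`, both sides become the
pasting of the squares `nat f`, `nat g` and `nat h`; what remains is the associativity law of `K`.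
-/
lemma map₂_associator {X Y Z V : C} (f : X ⟶ Y) (g : Y ⟶ Z) (h : Z ⟶ V) :
    L.map₂ (α_ f g h).hom = (L.mapComp (f ≫ g) h).hom ≫ (L.mapComp f g).hom ▷ L.map h ≫
      (α_ (L.map f) (L.map g) (L.map h)).hom ≫ L.map f ◁ (L.mapComp g h).inv ≫
        (L.mapComp f (g ≫ h)).inv := by
  refine L.map₂_eq _ ?_
  rw [← cancel_mono (L.e X ◁ (K.mapComp f (g ≫ h)).hom),
    ← cancel_mono (L.e X ◁ K.map f ◁ (K.mapComp g h).hom)]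
  have h1 := L.mapComp_e f (g ≫ h)
  have h2 := L.mapComp_e g h
  have h3 := L.mapComp_e (f ≫ g) h
  have h4 := congrArg (fun z => z ▷ K.map h) (L.mapComp_e f g)
  have h2' := congrArg (fun z => L.map f ◁ z) h2
  have h5 := whisker_exchange (L.mapComp f g).hom (L.nat h).hom
  simp only [whiskerRight_comp, Category.assoc, comp_whiskerRight,
    Bicategory.whiskerLeft_comp] at h4 h5 h2'
  have h6 : (L.nat f).hom ▷ K.map (g ≫ h) ≫ (α_ _ _ _).hom ≫
      L.e X ◁ K.map f ◁ (K.mapComp g h).hom =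
      (α_ _ _ _).hom ≫ L.map f ◁ L.e Y ◁ (K.mapComp g h).hom ≫ (α_ _ _ _).inv ≫
        (L.nat f).hom ▷ (K.map g ≫ K.map h) ≫ (α_ _ _ _).hom := by
    rw [← associator_naturality_right, ← whisker_exchange_assoc]
    simp
  -- The interchange law and the two compatibilities `h4` and `h2'` are solved for the whiskered
  -- structural cells of `L`, so that these can be replaced by the cells `nat` and the structural
  -- cells of `K`.
  have h5' : (L.mapComp f g).hom ▷ L.map h ▷ L.e V = (α_ _ _ _).hom ≫
     L.map (f ≫ g) ◁ (L.nat h).hom ≫ (α_ _ _ _).inv ≫ (L.mapComp f g).hom ▷ L.e Z ▷ K.map h ≫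
     (α_ _ _ _).hom ≫ (L.map f ≫ L.map g) ◁ (L.nat h).inv ≫ (α_ _ _ _).inv := by
    rw [← cancel_mono (α_ _ _ _).hom, ← cancel_mono ((L.map f ≫ L.map g) ◁ (L.nat h).hom)]
    simp only [Category.assoc, Iso.inv_hom_id, Category.comp_id, whiskerLeft_inv_hom]
    rw [h5]
    simp
  simp only [Category.assoc, reassoc_of% h1, h6, comp_whiskerRight]
  simp only [inv_hom_whiskerRight_assoc, Iso.inv_hom_id_assoc, K.map₂_associator,
    Bicategory.whiskerLeft_comp, Category.assoc]
  simp only [whiskerLeft_inv_hom_assoc]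
  rw [reassoc_of% h3, h5']
  have h4' : (L.mapComp f g).hom ▷ L.e Z ▷ K.map h = (L.nat (f ≫ g)).hom ▷ K.map h ≫
      (α_ _ _ _).hom ≫ L.e X ◁ (K.mapComp f g).hom ▷ K.map h ≫ (α_ _ _ _).inv ≫ 
      (α_ _ _ _).inv ▷ K.map h ≫ (L.nat f).inv ▷ K.map g ▷ K.map h ≫ (α_ _ _ _).hom ▷ K.map h ≫
      (L.map f ◁ (L.nat g).inv) ▷ K.map h ≫ (α_ _ _ _).inv ▷ K.map h := by
    have : (L.nat (f ≫ g)).hom ▷ K.map h ≫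
      (α_ _ _ _).hom ≫ L.e X ◁ (K.mapComp f g).hom ▷ K.map h ≫ (α_ _ _ _).inv =
       (L.nat (f ≫ g)).hom ▷ K.map h ≫ (L.e X ◁ (K.mapComp f g).hom) ▷ K.map h := by simp
    rw [reassoc_of% this, reassoc_of% h4]
    simp [← comp_whiskerRight, ← comp_whiskerRight_assoc]
  rw [h4']
  have h2'' : L.map f ◁ (L.mapComp g h).inv ▷ L.e V = L.map f ◁ (α_ _ _ _).hom ≫
     L.map f ◁ L.map g ◁ (L.nat h).hom ≫ L.map f ◁ (α_ _ _ _).inv ≫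
      L.map f ◁ (L.nat g).hom ▷ K.map h ≫ L.map f ◁ (α_ _ _ _).hom ≫
       L.map f ◁ L.e Y ◁ (K.mapComp g h).inv ≫ L.map f ◁ (L.nat (g ≫ h)).inv := by
    rw [← cancel_epi (L.map f ◁ (L.mapComp g h).hom ▷ L.e V), ← reassoc_of% h2']
    simp [← Bicategory.whiskerLeft_comp, ← Bicategory.whiskerLeft_comp_assoc]
  simp only [whisker_assoc, Category.assoc, h2'']
  simp

/-- The source of a `LiftData` is a pseudofunctor. -/
def pseudofunctor : C ⥤ᵖ B where
  obj := L.obj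
  map := L.map
  map₂ := L.map₂
  map₂_id f := L.map₂_eq _ (by simp)
  map₂_comp μ ν := L.map₂_eq _ (by
    rw [comp_whiskerRight, Category.assoc, L.map₂_e, reassoc_of% L.map₂_e]; simp)
  mapId := L.mapId
  mapComp := L.mapComp
  map₂_whisker_left := L.map₂_whisker_left
  map₂_whisker_right := L.map₂_whisker_right
  map₂_associator := L.map₂_associator
  map₂_left_unitor {X Y} f := L.map₂_eq _ (by
    have h1 := L.mapComp_e (𝟙 X) f
    have h2 := congrArg (fun z => z ▷ K.map f) (L.mapId_e X)
    have h3 := whisker_exchange (L.mapId X).hom (L.nat f).hom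
    simp only [whiskerRight_comp, Category.assoc, comp_whiskerRight, id_whiskerLeft] at h2 h3
    have h3' : (L.mapId X).hom ▷ L.map f ▷ L.e Y ≫ (α_ _ _ _).hom ≫ (λ_ _).hom ≫ (L.nat f).hom =
        (α_ _ _ _).hom ≫ L.map (𝟙 X) ◁ (L.nat f).hom ≫ (α_ _ _ _).inv ≫
          (L.mapId X).hom ▷ L.e X ▷ K.map f ≫ (α_ _ _ _).hom ≫ (λ_ _).hom := by
      rw [reassoc_of% h3]; simp
    rw [K.map₂_left_unitor, Bicategory.whiskerLeft_comp, reassoc_of% h1]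
    have h2' : (L.nat (𝟙 X)).hom ▷ K.map f ≫ (α_ _ _ _).hom ≫
        L.e X ◁ (K.mapId X).hom ▷ K.map f = (L.mapId X).hom ▷ L.e X ▷ K.map f ≫
        (λ_ (L.e X)).hom ▷ K.map f ≫ (ρ_ (L.e X)).inv ▷ K.map f ≫ (α_ _ _ _).hom := by
      rw [← reassoc_of% h2]; simp
    rw [Bicategory.whiskerLeft_comp, reassoc_of% h2']
    simp only [comp_whiskerRight, Category.assoc, leftUnitor_whiskerRight, h3']
    simp)
  map₂_right_unitor {X Y} f := L.map₂_eq _ (by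
    have h1 := L.mapComp_e f (𝟙 Y)
    have h2 := congrArg (fun z => L.map f ◁ z) (L.mapId_e Y)
    have h3 := whisker_exchange (L.nat f).hom (K.mapId Y).hom
    simp only [Bicategory.whiskerLeft_comp, comp_whiskerLeft, Category.assoc] at h2 h3
    rw [K.map₂_right_unitor, Bicategory.whiskerLeft_comp, reassoc_of% h1,
      Bicategory.whiskerLeft_comp]
    have h3' : (L.nat f).hom ▷ K.map (𝟙 Y) ≫ (α_ _ _ _).hom ≫ L.e X ◁ K.map f ◁ (K.mapId Y).hom =
        (α_ _ _ _).hom ≫ L.map f ◁ L.e Y ◁ (K.mapId Y).hom ≫ (α_ _ _ _).inv ≫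
          (L.nat f).hom ▷ 𝟙 _ ≫ (α_ _ _ _).hom := by
      rw [reassoc_of% h3]; simp
    rw [reassoc_of% h3', Iso.inv_hom_id_assoc, reassoc_of% h2]
    simp)

/-- The pseudonatural transformation given by a `LiftData`. -/
def trans : L.pseudofunctor ⟶ K where
  app := L.e
  naturality := L.nat
  naturality_naturality := L.map₂_e
  naturality_id := L.mapId_e
  naturality_comp := L.mapComp_e

end LiftData

/-- The data of a pseudonatural transformation from a pseudofunctor `K`, with components `e` which
can be cancelled on the left, whose target is not known to satisfy the laws of a pseudofunctor. -/
structure ColiftData (K : C ⥤ᵖ B) where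
  obj : C → B
  e : ∀ X : C, K.obj X ⟶ obj X
  cancel : ∀ {X : C} {Z : B} {g h : obj X ⟶ Z} {α β : g ⟶ h}, e X ◁ α = e X ◁ β → α = β
  map : ∀ {X Y : C}, (X ⟶ Y) → (obj X ⟶ obj Y)
  nat : ∀ {X Y : C} (f : X ⟶ Y), K.map f ≫ e Y ≅ e X ≫ map f
  map₂ : ∀ {X Y : C} {f g : X ⟶ Y}, (f ⟶ g) → (map f ⟶ map g)
  map₂_e : ∀ {X Y : C} {f g : X ⟶ Y} (μ : f ⟶ g),
    K.map₂ μ ▷ e Y ≫ (nat g).hom = (nat f).hom ≫ e X ◁ map₂ μ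
  mapId : ∀ X : C, map (𝟙 X) ≅ 𝟙 (obj X)
  mapId_e : ∀ X : C, (nat (𝟙 X)).hom ≫ e X ◁ (mapId X).hom =
    (K.mapId X).hom ▷ e X ≫ (λ_ (e X)).hom ≫ (ρ_ (e X)).inv
  mapComp : ∀ {X Y Z : C} (f : X ⟶ Y) (g : Y ⟶ Z), map (f ≫ g) ≅ map f ≫ map g
  mapComp_e : ∀ {X Y Z : C} (f : X ⟶ Y) (g : Y ⟶ Z),
    (nat (f ≫ g)).hom ≫ e X ◁ (mapComp f g).hom =
      (K.mapComp f g).hom ▷ e Z ≫ (α_ _ _ _).hom ≫ K.map f ◁ (nat g).hom ≫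
        (α_ _ _ _).inv ≫ (nat f).hom ▷ map g ≫ (α_ _ _ _).hom

namespace ColiftData

variable {K : C ⥤ᵖ B} (L : ColiftData K)

/-- The dual principle: `e` is now cancelled on the left, and the known laws are those of the source
`K`. -/
lemma map₂_eq {X Y : C} {f g : X ⟶ Y} (μ : f ⟶ g) {a : L.map f ⟶ L.map g}
    (h : (L.nat f).hom ≫ L.e X ◁ a = K.map₂ μ ▷ L.e Y ≫ (L.nat g).hom) : L.map₂ μ = a := by
  refine L.cancel ((cancel_epi (L.nat f).hom).1 ?_)
  rw [h, L.map₂_e]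

lemma map₂_whisker_left {X Y Z : C} (f : X ⟶ Y) {g h : Y ⟶ Z} (μ : g ⟶ h) :
    L.map₂ (f ◁ μ) = (L.mapComp f g).hom ≫ L.map f ◁ L.map₂ μ ≫ (L.mapComp f h).inv := by
  refine L.map₂_eq _ ?_
  rw [← cancel_mono (L.e X ◁ (L.mapComp f h).hom)]
  have h1 := L.mapComp_e f h
  have h2 := L.mapComp_e f g
  have h3 := congrArg (fun z => (K.mapComp f g).hom ▷ L.e Z ≫ (α_ _ _ _).hom ≫
    K.map f ◁ z ≫ (α_ _ _ _).inv ≫ (L.nat f).hom ▷ L.map h ≫ (α_ _ _ _).hom) (L.map₂_e μ)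
  simp only [Bicategory.whiskerLeft_comp] at h3
  simp only [Category.assoc, h1, comp_whiskerRight, K.map₂_whisker_left, whisker_assoc,
    Bicategory.whiskerLeft_comp] at h3 ⊢
  simp only [inv_hom_whiskerRight_assoc, Iso.inv_hom_id_assoc]
  rw [h3, reassoc_of% h2, whiskerLeft_inv_hom, Category.comp_id, ← associator_naturality_right,
    ← whisker_exchange_assoc]
  simp

lemma map₂_whisker_right {X Y Z : C} {f g : X ⟶ Y} (μ : f ⟶ g) (h : Y ⟶ Z) :
    L.map₂ (μ ▷ h) = (L.mapComp f h).hom ≫ L.map₂ μ ▷ L.map h ≫ (L.mapComp g h).inv := by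
  refine L.map₂_eq _ ?_
  rw [← cancel_mono (L.e X ◁ (L.mapComp g h).hom)]
  have h1 := L.mapComp_e g h
  have h2 := L.mapComp_e f h
  have h3 := congrArg (fun z => z ▷ L.map h) (L.map₂_e μ)
  simp only [comp_whiskerRight] at h3
  simp only [Category.assoc, h1, comp_whiskerRight, K.map₂_whisker_right,
    Bicategory.whiskerLeft_comp]
  simp only [inv_hom_whiskerRight_assoc, whiskerLeft_inv_hom, Category.comp_id,
    reassoc_of% h2]
  have h4 := whisker_exchange (K.map₂ μ) (L.nat h).hom
  simp only [whiskerRight_comp, Category.assoc] at h4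
  have h5 : K.map₂ μ ▷ K.map h ▷ L.e Z ≫ (α_ (K.map g) (K.map h) (L.e Z)).hom ≫
      K.map g ◁ (L.nat h).hom = (α_ _ _ _).hom ≫ K.map f ◁ (L.nat h).hom ≫ (α_ _ _ _).inv ≫
      K.map₂ μ ▷ L.e Y ▷ L.map h ≫ (α_ _ _ _).hom := by
    rw [h4]; simp
  rw [reassoc_of% h5]
  simp only [Iso.hom_inv_id_assoc, reassoc_of% h3]
  simp

/-- As for `LiftData`, both sides reduce to the pasting of the three squares. Here the
compatibilities are solved for the structural cells of the source `K`, and those of `L` are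
absorbed. -/
lemma map₂_associator {X Y Z V : C} (f : X ⟶ Y) (g : Y ⟶ Z) (h : Z ⟶ V) :
    L.map₂ (α_ f g h).hom = (L.mapComp (f ≫ g) h).hom ≫ (L.mapComp f g).hom ▷ L.map h ≫
      (α_ (L.map f) (L.map g) (L.map h)).hom ≫ L.map f ◁ (L.mapComp g h).inv ≫
        (L.mapComp f (g ≫ h)).inv := by
  refine L.map₂_eq _ ?_
  rw [← cancel_mono (L.e X ◁ (L.mapComp f (g ≫ h)).hom),
    ← cancel_mono (L.e X ◁ L.map f ◁ (L.mapComp g h).hom)]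
  have h1 := L.mapComp_e f (g ≫ h)
  have h2 := L.mapComp_e g h
  have h3 := L.mapComp_e (f ≫ g) h
  have h4 := congrArg (fun z => z ▷ L.map h) (L.mapComp_e f g)
  have h2' := congrArg (fun z => K.map f ◁ z) h2
  have h5 := whisker_exchange (K.mapComp f g).hom (L.nat h).hom
  simp only [whiskerRight_comp, Category.assoc, comp_whiskerRight,
    Bicategory.whiskerLeft_comp] at h4 h5 h2'
  have h6 : (L.nat f).hom ▷ L.map (g ≫ h) ≫ (α_ _ _ _).hom ≫
      L.e X ◁ L.map f ◁ (L.mapComp g h).hom =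
      (α_ _ _ _).hom ≫ K.map f ◁ L.e Y ◁ (L.mapComp g h).hom ≫ (α_ _ _ _).inv ≫
        (L.nat f).hom ▷ (L.map g ≫ L.map h) ≫ (α_ _ _ _).hom := by
    rw [← associator_naturality_right, ← whisker_exchange_assoc]
    simp
  have h5' : (K.mapComp f g).hom ▷ K.map h ▷ L.e V = (α_ _ _ _).hom ≫
     K.map (f ≫ g) ◁ (L.nat h).hom ≫ (α_ _ _ _).inv ≫ (K.mapComp f g).hom ▷ L.e Z ▷ L.map h ≫
     (α_ _ _ _).hom ≫ (K.map f ≫ K.map g) ◁ (L.nat h).inv ≫ (α_ _ _ _).inv := by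
    rw [← cancel_mono (α_ _ _ _).hom, ← cancel_mono ((K.map f ≫ K.map g) ◁ (L.nat h).hom)]
    simp only [Category.assoc, Iso.inv_hom_id, Category.comp_id, whiskerLeft_inv_hom]
    rw [h5]
    simp
  have h4' : (K.mapComp f g).hom ▷ L.e Z ▷ L.map h = (L.nat (f ≫ g)).hom ▷ L.map h ≫
      (α_ _ _ _).hom ≫ L.e X ◁ (L.mapComp f g).hom ▷ L.map h ≫ (α_ _ _ _).inv ≫
      (α_ _ _ _).inv ▷ L.map h ≫ (L.nat f).inv ▷ L.map g ▷ L.map h ≫ (α_ _ _ _).hom ▷ L.map h ≫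
      (K.map f ◁ (L.nat g).inv) ▷ L.map h ≫ (α_ _ _ _).inv ▷ L.map h := by
    have : (L.nat (f ≫ g)).hom ▷ L.map h ≫
      (α_ _ _ _).hom ≫ L.e X ◁ (L.mapComp f g).hom ▷ L.map h ≫ (α_ _ _ _).inv =
       (L.nat (f ≫ g)).hom ▷ L.map h ≫ (L.e X ◁ (L.mapComp f g).hom) ▷ L.map h := by simp
    rw [reassoc_of% this, reassoc_of% h4]
    simp [← comp_whiskerRight, ← comp_whiskerRight_assoc]
  have h2'' : K.map f ◁ (K.mapComp g h).inv ▷ L.e V = K.map f ◁ (α_ _ _ _).hom ≫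
     K.map f ◁ K.map g ◁ (L.nat h).hom ≫ K.map f ◁ (α_ _ _ _).inv ≫
      K.map f ◁ (L.nat g).hom ▷ L.map h ≫ K.map f ◁ (α_ _ _ _).hom ≫
       K.map f ◁ L.e Y ◁ (L.mapComp g h).inv ≫ K.map f ◁ (L.nat (g ≫ h)).inv := by
    rw [← cancel_epi (K.map f ◁ (K.mapComp g h).hom ▷ L.e V), ← reassoc_of% h2']
    simp [← Bicategory.whiskerLeft_comp, ← Bicategory.whiskerLeft_comp_assoc]
  simp only [K.map₂_associator, comp_whiskerRight, Category.assoc, h1, h6,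
    inv_hom_whiskerRight_assoc, whisker_assoc, h2'', h5', h4']
  simp only [Bicategory.whiskerLeft_comp, Category.assoc, whiskerLeft_inv_hom_assoc,
    reassoc_of% h3]
  simp

/-- The target of a `ColiftData` is a pseudofunctor. -/
def pseudofunctor : C ⥤ᵖ B where
  obj := L.obj
  map := L.map
  map₂ := L.map₂
  map₂_id f := L.map₂_eq _ (by simp)
  map₂_comp μ ν := L.map₂_eq _ (by
    rw [Bicategory.whiskerLeft_comp, ← reassoc_of% L.map₂_e, ← L.map₂_e]; simp)
  mapId := L.mapId
  mapComp := L.mapComp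
  map₂_whisker_left := L.map₂_whisker_left
  map₂_whisker_right := L.map₂_whisker_right
  map₂_associator := L.map₂_associator
  map₂_left_unitor {X Y} f := L.map₂_eq _ (by
    have h1 := L.mapComp_e (𝟙 X) f
    have h2 := congrArg (fun z => z ▷ L.map f) (L.mapId_e X)
    have h3 := whisker_exchange (K.mapId X).hom (L.nat f).hom
    simp only [whiskerRight_comp, Category.assoc, comp_whiskerRight, id_whiskerLeft] at h2 h3
    have h3' : (K.mapId X).hom ▷ K.map f ▷ L.e Y ≫ (α_ _ _ _).hom ≫ (λ_ _).hom ≫ (L.nat f).hom =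
        (α_ _ _ _).hom ≫ K.map (𝟙 X) ◁ (L.nat f).hom ≫ (α_ _ _ _).inv ≫
          (K.mapId X).hom ▷ L.e X ▷ L.map f ≫ (α_ _ _ _).hom ≫ (λ_ _).hom := by
      rw [reassoc_of% h3]; simp
    rw [K.map₂_left_unitor, Bicategory.whiskerLeft_comp, reassoc_of% h1]
    have h2' : (L.nat (𝟙 X)).hom ▷ L.map f ≫ (α_ _ _ _).hom ≫
        L.e X ◁ (L.mapId X).hom ▷ L.map f = (K.mapId X).hom ▷ L.e X ▷ L.map f ≫
        (λ_ (L.e X)).hom ▷ L.map f ≫ (ρ_ (L.e X)).inv ▷ L.map f ≫ (α_ _ _ _).hom := by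
      rw [← reassoc_of% h2]; simp
    rw [Bicategory.whiskerLeft_comp, reassoc_of% h2']
    simp only [comp_whiskerRight, Category.assoc, leftUnitor_whiskerRight, h3']
    simp)
  map₂_right_unitor {X Y} f := L.map₂_eq _ (by
    have h1 := L.mapComp_e f (𝟙 Y)
    have h2 := congrArg (fun z => K.map f ◁ z) (L.mapId_e Y)
    have h3 := whisker_exchange (L.nat f).hom (L.mapId Y).hom
    simp only [Bicategory.whiskerLeft_comp, comp_whiskerLeft, Category.assoc] at h2 h3
    rw [K.map₂_right_unitor, Bicategory.whiskerLeft_comp, reassoc_of% h1,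
      Bicategory.whiskerLeft_comp]
    have h3' : (L.nat f).hom ▷ L.map (𝟙 Y) ≫ (α_ _ _ _).hom ≫ L.e X ◁ L.map f ◁ (L.mapId Y).hom =
        (α_ _ _ _).hom ≫ K.map f ◁ L.e Y ◁ (L.mapId Y).hom ≫ (α_ _ _ _).inv ≫
          (L.nat f).hom ▷ 𝟙 _ ≫ (α_ _ _ _).hom := by
      rw [reassoc_of% h3]; simp
    rw [reassoc_of% h3', Iso.inv_hom_id_assoc, reassoc_of% h2]
    simp)

end ColiftData

end Transfer

/-! ### Pseudonatural transformations whose components are equivalences. -/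

section ObjectwiseEquivalences

variable {C : Type u} [Bicategory.{w, v} C] {B : Type u₁} [Bicategory.{w₁, v₁} B]

/-- A quasi-inverse, together with one of the two invertible 2-cells, for every component of a
pseudonatural transformation whose components are quasiequivalences, and chosen comparison cells
which make the quasi-inverses a pseudonatural transformation. -/
structure InverseData {F G : C ⥤ᵖ B} (θ : F ⟶ G) where
  cancel : ∀ {X : C} {Z : B} {g h : Z ⟶ F.obj X} {α β : g ⟶ h},
    α ▷ θ.app X = β ▷ θ.app X → α = β
  app : ∀ X : C, G.obj X ⟶ F.obj X
  counit : ∀ X : C, app X ≫ θ.app X ≅ 𝟙 (G.obj X)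
  unit : ∀ X : C, θ.app X ≫ app X ≅ 𝟙 (F.obj X)
  unit_app : ∀ X : C, (unit X).hom ▷ θ.app X =
    (α_ _ _ _).hom ≫ θ.app X ◁ (counit X).hom ≫ (ρ_ _).hom ≫ (λ_ _).inv
  nat : ∀ {X Y : C} (f : X ⟶ Y), G.map f ≫ app Y ≅ app X ≫ F.map f
  nat_app : ∀ {X Y : C} (f : X ⟶ Y), (nat f).hom ▷ θ.app Y =
    (α_ _ _ _).hom ≫ G.map f ◁ (counit Y).hom ≫ (ρ_ _).hom ≫ (λ_ _).inv ≫
      (counit X).inv ▷ G.map f ≫ (α_ _ _ _).hom ≫ app X ◁ (θ.naturality f).inv ≫ (α_ _ _ _).inv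

/-- Only the quasi-inverses and the counits are arbitrary. Units and comparison cells are the lifts
along `θ` of the composites which make one triangle identity hold and make `nat f` the mate of
`(θ.naturality f).inv`. -/
lemma exists_inverseData {F G : C ⥤ᵖ B} (θ : F ⟶ G) (h : ∀ X, IsEquiv (θ.app X)) :
    Nonempty (InverseData θ) := by
  have hq := fun X => (h X).isQuasiequiv
  choose g a b using h
  -- The isomorphism `a` supplied by the hypothesis is discarded, since it need not satisfy the
  -- triangle identity with `b`.
  have hu : ∀ X, ∃ ψ : θ.app X ≫ g X ≅ 𝟙 _, ψ.hom ▷ θ.app X = _ := fun X =>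
    (hq X).exists_iso_right (α_ _ _ _ ≪≫ whiskerLeftIso (θ.app X) (b X).some ≪≫ ρ_ _ ≪≫ (λ_ _).symm)
  choose ψ hψ using hu
  have hn : ∀ {X Y : C} (f : X ⟶ Y), ∃ χ : G.map f ≫ g Y ≅ g X ≫ F.map f, χ.hom ▷ θ.app Y = _ :=
    fun {X Y} f => (hq Y).exists_iso_right (α_ _ _ _ ≪≫ whiskerLeftIso (G.map f) (b Y).some ≪≫
      ρ_ _ ≪≫ (λ_ _).symm ≪≫ whiskerRightIso (b X).some.symm (G.map f) ≪≫ α_ _ _ _ ≪≫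
      whiskerLeftIso (g X) (θ.naturality f).symm ≪≫ (α_ _ _ _).symm)
  choose χ hχ using @hn
  exact ⟨⟨fun e => (hq _).isCancellable.right e, g, fun X => (b X).some, ψ, hψ, χ, hχ⟩⟩

namespace InverseData

variable {F G : C ⥤ᵖ B} {θ : F ⟶ G} (I : InverseData θ)

/-- The mate formula with the inverses moved to the other side: pasting `nat f` with `θ.naturality
f` and the counit at `X` leaves the counit at `Y`. In this form it eliminates and introduces `nat`
in the proofs below. -/
lemma nat_app' {X Y : C} (f : X ⟶ Y) : (I.nat f).hom ▷ θ.app Y ≫ (α_ _ _ _).hom ≫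
      I.app X ◁ (θ.naturality f).hom ≫ (α_ _ _ _).inv ≫ (I.counit X).hom ▷ G.map f =
    (α_ _ _ _).hom ≫ G.map f ◁ (I.counit Y).hom ≫ (ρ_ _).hom ≫ (λ_ _).inv := by
  simp [I.nat_app]

/-- Whiskered with `θ.app Y` and pasted with the naturality of `θ` and the counit, both sides reduce
by the mate formula to counits and `G.map₂ η`. The identity and composition laws below are obtained
in the same way. -/
lemma naturality_naturality {X Y : C} {f g : X ⟶ Y} (η : f ⟶ g) :
    G.map₂ η ▷ I.app Y ≫ (I.nat g).hom = (I.nat f).hom ≫ I.app X ◁ F.map₂ η := by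
  apply I.cancel
  have h1 := θ.naturality_naturality η
  rw [← cancel_mono ((α_ _ _ _).hom ≫ I.app X ◁ (θ.naturality g).hom ≫ (α_ _ _ _).inv ≫
    (I.counit X).hom ▷ G.map g)]
  rw [comp_whiskerRight, comp_whiskerRight, Category.assoc, I.nat_app']
  simp only [whisker_assoc, Category.assoc, Iso.inv_hom_id_assoc]
  rw [← Bicategory.whiskerLeft_comp_assoc, h1, Bicategory.whiskerLeft_comp_assoc]
  have h2 := I.nat_app' f
  have h3 := whisker_exchange (I.counit X).hom (G.map₂ η)
  have h4 : I.app X ◁ θ.app X ◁ G.map₂ η ≫ (α_ _ _ _).inv ≫ (I.counit X).hom ▷ G.map g =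
      (α_ _ _ _).inv ≫ (I.counit X).hom ▷ G.map f ≫ 𝟙 _ ◁ G.map₂ η := by
    rw [← h3]; simp
  rw [h4, reassoc_of% h2]
  have h5 := whisker_exchange (G.map₂ η) (I.counit Y).hom
  simp only [whiskerRight_comp, Category.assoc] at h5
  have h6 : G.map₂ η ▷ I.app Y ▷ θ.app Y ≫ (α_ _ _ _).hom ≫ G.map g ◁ (I.counit Y).hom =
    (α_ _ _ _).hom ≫ G.map f ◁ (I.counit Y).hom ≫ G.map₂ η ▷ 𝟙 _ := by
    rw [h5]; simp
  rw [reassoc_of% h6]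
  simp

lemma naturality_id (X : C) : (I.nat (𝟙 X)).hom ≫ I.app X ◁ (F.mapId X).hom =
    (G.mapId X).hom ▷ I.app X ≫ (λ_ (I.app X)).hom ≫ (ρ_ (I.app X)).inv := by
  apply I.cancel
  rw [← cancel_mono ((ρ_ _).hom ▷ _ ≫ (I.counit X).hom)]
  have h1 := θ.naturality_id X
  have h2 := I.nat_app' (𝟙 X)
  have h3 := whisker_exchange (I.counit X).hom (G.mapId X).hom
  have h4 := whisker_exchange (G.mapId X).hom (I.counit X).hom
  simp only [whiskerRight_comp, comp_whiskerLeft, Category.assoc] at h3 h4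
  have h5 : (F.mapId X).hom ▷ θ.app X = (θ.naturality (𝟙 X)).hom ≫ θ.app X ◁ (G.mapId X).hom ≫
      (ρ_ _).hom ≫ (λ_ _).inv := by
    rw [reassoc_of% h1]; simp
  rw [comp_whiskerRight, Category.assoc, whisker_assoc, h5]
  have h6 : I.app X ◁ θ.app X ◁ (G.mapId X).hom ≫ I.app X ◁ (ρ_ _).hom ≫ (I.counit X).hom =
      (α_ _ _ _).inv ≫ (I.counit X).hom ▷ _ ≫ (λ_ _).hom ≫ (G.mapId X).hom := by
    have := (α_ _ _ _).inv ≫= h3 =≫ (λ_ _).hom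
    simp only [Category.assoc, id_whiskerLeft, Iso.inv_hom_id, Category.comp_id,
      whiskerRight_id, Iso.inv_hom_id_assoc] at this
    rw [← this]
    simp
  have h7 : (G.mapId X).hom ▷ I.app X ▷ θ.app X ≫ (λ_ _).hom ▷ _ ≫ (I.counit X).hom =
      (α_ _ _ _).hom ≫ G.map (𝟙 X) ◁ (I.counit X).hom ≫ (ρ_ _).hom ≫ (G.mapId X).hom := by
    have := (α_ _ _ _).hom ≫= h4 =≫ (λ_ _).hom
    simp only [Category.assoc, id_whiskerLeft, Iso.inv_hom_id, Category.comp_id,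
      whiskerRight_id, unitors_equal, Iso.hom_inv_id_assoc] at this
    rw [this]
    simp
  simp only [Bicategory.whiskerLeft_comp, Category.assoc]
  simp only [comp_whiskerRight, Category.assoc, inv_hom_whiskerRight_assoc]
  rw [h7]
  have h8 : I.app X ◁ (λ_ (θ.app X)).inv ≫ (α_ _ _ _).inv ≫ (ρ_ (I.app X)).hom ▷ θ.app X = 𝟙 _ := by
    simp
  rw [reassoc_of% h8, h6, reassoc_of% h2]
  simp

lemma naturality_comp {X Y Z : C} (f : X ⟶ Y) (g : Y ⟶ Z) :
    (I.nat (f ≫ g)).hom ≫ I.app X ◁ (F.mapComp f g).hom =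
      (G.mapComp f g).hom ▷ I.app Z ≫ (α_ _ _ _).hom ≫ G.map f ◁ (I.nat g).hom ≫
        (α_ _ _ _).inv ≫ (I.nat f).hom ▷ F.map g ≫ (α_ _ _ _).hom := by
  apply I.cancel
  rw [← cancel_mono ((α_ _ _ _).hom ≫ I.app X ◁ ((α_ _ _ _).hom ≫ F.map f ◁ (θ.naturality g).hom ≫
    (α_ _ _ _).inv ≫ (θ.naturality f).hom ▷ G.map g ≫ (α_ _ _ _).hom) ≫ (α_ _ _ _).inv ≫
      (I.counit X).hom ▷ (G.map f ≫ G.map g))]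
  have h1 := θ.naturality_comp f g
  have h5 := whisker_exchange (I.nat f).hom (θ.naturality g).hom
  -- The comparison cell at `f ≫ g` is first contracted to a counit, which is then moved past
  -- `G.mapComp f g` and expanded again, once for `g` and once for `f`.
  calc
    _ = (I.nat (f ≫ g)).hom ▷ θ.app Z ⊗≫ I.app X ◁ ((F.mapComp f g).hom ▷ θ.app Z ≫ (α_ _ _ _).hom ≫
          F.map f ◁ (θ.naturality g).hom ≫ (α_ _ _ _).inv ≫ (θ.naturality f).hom ▷ G.map g ≫
          (α_ _ _ _).hom) ⊗≫ (I.counit X).hom ▷ (G.map f ≫ G.map g) := by bicategory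
    _ = (I.nat (f ≫ g)).hom ▷ θ.app Z ⊗≫ I.app X ◁ (θ.naturality (f ≫ g)).hom ⊗≫
          ((I.app X ≫ θ.app X) ◁ (G.mapComp f g).hom ≫
            (I.counit X).hom ▷ (G.map f ≫ G.map g)) := by rw [← h1]; bicategory
    _ = 𝟙 _ ⊗≫ ((I.nat (f ≫ g)).hom ▷ θ.app Z ≫ (α_ _ _ _).hom ≫
          I.app X ◁ (θ.naturality (f ≫ g)).hom ≫ (α_ _ _ _).inv ≫
          (I.counit X).hom ▷ G.map (f ≫ g)) ⊗≫ 𝟙 _ ◁ (G.mapComp f g).hom := by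
      rw [whisker_exchange]; bicategory
    _ = 𝟙 _ ⊗≫ (G.map (f ≫ g) ◁ (I.counit Z).hom ≫ (G.mapComp f g).hom ▷ 𝟙 _) ⊗≫ 𝟙 _ := by
      rw [I.nat_app']; bicategory
    _ = 𝟙 _ ⊗≫ (G.mapComp f g).hom ▷ (I.app Z ≫ θ.app Z) ⊗≫
          G.map f ◁ ((α_ _ _ _).hom ≫ G.map g ◁ (I.counit Z).hom ≫ (ρ_ _).hom ≫
            (λ_ _).inv) ⊗≫ 𝟙 _ := by
      rw [whisker_exchange]; bicategory
    _ = 𝟙 _ ⊗≫ (G.mapComp f g).hom ▷ (I.app Z ≫ θ.app Z) ⊗≫ G.map f ◁ (I.nat g).hom ▷ θ.app Z ⊗≫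
          G.map f ◁ I.app Y ◁ (θ.naturality g).hom ⊗≫ ((α_ _ _ _).hom ≫
            G.map f ◁ (I.counit Y).hom ≫ (ρ_ _).hom ≫ (λ_ _).inv) ▷ G.map g ⊗≫ 𝟙 _ := by
      rw [← I.nat_app']; bicategory
    _ = 𝟙 _ ⊗≫ (G.mapComp f g).hom ▷ (I.app Z ≫ θ.app Z) ⊗≫ G.map f ◁ (I.nat g).hom ▷ θ.app Z ⊗≫
          ((G.map f ≫ I.app Y) ◁ (θ.naturality g).hom ≫ (I.nat f).hom ▷ (θ.app Y ≫ G.map g)) ⊗≫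
            I.app X ◁ (θ.naturality f).hom ▷ G.map g ⊗≫
              (I.counit X).hom ▷ (G.map f ≫ G.map g) := by
      rw [← I.nat_app']; bicategory
    _ = _ := by
      rw [h5]; bicategory

/-- The quasi-inverse pseudonatural transformation. -/
def trans : G ⟶ F where
  app := I.app
  naturality := I.nat
  naturality_naturality := I.naturality_naturality
  naturality_id := I.naturality_id
  naturality_comp := I.naturality_comp

/-- After whiskering with `θ.app Y`, the triangle identity `unit_app` turns the units into counits,
and the mate formula applies. -/
lemma unit_naturality {X Y : C} (f : X ⟶ Y) :
    F.map f ◁ (I.unit Y).hom ≫ (ρ_ (F.map f)).hom ≫ (λ_ (F.map f)).inv =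
      ((α_ _ _ _).inv ≫ (θ.naturality f).hom ▷ I.app Y ≫ (α_ _ _ _).hom ≫
        θ.app X ◁ (I.nat f).hom ≫ (α_ _ _ _).inv) ≫ (I.unit X).hom ▷ F.map f := by
  apply I.cancel
  rw [← cancel_mono ((α_ _ _ _).hom ≫ 𝟙 _ ◁ (θ.naturality f).hom)]
  have h1 := whisker_exchange (I.unit X).hom (θ.naturality f).hom
  have h4 := whisker_exchange (θ.naturality f).hom (I.counit Y).hom
  calc
    _ = 𝟙 _ ⊗≫ F.map f ◁ (I.unit Y).hom ▷ θ.app Y ⊗≫ (θ.naturality f).hom ⊗≫ 𝟙 _ := by bicategory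
    _ = 𝟙 _ ⊗≫ ((F.map f ≫ θ.app Y) ◁ (I.counit Y).hom ≫
          (θ.naturality f).hom ▷ 𝟙 _) ⊗≫ 𝟙 _ := by
      rw [I.unit_app]; bicategory
    _ = 𝟙 _ ⊗≫ (θ.naturality f).hom ▷ (I.app Y ≫ θ.app Y) ⊗≫ θ.app X ◁ ((α_ _ _ _).hom ≫
          G.map f ◁ (I.counit Y).hom ≫ (ρ_ _).hom ≫ (λ_ _).inv) ⊗≫ 𝟙 _ := by
      rw [h4]; bicategory
    _ = 𝟙 _ ⊗≫ (θ.naturality f).hom ▷ (I.app Y ≫ θ.app Y) ⊗≫ θ.app X ◁ (I.nat f).hom ▷ θ.app Y ⊗≫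
          θ.app X ◁ I.app X ◁ (θ.naturality f).hom ⊗≫ ((α_ _ _ _).hom ≫
            θ.app X ◁ (I.counit X).hom ≫ (ρ_ _).hom ≫ (λ_ _).inv) ▷ G.map f ⊗≫ 𝟙 _ := by
      rw [← I.nat_app']; bicategory
    _ = 𝟙 _ ⊗≫ (θ.naturality f).hom ▷ (I.app Y ≫ θ.app Y) ⊗≫ θ.app X ◁ (I.nat f).hom ▷ θ.app Y ⊗≫
          ((θ.app X ≫ I.app X) ◁ (θ.naturality f).hom ≫
            (I.unit X).hom ▷ (θ.app X ≫ G.map f)) ⊗≫ 𝟙 _ := by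
      rw [← I.unit_app]; bicategory
    _ = _ := by
      rw [h1]; bicategory

lemma counit_naturality {X Y : C} (f : X ⟶ Y) :
    G.map f ◁ (I.counit Y).hom ≫ (ρ_ (G.map f)).hom ≫ (λ_ (G.map f)).inv =
      ((α_ _ _ _).inv ≫ (I.nat f).hom ▷ θ.app Y ≫ (α_ _ _ _).hom ≫
        I.app X ◁ (θ.naturality f).hom ≫ (α_ _ _ _).inv) ≫ (I.counit X).hom ▷ G.map f := by
  simp only [Category.assoc, I.nat_app', Iso.inv_hom_id_assoc]

end InverseData

/-- A pseudonatural transformation whose components are equivalences is an equivalence. -/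
theorem isEquiv_of_app {F G : C ⥤ᵖ B} (θ : F ⟶ G) (h : ∀ X, IsEquiv (θ.app X)) : IsEquiv θ := by
  obtain ⟨I⟩ := exists_inverseData θ h
  exact ⟨I.trans, ⟨Pseudofunctor.StrongTrans.isoMk I.unit I.unit_naturality⟩,
    ⟨Pseudofunctor.StrongTrans.isoMk I.counit I.counit_naturality⟩⟩

end ObjectwiseEquivalences

/-! ### Pseudofunctors which are equivalences on hom-categories. -/

section LocalEquivalences

variable {A : Type u} [Bicategory.{w, v} A] {B : Type u₁} [Bicategory.{w₁, v₁} B]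

lemma IsEquiv.app {F G : A ⥤ᵖ B} {θ : F ⟶ G} (h : IsEquiv θ) (X : A) : IsEquiv (θ.app X) := by
  obtain ⟨θ', ⟨a⟩, ⟨b⟩⟩ := h
  exact ⟨θ'.app X, ⟨⟨a.hom.as.app X, a.inv.as.app X, congrArg (fun Γ => Γ.as.app X) a.hom_inv_id,
      congrArg (fun Γ => Γ.as.app X) a.inv_hom_id⟩⟩,
    ⟨⟨b.hom.as.app X, b.inv.as.app X, congrArg (fun Γ => Γ.as.app X) b.hom_inv_id,
      congrArg (fun Γ => Γ.as.app X) b.inv_hom_id⟩⟩⟩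

/-- A pseudofunctor is a local equivalence if it induces equivalences of hom-categories. -/
structure IsLocalEquivalence (P : A ⥤ᵖ B) : Prop where
  faithful : ∀ {X Y : A} {f g : X ⟶ Y} {μ ν : f ⟶ g}, P.map₂ μ = P.map₂ ν → μ = ν
  full : ∀ {X Y : A} {f g : X ⟶ Y} (κ : P.map f ⟶ P.map g), ∃ μ : f ⟶ g, P.map₂ μ = κ
  essSurj : ∀ {X Y : A} (k : P.obj X ⟶ P.obj Y), ∃ f : X ⟶ Y, Nonempty (P.map f ≅ k)

end LocalEquivalences

/-! ### Lifting in a model bicategory and existence of the replacements. -/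

namespace ModelStructure

variable {C : Type u} [Bicategory.{w, v} C] (M : ModelStructure C)

section Lifts

variable {M}

/-- The two-dimensional lifting property is applied to the arrow from the Initial object to `A`,
with `f` and `g` themselves as fillers carrying identity 2-cells. The 2-cell on the Initial object
and the compatibility condition come for free. The lift `δ` need not be unique. -/
lemma exists_lift_cell {A Y B : C} (hA : M.IsCofibrant A) {p : Y ⟶ B} (hp : M.Fib p) (hw : M.W p)
    {f g : A ⟶ Y} (μ : f ≫ p ⟶ g ≫ p) : ∃ δ : f ⟶ g, δ ▷ p = μ := by
  obtain ⟨I, i, hI, hi⟩ := hA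
  obtain ⟨α, -, -⟩ := (hI Y).2 (i ≫ f) (i ≫ g)
  obtain ⟨δ, -, h⟩ := (M.lifting i p hi hp (.inr hw)).exists_cell (α_ i f p) (α_ i g p)
    ⟨f, Iso.refl _, Iso.refl _, by simp⟩ ⟨g, Iso.refl _, Iso.refl _, by simp⟩ α μ
    (((hI B).2 _ _).unique trivial trivial)
  exact ⟨δ, by simpa using h⟩

/-- Parallel arrows out of an Initial object are uniquely isomorphic, so `b` fits into a square
against `p`, and the lower cell of a filler is the required isomorphism. -/
lemma exists_lift_arrow {A Y B : C} (hA : M.IsCofibrant A) {p : Y ⟶ B} (hp : M.Fib p)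
    (hw : M.W p) (b : A ⟶ B) : ∃ f : A ⟶ Y, Nonempty (f ≫ p ≅ b) := by
  obtain ⟨I, i, hI, hi⟩ := hA
  obtain ⟨a⟩ := (hI Y).1
  obtain ⟨γ, -, -⟩ := (hI B).2 (a ≫ p) (i ≫ b)
  obtain ⟨γ', -, -⟩ := (hI B).2 (i ≫ b) (a ≫ p)
  obtain ⟨L⟩ := (M.lifting i p hi hp (.inr hw)).exists_filler
    (⟨γ, γ', ((hI B).2 _ _).unique trivial trivial, ((hI B).2 _ _).unique trivial trivial⟩ :
      a ≫ p ≅ i ≫ b)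
  exact ⟨L.diag, ⟨L.lower⟩⟩

/-- The dual argument, with the arrow from `Y` to the Terminal object as fibration: there the
compatibility condition is between 2-cells into a Terminal object. -/
lemma exists_colift_cell {A B Y : C} (hY : M.IsFibrant Y) {i : A ⟶ B} (hi : M.Cof i) (hw : M.W i)
    {f g : B ⟶ Y} (μ : i ≫ f ⟶ i ≫ g) : ∃ δ : f ⟶ g, i ◁ δ = μ := by
  obtain ⟨T, p, hT, hp⟩ := hY
  obtain ⟨β, -, -⟩ := (hT B).2 (f ≫ p) (g ≫ p)
  obtain ⟨δ, h, -⟩ := (M.lifting i p hi hp (.inl hw)).exists_cell (α_ i f p) (α_ i g p)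
    ⟨f, Iso.refl _, Iso.refl _, by simp⟩ ⟨g, Iso.refl _, Iso.refl _, by simp⟩ μ β
    (((hT A).2 _ _).unique trivial trivial)
  exact ⟨δ, by simpa using h.symm⟩

lemma exists_colift_arrow {A B Y : C} (hY : M.IsFibrant Y) {i : A ⟶ B} (hi : M.Cof i)
    (hw : M.W i) (a : A ⟶ Y) : ∃ f : B ⟶ Y, Nonempty (a ≅ i ≫ f) := by
  obtain ⟨T, p, hT, hp⟩ := hY
  obtain ⟨b⟩ := (hT B).1
  obtain ⟨γ, -, -⟩ := (hT A).2 (a ≫ p) (i ≫ b)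
  obtain ⟨γ', -, -⟩ := (hT A).2 (i ≫ b) (a ≫ p)
  obtain ⟨L⟩ := (M.lifting i p hi hp (.inl hw)).exists_filler
    (⟨γ, γ', ((hT A).2 _ _).unique trivial trivial, ((hT A).2 _ _).unique trivial trivial⟩ :
      a ≫ p ≅ i ≫ b)
  exact ⟨L.diag, ⟨L.upper⟩⟩

end Lifts

/-- Objects are replaced by factoring the arrow from an Initial object. Arrows and 2-cells are then
lifted along `p` independently of one another, with no functoriality imposed. -/
theorem nonempty_cofibrantReplacement : Nonempty M.CofibrantReplacement := by
  have h : ∀ X : C, ∃ (Z : C) (p : Z ⟶ X), M.IsCofibrant Z ∧ M.Fib p ∧ M.W p := by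
    intro X
    obtain ⟨I, hI⟩ := M.exists_initial
    obtain ⟨f⟩ := (hI X).1
    obtain ⟨Z, i, p, hi, hp, hw, -⟩ := M.factor_cof_trivFib f
    exact ⟨Z, p, ⟨I, i, hI, hi⟩, hp, hw⟩
  choose obj p hc hp hw using h
  have h₁ : ∀ {X Y : C} (f : X ⟶ Y), ∃ k : obj X ⟶ obj Y, Nonempty (k ≫ p Y ≅ p X ≫ f) :=
    fun {X Y} f => exists_lift_arrow (hc X) (hp Y) (hw Y) _
  choose map ρ using @h₁
  have h₂ : ∀ {X Y : C} {f g : X ⟶ Y} (μ : f ⟶ g), ∃ δ : map f ⟶ map g,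
      δ ▷ p Y = (ρ f).some.hom ≫ p X ◁ μ ≫ (ρ g).some.inv :=
    fun {X Y f g} μ => exists_lift_cell (hc X) (hp Y) (hw Y) _
  choose map₂ h₂ using @h₂
  exact ⟨{ obj := obj, p := p, cofibrant := hc, fib := hp, weq := hw, map := map,
           ρ := fun f => (ρ f).some, map₂ := map₂, map₂_p := h₂ }⟩

theorem nonempty_fibrantReplacement : Nonempty M.FibrantReplacement := by
  have h : ∀ X : C, ∃ (Z : C) (i : X ⟶ Z), M.IsFibrant Z ∧ M.Cof i ∧ M.W i := by
    intro X
    obtain ⟨T, hT⟩ := M.exists_terminal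
    obtain ⟨f⟩ := (hT X).1
    obtain ⟨Z, i, p, hi, hw, hp, -⟩ := M.factor_trivCof_fib f
    exact ⟨Z, i, ⟨T, p, hT, hp⟩, hi, hw⟩
  choose obj i hc hp hw using h
  have h₁ : ∀ {X Y : C} (f : X ⟶ Y), ∃ k : obj X ⟶ obj Y, Nonempty (f ≫ i Y ≅ i X ≫ k) :=
    fun {X Y} f => exists_colift_arrow (hc Y) (hp X) (hw X) _
  choose map ρ using @h₁
  have h₂ : ∀ {X Y : C} {f g : X ⟶ Y} (μ : f ⟶ g), ∃ δ : map f ⟶ map g,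
      i X ◁ δ = (ρ f).some.inv ≫ μ ▷ i Y ≫ (ρ g).some.hom :=
    fun {X Y f g} μ => exists_colift_cell (hc Y) (hp X) (hw X) _
  choose map₂ h₂ using @h₂
  exact ⟨{ obj := obj, i := i, fibrant := hc, cof := hp, weq := hw, map := map,
           lam := fun f => (ρ f).some, map₂ := map₂, i_map₂ := h₂ }⟩

variable {M}

lemma IsFibrant.comp {X Y : C} (hY : M.IsFibrant Y) (f : X ⟶ Y) (hf : M.Fib f) :
    M.IsFibrant X := by
  obtain ⟨T, g, hT, hg⟩ := hY
  exact ⟨T, f ≫ g, hT, M.fib_comp f g hf hg⟩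

namespace HoSigma

/-- Weak equivalences can be cancelled in `Ho(C, W)`. -/
lemma isCancellable {X Y : HoSigma M} {s : X ⟶ Y} (hs : M.W s.arrow) : IsCancellable s where
  right {Z g h a b} e := by
    -- Classes are equal as soon as all test functors agree on them, and a test functor sends `s` to
    -- a quasiequivalence.
    refine Hom₂.ext (HomotopyClass.ext fun T => ?_)
    have e' : (Hom₂.cls a).whiskerRight s.arrow = (Hom₂.cls b).whiskerRight s.arrow :=
      congrArg Hom₂.cls e
    have e'' := congrArg (HomotopyClass.ev T) e'
    rw [HomotopyClass.ev_whiskerRight, HomotopyClass.ev_whiskerRight] at e''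
    exact (T.inverts _ hs).isCancellable.right
      ((cancel_mono _).1 ((cancel_epi _).1 e''))
  left {Z g h a b} e := by
    refine Hom₂.ext (HomotopyClass.ext fun T => ?_)
    have e' : (Hom₂.cls a).whiskerLeft s.arrow = (Hom₂.cls b).whiskerLeft s.arrow :=
      congrArg Hom₂.cls e
    have e'' := congrArg (HomotopyClass.ev T) e'
    rw [HomotopyClass.ev_whiskerLeft, HomotopyClass.ev_whiskerLeft] at e''
    exact (T.inverts _ hs).isCancellable.left
      ((cancel_mono _).1 ((cancel_epi _).1 e''))

end HoSigma

/-! ### The 2-cells of `Ho(C, W)` which come from `C`, and their lifts. -/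

section Cells

lemma cell_comp {X Y : C} {f g h : X ⟶ Y} (μ : f ⟶ g) (ν : g ⟶ h) :
    (cell (μ ≫ ν) : (arr f : (⟨X⟩ : HoSigma M) ⟶ ⟨Y⟩) ⟶ arr h) = cell μ ≫ cell ν :=
  HoSigma.Hom₂.ext (HomotopyClass.ofCell_comp μ ν).symm

lemma cell_id {X Y : C} (f : X ⟶ Y) :
    (cell (𝟙 f) : (arr f : (⟨X⟩ : HoSigma M) ⟶ ⟨Y⟩) ⟶ arr f) = 𝟙 (arr f) :=
  HoSigma.Hom₂.ext (HomotopyClass.ofCell_id f)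

lemma whiskerLeft_cell {X Y Z : C} (f : X ⟶ Y) {g h : Y ⟶ Z} (μ : g ⟶ h) :
    (arr f : (⟨X⟩ : HoSigma M) ⟶ ⟨Y⟩) ◁ (cell μ : (arr g : (⟨Y⟩ : HoSigma M) ⟶ ⟨Z⟩) ⟶ arr h) =
      cell (f ◁ μ) :=
  HoSigma.Hom₂.ext (HomotopyClass.whiskerLeft_ofCell f μ)

lemma cell_whiskerRight {X Y Z : C} {f g : X ⟶ Y} (μ : f ⟶ g) (h : Y ⟶ Z) :
    (cell μ : (arr f : (⟨X⟩ : HoSigma M) ⟶ ⟨Y⟩) ⟶ arr g) ▷ (arr h : (⟨Y⟩ : HoSigma M) ⟶ ⟨Z⟩) =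
      cell (μ ▷ h) :=
  HoSigma.Hom₂.ext (HomotopyClass.whiskerRight_ofCell μ h)

/-- An invertible 2-cell of `C`, as an invertible 2-cell of `Ho(C, W)`. -/
abbrev cellIso {X Y : C} {f g : X ⟶ Y} (φ : f ≅ g) :
    (arr f : (⟨X⟩ : HoSigma M) ⟶ ⟨Y⟩) ≅ arr g :=
  HoSigma.projIso φ

/-- The projection from `C` to `Ho(C, W)`. -/
def proj (M : ModelStructure C) : C ⥤ᵖ HoSigma M where
  obj X := ⟨X⟩
  map f := arr f
  map₂ μ := cell μ
  map₂_id f := cell_id f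
  map₂_comp μ ν := cell_comp μ ν
  mapId X := Iso.refl _
  mapComp f g := Iso.refl _
  map₂_whisker_left f _ _ μ := by
    rw [← whiskerLeft_cell]
    exact (id_comp_comp_id _).symm
  map₂_whisker_right μ h := by
    rw [← cell_whiskerRight]
    exact (id_comp_comp_id _).symm
  map₂_associator f g h := assoc_aux (D := HoSigma M) (arr f) (arr g) (arr h)
  map₂_left_unitor f := leftUnitor_aux (D := HoSigma M) (arr f)
  map₂_right_unitor f := rightUnitor_aux (D := HoSigma M) (arr f)

/-- An invertible 2-cell of `Ho(C, W)` which, together with its inverse, comes from `C`. -/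
def IsCellular {X Y : HoSigma M} {f g : X ⟶ Y} (φ : f ≅ g) : Prop :=
  ∃ (a : f.arrow ⟶ g.arrow) (b : g.arrow ⟶ f.arrow),
    φ.hom = HoSigma.proj₂ a ∧ φ.inv = HoSigma.proj₂ b

lemma isCellular_projIso {X Y : HoSigma M} {f g : X ⟶ Y} (φ : f.arrow ≅ g.arrow) :
    IsCellular (HoSigma.projIso φ : f ≅ g) :=
  ⟨φ.hom, φ.inv, rfl, rfl⟩

lemma IsCellular.symm {X Y : HoSigma M} {f g : X ⟶ Y} {φ : f ≅ g} (h : IsCellular φ) :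
    IsCellular φ.symm := by
  obtain ⟨a, b, ha, hb⟩ := h
  exact ⟨b, a, hb, ha⟩

lemma IsCellular.trans {X Y : HoSigma M} {f g k : X ⟶ Y} {φ : f ≅ g} {ψ : g ≅ k}
    (h : IsCellular φ) (h' : IsCellular ψ) : IsCellular (φ ≪≫ ψ) := by
  obtain ⟨a, b, ha, hb⟩ := h
  obtain ⟨a', b', ha', hb'⟩ := h'
  exact ⟨a ≫ a', b' ≫ b, by rw [Iso.trans_hom, ha, ha']; exact (cell_comp a a').symm,
    by rw [Iso.trans_inv, hb, hb']; exact (cell_comp b' b).symm⟩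

lemma IsCellular.whiskerRightIso {X Y Z : HoSigma M} {f g : X ⟶ Y} {φ : f ≅ g}
    (h : IsCellular φ) (k : Y ⟶ Z) : IsCellular (Bicategory.whiskerRightIso φ k) := by
  obtain ⟨a, b, ha, hb⟩ := h
  exact ⟨a ▷ k.arrow, b ▷ k.arrow,
    by rw [Bicategory.whiskerRightIso_hom, ha]; exact cell_whiskerRight a k.arrow,
    by rw [Bicategory.whiskerRightIso_inv, hb]; exact cell_whiskerRight b k.arrow⟩

lemma IsCellular.whiskerLeftIso {X Y Z : HoSigma M} {f g : Y ⟶ Z} {φ : f ≅ g}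
    (h : IsCellular φ) (k : X ⟶ Y) : IsCellular (Bicategory.whiskerLeftIso k φ) := by
  obtain ⟨a, b, ha, hb⟩ := h
  exact ⟨k.arrow ◁ a, k.arrow ◁ b,
    by rw [Bicategory.whiskerLeftIso_hom, ha]; exact whiskerLeft_cell k.arrow a,
    by rw [Bicategory.whiskerLeftIso_inv, hb]; exact whiskerLeft_cell k.arrow b⟩

/-- The cells representing `φ` and its inverse are lifted separately in `C`, where the lifts need
not be mutually inverse; they become so in `Ho(C, W)`, where `p` can be cancelled. The lift is again
cellular, so that it can enter a further lift along `i`. -/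
lemma exists_lift_iso {X Y Z : HoSigma M} (hX : M.IsCofibrant X.obj) {p : Y ⟶ Z}
    (hp : M.Fib p.arrow) (hw : M.W p.arrow) {f g : X ⟶ Y} {φ : f ≫ p ≅ g ≫ p}
    (hφ : IsCellular φ) : ∃ ψ : f ≅ g, IsCellular ψ ∧ ψ.hom ▷ p = φ.hom := by
  obtain ⟨a, b, ha, hb⟩ := hφ
  obtain ⟨δ, h⟩ := exists_lift_cell hX hp hw a
  obtain ⟨δ', h'⟩ := exists_lift_cell hX hp hw b
  have hc := HoSigma.isCancellable hw
  have e : (HoSigma.proj₂ δ : f ⟶ g) ▷ p = φ.hom := by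
    rw [ha, ← h]; exact cell_whiskerRight δ p.arrow
  have e' : (HoSigma.proj₂ δ' : g ⟶ f) ▷ p = φ.inv := by
    rw [hb, ← h']; exact cell_whiskerRight δ' p.arrow
  exact ⟨⟨HoSigma.proj₂ δ, HoSigma.proj₂ δ', hc.right (by simp [e, e']),
    hc.right (by simp [e, e'])⟩, ⟨δ, δ', rfl, rfl⟩, e⟩

/-- The dual argument: extension along a trivial cofibration into a fibrant object, followed by
cancellation of `i` on the left. -/
lemma exists_colift_iso {X Y Z : HoSigma M} (hZ : M.IsFibrant Z.obj) {i : X ⟶ Y}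
    (hi : M.Cof i.arrow) (hw : M.W i.arrow) {f g : Y ⟶ Z} {φ : i ≫ f ≅ i ≫ g}
    (hφ : IsCellular φ) : ∃ ψ : f ≅ g, IsCellular ψ ∧ i ◁ ψ.hom = φ.hom := by
  obtain ⟨a, b, ha, hb⟩ := hφ
  obtain ⟨δ, h⟩ := exists_colift_cell hZ hi hw a
  obtain ⟨δ', h'⟩ := exists_colift_cell hZ hi hw b
  have hc := HoSigma.isCancellable hw
  have e : i ◁ (HoSigma.proj₂ δ : f ⟶ g) = φ.hom := by
    rw [ha, ← h]; exact whiskerLeft_cell i.arrow δ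
  have e' : i ◁ (HoSigma.proj₂ δ' : g ⟶ f) = φ.inv := by
    rw [hb, ← h']; exact whiskerLeft_cell i.arrow δ'
  exact ⟨⟨HoSigma.proj₂ δ, HoSigma.proj₂ δ', hc.left (by simp [e, e']),
    hc.left (by simp [e, e'])⟩, ⟨δ, δ', rfl, rfl⟩, e⟩

end Cells

/-! ### The Whitehead theorem. -/

section Whitehead

/-- A weak equivalence between fibrant-cofibrant objects is an equivalence in `Ho(C)`. -/
theorem isEquiv_of_w {X Y : Ho M} (f : X ⟶ Y) (hf : M.W f.hom.arrow) : IsEquiv f := by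
  -- In the factorization of `f` both factors are weak equivalences, by two-out-of-three, and the
  -- middle object is again fibrant and cofibrant. It is enough to treat a trivial cofibration and a
  -- trivial fibration.
  obtain ⟨Z, j, q, hj, hjw, hq, ⟨φ⟩⟩ := M.factor_trivCof_fib f.hom.arrow
  have hqw : M.W q := M.w_of_comp_left j q _ φ.symm hjw hf
  have hZf : M.IsFibrant Z := Y.2.1.comp q hq
  have hZc : M.IsCofibrant Z := X.2.2.comp j hj
  let Z' : Ho M := ⟨Z, hZf, hZc⟩
  -- Extending the identity of the fibrant object `X` along `j` gives a retraction `k` up to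
  -- isomorphism. The composite `k ≫ j` agrees with the identity after precomposition with `j`, and
  -- this isomorphism extends along `j` because `Z` is fibrant.
  have ej : IsEquiv (Ho.ofArrow j : X ⟶ Z') := by
    obtain ⟨k, ⟨a⟩⟩ := exists_colift_arrow X.2.1 hj hjw (𝟙 X.1)
    obtain ⟨ψ, -⟩ := exists_colift_iso (i := arr j) (f := arr (k ≫ j)) (g := arr (𝟙 Z)) hZf hj hjw
      (isCellular_projIso ((α_ _ _ _).symm ≪≫ Bicategory.whiskerRightIso a.symm j ≪≫ λ_ j ≪≫
        (ρ_ j).symm))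
    exact ⟨Ho.ofArrow k, ⟨InducedBicategory.isoMk (cellIso a.symm)⟩,
      ⟨InducedBicategory.isoMk ψ⟩⟩
  -- Dually, `q` has a section because `Y` is cofibrant, and the other composite is compared with
  -- the identity after `q`, using that `Z` is cofibrant.
  have eq : IsEquiv (Ho.ofArrow q : Z' ⟶ Y) := by
    obtain ⟨k, ⟨a⟩⟩ := exists_lift_arrow Y.2.2 hq hqw (𝟙 Y.1)
    obtain ⟨ψ, -⟩ := exists_lift_iso (p := arr q) (f := arr (q ≫ k)) (g := arr (𝟙 Z)) hZc hq hqw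
      (isCellular_projIso (α_ _ _ _ ≪≫ Bicategory.whiskerLeftIso q a ≪≫ ρ_ q ≪≫ (λ_ q).symm))
    exact ⟨Ho.ofArrow k, ⟨InducedBicategory.isoMk ψ⟩,
      ⟨InducedBicategory.isoMk (cellIso a)⟩⟩
  exact (ej.comp eq).of_iso (InducedBicategory.isoMk (cellIso φ.symm))

end Whitehead

end ModelStructure

/-! ### The replacements as pseudofunctors with values in `Ho(C, W)` and `Ho(C)`. -/

lemma comp_whiskerLeft_id_eq {B : Type u} [Bicategory.{w, v} B] {X Y Z : B} (f : X ⟶ Y) (g : Y ⟶ Z)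
    {h : X ⟶ Z} (a : h ⟶ f ≫ g) : a ≫ f ◁ 𝟙 g = a := by
  simp

namespace ModelStructure

variable {C : Type u} [Bicategory.{w, v} C] {M : ModelStructure C}

section Replacements

variable (Q : M.CofibrantReplacement) (R : M.FibrantReplacement)

namespace CofibrantReplacement

/-- The cells `ρ`, in `Ho(C, W)`. -/
def nat {X Y : C} (f : X ⟶ Y) : (arr (Q.map f) : (⟨Q.obj X⟩ : HoSigma M) ⟶ ⟨Q.obj Y⟩) ≫ arr (Q.p Y) ≅
    arr (Q.p X) ≫ arr f :=
  cellIso (Q.ρ f)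

lemma isCellular_nat {X Y : C} (f : X ⟶ Y) : IsCellular (Q.nat f) :=
  isCellular_projIso _

/-- The composite of `ρ` with unitors is cellular, with target the whiskering of the identity by
`p`; the cell `ψ` is its lift along `p`. -/
lemma exists_mapId (X : C) : ∃ ψ : (arr (Q.map (𝟙 X)) : (⟨Q.obj X⟩ : HoSigma M) ⟶ ⟨Q.obj X⟩) ≅ 𝟙 _,
    IsCellular ψ ∧ (Q.nat (𝟙 X)).hom =
      ψ.hom ▷ arr (Q.p X) ≫ (λ_ (arr (Q.p X))).hom ≫ (ρ_ (arr (Q.p X))).inv := by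
  obtain ⟨ψ, h, e⟩ := exists_lift_iso (Q.cofibrant X) (Q.fib X) (Q.weq X)
    (φ := Q.nat (𝟙 X) ≪≫ ρ_ (arr (Q.p X)) ≪≫ (λ_ (arr (Q.p X))).symm)
    ((Q.isCellular_nat _).trans (.trans (isCellular_projIso (ρ_ (Q.p X)))
      (.symm (isCellular_projIso (λ_ (Q.p X))))))
  exact ⟨ψ, h, by rw [e]; simp⟩

/-- The lift along `p` of the pasting of `ρ` for `f ≫ g` with the inverses of `ρ` for `f` and for
`g`. -/
lemma exists_mapComp {X Y Z : C} (f : X ⟶ Y) (g : Y ⟶ Z) :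
    ∃ ψ : (arr (Q.map (f ≫ g)) : (⟨Q.obj X⟩ : HoSigma M) ⟶ ⟨Q.obj Z⟩) ≅ arr (Q.map f) ≫ arr (Q.map g),
      IsCellular ψ ∧ (Q.nat (f ≫ g)).hom =
        ψ.hom ▷ arr (Q.p Z) ≫ (α_ _ _ _).hom ≫ arr (Q.map f) ◁ (Q.nat g).hom ≫ (α_ _ _ _).inv ≫
          (Q.nat f).hom ▷ arr g ≫ (α_ (arr (Q.p X)) (arr f) (arr g)).hom := by
  obtain ⟨ψ, h, e⟩ := exists_lift_iso (Q.cofibrant X) (Q.fib Z) (Q.weq Z)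
    (φ := Q.nat (f ≫ g) ≪≫ (α_ (arr (Q.p X)) (arr f) (arr g)).symm ≪≫
      whiskerRightIso (Q.nat f).symm (arr g) ≪≫ α_ _ _ _ ≪≫
        whiskerLeftIso (arr (Q.map f)) (Q.nat g).symm ≪≫ (α_ _ _ _).symm)
    ((Q.isCellular_nat _).trans (.trans (.symm (isCellular_projIso _))
      (.trans ((Q.isCellular_nat f).symm.whiskerRightIso _) (.trans (isCellular_projIso _)
        (.trans ((Q.isCellular_nat g).symm.whiskerLeftIso _) (.symm (isCellular_projIso _)))))))
  exact ⟨ψ, h, by rw [e]; simp⟩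

/-- The comparison cell between the replacement of an identity and the identity. -/
noncomputable def mapIdIso (X : C) :
    (arr (Q.map (𝟙 X)) : (⟨Q.obj X⟩ : HoSigma M) ⟶ ⟨Q.obj X⟩) ≅ 𝟙 _ :=
  (Q.exists_mapId X).choose

lemma isCellular_mapIdIso (X : C) : IsCellular (Q.mapIdIso X) :=
  (Q.exists_mapId X).choose_spec.1

lemma nat_id (X : C) : (Q.nat (𝟙 X)).hom =
    (Q.mapIdIso X).hom ▷ arr (Q.p X) ≫ (λ_ (arr (Q.p X))).hom ≫ (ρ_ (arr (Q.p X))).inv :=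
  (Q.exists_mapId X).choose_spec.2

/-- The comparison cell between the replacement of a composite and the composite of the
replacements. -/
noncomputable def mapCompIso {X Y Z : C} (f : X ⟶ Y) (g : Y ⟶ Z) :
    (arr (Q.map (f ≫ g)) : (⟨Q.obj X⟩ : HoSigma M) ⟶ ⟨Q.obj Z⟩) ≅ arr (Q.map f) ≫ arr (Q.map g) :=
  (Q.exists_mapComp f g).choose

lemma isCellular_mapCompIso {X Y Z : C} (f : X ⟶ Y) (g : Y ⟶ Z) : IsCellular (Q.mapCompIso f g) :=
  (Q.exists_mapComp f g).choose_spec.1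

lemma nat_comp {X Y Z : C} (f : X ⟶ Y) (g : Y ⟶ Z) : (Q.nat (f ≫ g)).hom =
    (Q.mapCompIso f g).hom ▷ arr (Q.p Z) ≫ (α_ _ _ _).hom ≫ arr (Q.map f) ◁ (Q.nat g).hom ≫
      (α_ _ _ _).inv ≫ (Q.nat f).hom ▷ arr g ≫ (α_ (arr (Q.p X)) (arr f) (arr g)).hom :=
  (Q.exists_mapComp f g).choose_spec.2

lemma cell_map₂_nat {X Y : C} {f g : X ⟶ Y} (μ : f ⟶ g) :
    (cell (Q.map₂ μ) : (arr (Q.map f) : (⟨Q.obj X⟩ : HoSigma M) ⟶ ⟨Q.obj Y⟩) ⟶ _) ▷ arr (Q.p Y) ≫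
      (Q.nat g).hom = (Q.nat f).hom ≫ arr (Q.p X) ◁ cell μ := by
  rw [cell_whiskerRight, Q.map₂_p, cell_comp, cell_comp, ← whiskerLeft_cell]
  simp only [Category.assoc]
  exact congrArg _ ((congrArg _ (Q.nat g).inv_hom_id).trans (Category.comp_id _))

/-- The cofibrant replacement, as the data which define a pseudofunctor to `Ho(C, W)`. -/
noncomputable def liftData : LiftData (proj M) where
  obj X := ⟨Q.obj X⟩
  e X := arr (Q.p X)
  cancel e := (HoSigma.isCancellable (Q.weq _)).right e
  map f := arr (Q.map f)
  nat f := Q.nat f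
  map₂ μ := cell (Q.map₂ μ)
  map₂_e μ := Q.cell_map₂_nat μ
  mapId X := Q.mapIdIso X
  mapId_e X := (comp_whiskerLeft_id_eq _ _ _).trans (Q.nat_id X)
  mapComp f g := Q.mapCompIso f g
  mapComp_e f g := (comp_whiskerLeft_id_eq _ _ _).trans (Q.nat_comp f g)

/-- The cofibrant replacement, as a pseudofunctor to `Ho(C, W)`. -/
noncomputable def psf : C ⥤ᵖ HoSigma M :=
  Q.liftData.pseudofunctor

/-- The arrows `p`, as a pseudonatural transformation. -/
noncomputable def trans : Q.psf ⟶ proj M :=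
  Q.liftData.trans

end CofibrantReplacement

end Replacements

end ModelStructure

section

variable {B : Type u} [Bicategory.{w, v} B]

/-- This lemma and the three that follow translate between two conventions.
`ReplacementPseudofunctor` describes structural cells from the identity, or from a composite, by
means of their whiskerings; `LiftData` and `ColiftData` use the inverse cells in the form of
pseudonaturality laws. -/
lemma inv_whiskerRight_eq_iff {X Y : B} {f : X ⟶ X} {e : X ⟶ Y} (n : f ≫ e ≅ e ≫ 𝟙 Y)
    (m : f ≅ 𝟙 X) : m.inv ▷ e = (λ_ e).hom ≫ (ρ_ e).inv ≫ n.inv ↔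
    n.hom = m.hom ▷ e ≫ (λ_ e).hom ≫ (ρ_ e).inv := by
  rw [← cancel_epi (m.hom ▷ e), ← cancel_mono n.hom, hom_inv_whiskerRight]
  simp only [Category.id_comp, Category.assoc, Iso.inv_hom_id, Category.comp_id]

lemma inv_whiskerRight_comp_eq_iff {X Y Z X' Y' Z' : B} {f : X ⟶ Y} {g : Y ⟶ Z} {k : X ⟶ Z}
    {f' : X' ⟶ Y'} {g' : Y' ⟶ Z'} {eX : X ⟶ X'} {eY : Y ⟶ Y'} {eZ : Z ⟶ Z'}
    (nf : f ≫ eY ≅ eX ≫ f') (ng : g ≫ eZ ≅ eY ≫ g') (nk : k ≫ eZ ≅ eX ≫ f' ≫ g')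
    (m : k ≅ f ≫ g) :
    m.inv ▷ eZ = (α_ _ _ _).hom ≫ f ◁ ng.hom ≫ (α_ _ _ _).inv ≫ nf.hom ▷ g' ≫ (α_ _ _ _).hom ≫
        nk.inv ↔
      nk.hom = m.hom ▷ eZ ≫ (α_ _ _ _).hom ≫ f ◁ ng.hom ≫ (α_ _ _ _).inv ≫ nf.hom ▷ g' ≫
        (α_ _ _ _).hom := by
  rw [← cancel_epi (m.hom ▷ eZ), ← cancel_mono nk.hom, hom_inv_whiskerRight]
  simp only [Category.id_comp, Category.assoc, Iso.inv_hom_id, Category.comp_id]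

lemma whiskerLeft_inv_eq_iff {X Y : B} {f : X ⟶ X} {e : X ⟶ Y} {g : Y ⟶ Y} (n : f ≫ e ≅ e ≫ g)
    (m : f ≅ 𝟙 X) (ψ : g ≅ 𝟙 Y) :
    e ◁ ψ.inv = ((ρ_ e).hom ≫ (λ_ e).inv) ≫ m.inv ▷ e ≫ n.hom ↔
      n.hom ≫ e ◁ ψ.hom = m.hom ▷ e ≫ (λ_ e).hom ≫ (ρ_ e).inv := by
  rw [← cancel_mono (e ◁ ψ.hom), whiskerLeft_inv_hom,
    ← cancel_epi (m.hom ▷ e ≫ (λ_ e).hom ≫ (ρ_ e).inv)]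
  simp only [Category.assoc, Category.comp_id, Iso.inv_hom_id_assoc, Iso.hom_inv_id_assoc,
    hom_inv_whiskerRight_assoc]
  exact eq_comm

lemma whiskerLeft_inv_comp_eq_iff {X Y Z X' Y' Z' : B} {f : X ⟶ Y} {g : Y ⟶ Z} {k : X ⟶ Z}
    {f' : X' ⟶ Y'} {g' : Y' ⟶ Z'} {k' : X' ⟶ Z'} {eX : X ⟶ X'} {eY : Y ⟶ Y'} {eZ : Z ⟶ Z'}
    (nf : f ≫ eY ≅ eX ≫ f') (ng : g ≫ eZ ≅ eY ≫ g') (nk : k ≫ eZ ≅ eX ≫ k')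
    (m : k ≅ f ≫ g) (ψ : k' ≅ f' ≫ g') :
    eX ◁ ψ.inv = ((α_ _ _ _).inv ≫ nf.inv ▷ g' ≫ (α_ _ _ _).hom ≫ f ◁ ng.inv ≫ (α_ _ _ _).inv) ≫
        m.inv ▷ eZ ≫ nk.hom ↔
      nk.hom ≫ eX ◁ ψ.hom = m.hom ▷ eZ ≫ (α_ _ _ _).hom ≫ f ◁ ng.hom ≫ (α_ _ _ _).inv ≫
        nf.hom ▷ g' ≫ (α_ _ _ _).hom := by
  rw [← cancel_mono (eX ◁ ψ.hom), whiskerLeft_inv_hom,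
    ← cancel_epi (m.hom ▷ eZ ≫ (α_ _ _ _).hom ≫ f ◁ ng.hom ≫ (α_ _ _ _).inv ≫
        nf.hom ▷ g' ≫ (α_ _ _ _).hom)]
  simp only [Category.assoc, Category.comp_id, Iso.inv_hom_id_assoc, Iso.hom_inv_id_assoc,
    hom_inv_whiskerRight_assoc, whiskerLeft_hom_inv_assoc]
  exact eq_comm

end

namespace ModelStructure

variable {C : Type u} [Bicategory.{w, v} C] {M : ModelStructure C}

/-- The inclusion of `Ho(C)` into `Ho(C, W)`. -/
def incl (M : ModelStructure C) : Ho M ⥤ᵖ HoSigma M where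
  obj X := ⟨X.1⟩
  map f := f.hom
  map₂ a := a.hom
  map₂_id _ := rfl
  map₂_comp _ _ := rfl
  mapId _ := Iso.refl _
  mapComp _ _ := Iso.refl _
  map₂_whisker_left _ _ _ _ := (id_comp_comp_id _).symm
  map₂_whisker_right _ _ := (id_comp_comp_id _).symm
  map₂_associator f g h := assoc_aux f.hom g.hom h.hom
  map₂_left_unitor f := leftUnitor_aux f.hom
  map₂_right_unitor f := rightUnitor_aux f.hom

variable (Q : M.CofibrantReplacement) (R : M.FibrantReplacement)

/-- The cells `lam`, in `Ho(C, W)`. -/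
def FibrantReplacement.nat {X Y : C} (f : X ⟶ Y) :
    (arr f : (⟨X⟩ : HoSigma M) ⟶ ⟨Y⟩) ≫ arr (R.i Y) ≅ arr (R.i X) ≫ arr (R.map f) :=
  cellIso (R.lam f)

lemma FibrantReplacement.isCellular_nat {X Y : C} (f : X ⟶ Y) : IsCellular (R.nat f) :=
  isCellular_projIso _

lemma FibrantReplacement.cell_map₂_nat {X Y : C} {f g : X ⟶ Y} (μ : f ⟶ g) :
    (cell μ : (arr f : (⟨X⟩ : HoSigma M) ⟶ ⟨Y⟩) ⟶ _) ▷ arr (R.i Y) ≫ (R.nat g).hom =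
      (R.nat f).hom ≫ arr (R.i X) ◁ cell (R.map₂ μ) := by
  rw [whiskerLeft_cell, R.i_map₂, cell_comp, cell_comp, ← cell_whiskerRight]
  exact (Iso.hom_inv_id_assoc (R.nat f) _).symm

/-- The cell already constructed for `Q` is pasted with the comparison cell of `R` and extended
along the trivial cofibration `i`. This is possible because that cell is cellular. -/
lemma exists_rMapId (X : C) :
    ∃ ψ : (arr (R.map (Q.map (𝟙 X))) : (⟨R.obj (Q.obj X)⟩ : HoSigma M) ⟶ _) ≅ 𝟙 _,
      (R.nat (Q.map (𝟙 X))).hom ≫ arr (R.i (Q.obj X)) ◁ ψ.hom =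
        (Q.mapIdIso X).hom ▷ arr (R.i (Q.obj X)) ≫ (λ_ _).hom ≫ (ρ_ _).inv := by
  obtain ⟨ψ, -, e⟩ := exists_colift_iso (R.fibrant _) (R.cof _) (R.weq _)
    (φ := (R.nat (Q.map (𝟙 X))).symm ≪≫ whiskerRightIso (Q.mapIdIso X) (arr (R.i (Q.obj X))) ≪≫
      λ_ _ ≪≫ (ρ_ _).symm)
    ((R.isCellular_nat _).symm.trans (.trans ((Q.isCellular_mapIdIso X).whiskerRightIso _)
      (.trans (isCellular_projIso _) (.symm (isCellular_projIso _)))))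
  refine ⟨ψ, (congrArg ((R.nat (Q.map (𝟙 X))).hom ≫ ·) e).trans ?_⟩
  simp only [Iso.trans_hom, Iso.symm_hom, whiskerRightIso_hom, Iso.hom_inv_id_assoc]

lemma exists_rMapComp {X Y Z : C} (f : X ⟶ Y) (g : Y ⟶ Z) :
    ∃ ψ : (arr (R.map (Q.map (f ≫ g))) : (⟨R.obj (Q.obj X)⟩ : HoSigma M) ⟶ ⟨R.obj (Q.obj Z)⟩) ≅
        arr (R.map (Q.map f)) ≫ arr (R.map (Q.map g)),
      (R.nat (Q.map (f ≫ g))).hom ≫ arr (R.i (Q.obj X)) ◁ ψ.hom =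
        (Q.mapCompIso f g).hom ▷ arr (R.i (Q.obj Z)) ≫ (α_ _ _ _).hom ≫
          arr (Q.map f) ◁ (R.nat (Q.map g)).hom ≫ (α_ _ _ _).inv ≫
            (R.nat (Q.map f)).hom ▷ arr (R.map (Q.map g)) ≫ (α_ _ _ _).hom := by
  obtain ⟨ψ, -, e⟩ := exists_colift_iso (R.fibrant _) (R.cof _) (R.weq _)
    (φ := (R.nat (Q.map (f ≫ g))).symm ≪≫
      whiskerRightIso (Q.mapCompIso f g) (arr (R.i (Q.obj Z))) ≪≫ α_ _ _ _ ≪≫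
      whiskerLeftIso (arr (Q.map f)) (R.nat (Q.map g)) ≪≫ (α_ _ _ _).symm ≪≫
      whiskerRightIso (R.nat (Q.map f)) (arr (R.map (Q.map g))) ≪≫ α_ _ _ _)
    ((R.isCellular_nat _).symm.trans (.trans
      ((Q.isCellular_mapCompIso f g).whiskerRightIso _)
      (.trans (isCellular_projIso _) (.trans ((R.isCellular_nat _).whiskerLeftIso _)
        (.trans (.symm (isCellular_projIso _)) (.trans ((R.isCellular_nat _).whiskerRightIso _)
          (isCellular_projIso _)))))))
  refine ⟨ψ, (congrArg ((R.nat (Q.map (f ≫ g))).hom ≫ ·) e).trans ?_⟩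
  simp only [Iso.trans_hom, Iso.symm_hom, whiskerRightIso_hom, whiskerLeftIso_hom,
    Iso.hom_inv_id_assoc]

/-- The fibrant-cofibrant replacement, as the data which define a pseudofunctor to
`Ho(C, W)`. -/
noncomputable def coliftData : ColiftData Q.psf where
  obj X := ⟨R.obj (Q.obj X)⟩
  e X := arr (R.i (Q.obj X))
  cancel e := (HoSigma.isCancellable (R.weq _)).left e
  map f := arr (R.map (Q.map f))
  nat f := R.nat (Q.map f)
  map₂ μ := cell (R.map₂ (Q.map₂ μ))
  map₂_e μ := R.cell_map₂_nat (Q.map₂ μ)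
  mapId X := (exists_rMapId Q R X).choose
  mapId_e X := (exists_rMapId Q R X).choose_spec
  mapComp f g := (exists_rMapComp Q R f g).choose
  mapComp_e f g := (exists_rMapComp Q R f g).choose_spec

namespace CofibrantReplacement

lemma mapIdIso_inv_whiskerRight (X : C) :
    (Q.mapIdIso X).inv ▷ arr (Q.p X) =
      cell ((λ_ (Q.p X)).hom ≫ (ρ_ (Q.p X)).inv ≫ (Q.ρ (𝟙 X)).inv) := by
  rw [cell_comp, cell_comp]
  exact (inv_whiskerRight_eq_iff (B := HoSigma M) (Q.nat (𝟙 X)) (Q.mapIdIso X)).2 (Q.nat_id X)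

lemma mapCompIso_inv_whiskerRight {X Y Z : C} (f : X ⟶ Y) (g : Y ⟶ Z) :
    (Q.mapCompIso f g).inv ▷ arr (Q.p Z) =
      cell ((α_ _ _ _).hom ≫ Q.map f ◁ (Q.ρ g).hom ≫ (α_ _ _ _).inv ≫ (Q.ρ f).hom ▷ g ≫
        (α_ _ _ _).hom ≫ (Q.ρ (f ≫ g)).inv) := by
  simp only [cell_comp, ← cell_whiskerRight, ← whiskerLeft_cell]
  exact (inv_whiskerRight_comp_eq_iff (B := HoSigma M) (Q.nat f) (Q.nat g) (Q.nat (f ≫ g))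
    (Q.mapCompIso f g)).2 (Q.nat_comp f g)

end CofibrantReplacement

/-- The laws hold in `Ho(C, W)` by transfer along `p` and then along `i`. As `Ho(C)` is a full
sub-bicategory, they hold there as well. -/
theorem nonempty_replacementPseudofunctor : Nonempty (ReplacementPseudofunctor Q R) := by
  let L := coliftData Q R
  let P := L.pseudofunctor
  refine ⟨{
    mapId := fun X => InducedBicategory.isoMk (L.mapId X)
    mapComp := fun f g => InducedBicategory.isoMk (L.mapComp f g)
    map₂_id := fun f => InducedBicategory.hom₂_ext (P.map₂_id f)
    map₂_comp := fun μ ν => InducedBicategory.hom₂_ext (P.map₂_comp μ ν)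
    map₂_whisker_left := fun f _ _ μ => InducedBicategory.hom₂_ext (P.map₂_whisker_left f μ)
    map₂_whisker_right := fun μ f => InducedBicategory.hom₂_ext (P.map₂_whisker_right μ f)
    map₂_associator := fun f g h => InducedBicategory.hom₂_ext (P.map₂_associator f g h)
    map₂_left_unitor := fun f => InducedBicategory.hom₂_ext (P.map₂_left_unitor f)
    map₂_right_unitor := fun f => InducedBicategory.hom₂_ext (P.map₂_right_unitor f)
    ξ := fun X => (Q.mapIdIso X).inv
    ξ_p := Q.mapIdIso_inv_whiskerRight
    i_mapId := fun X => ?_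
    φ := fun f g => (Q.mapCompIso f g).inv
    φ_p := Q.mapCompIso_inv_whiskerRight
    i_mapComp := fun f g => ?_ }⟩
  · rw [cell_comp]
    exact (whiskerLeft_inv_eq_iff (B := HoSigma M) (R.nat (Q.map (𝟙 X))) (Q.mapIdIso X)
      (L.mapId X)).2 (L.mapId_e X)
  · simp only [cell_comp, ← cell_whiskerRight, ← whiskerLeft_cell]
    exact (whiskerLeft_inv_comp_eq_iff (B := HoSigma M) (R.nat (Q.map f)) (R.nat (Q.map g))
      (R.nat (Q.map (f ≫ g))) (Q.mapCompIso f g) (L.mapComp f g)).2 (L.mapComp_e f g)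

namespace ReplacementPseudofunctor

variable {Q R} (S : ReplacementPseudofunctor Q R)

/-- Cancelling `p` shows that the prescribed whiskering leaves no choice. With `φ_eq`, this lets an
arbitrary `S` be related to the pseudofunctor `Q.psf`, which is built from choices independent of
`S`. -/
lemma ξ_eq (X : C) : S.ξ X = (Q.mapIdIso X).inv :=
  (HoSigma.isCancellable (Q.weq X)).right
    ((S.ξ_p X).trans (Q.mapIdIso_inv_whiskerRight X).symm)

lemma φ_eq {X Y Z : C} (f : X ⟶ Y) (g : Y ⟶ Z) : S.φ f g = (Q.mapCompIso f g).inv :=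
  (HoSigma.isCancellable (Q.weq Z)).right
    ((S.φ_p f g).trans (Q.mapCompIso_inv_whiskerRight f g).symm)

/-- The cell `S.mapId`, in `Ho(C, W)`. -/
def mapIdIso (X : C) :
    (arr (R.map (Q.map (𝟙 X))) : (⟨R.obj (Q.obj X)⟩ : HoSigma M) ⟶ _) ≅ 𝟙 _ :=
  (incl M).map₂Iso (S.mapId X)

/-- The cell `S.mapComp`, in `Ho(C, W)`. -/
def mapCompIso {X Y Z : C} (f : X ⟶ Y) (g : Y ⟶ Z) :
    (arr (R.map (Q.map (f ≫ g))) : (⟨R.obj (Q.obj X)⟩ : HoSigma M) ⟶ ⟨R.obj (Q.obj Z)⟩) ≅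
      arr (R.map (Q.map f)) ≫ arr (R.map (Q.map g)) :=
  (incl M).map₂Iso (S.mapComp f g)

/-- With `nat_comp`, this is what makes the arrows `i` pseudonatural from `Q.psf` to the given `r`,
for every admissible choice of its structural cells. -/
lemma nat_id (X : C) : (R.nat (Q.map (𝟙 X))).hom ≫ arr (R.i (Q.obj X)) ◁ (S.mapIdIso X).hom =
    (Q.mapIdIso X).hom ▷ arr (R.i (Q.obj X)) ≫ (λ_ _).hom ≫ (ρ_ _).inv := by
  have h := S.i_mapId X
  rw [S.ξ_eq, cell_comp] at h
  exact (whiskerLeft_inv_eq_iff (B := HoSigma M) (R.nat (Q.map (𝟙 X))) (Q.mapIdIso X)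
      (S.mapIdIso X)).1 h

lemma nat_comp {X Y Z : C} (f : X ⟶ Y) (g : Y ⟶ Z) :
    (R.nat (Q.map (f ≫ g))).hom ≫ arr (R.i (Q.obj X)) ◁ (S.mapCompIso f g).hom =
      (Q.mapCompIso f g).hom ▷ arr (R.i (Q.obj Z)) ≫ (α_ _ _ _).hom ≫
        arr (Q.map f) ◁ (R.nat (Q.map g)).hom ≫ (α_ _ _ _).inv ≫
          (R.nat (Q.map f)).hom ▷ arr (R.map (Q.map g)) ≫ (α_ _ _ _).hom := by
  have h := S.i_mapComp f g
  simp only [cell_comp, ← cell_whiskerRight, ← whiskerLeft_cell, S.φ_eq] at h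
  exact (whiskerLeft_inv_comp_eq_iff (B := HoSigma M) (R.nat (Q.map f)) (R.nat (Q.map g))
      (R.nat (Q.map (f ≫ g))) (Q.mapCompIso f g) (S.mapCompIso f g)).1 h

/-- The arrows `i`, as a pseudonatural transformation. -/
noncomputable def trans : Q.psf ⟶ S.r.comp (incl M) where
  app X := arr (R.i (Q.obj X))
  naturality f := R.nat (Q.map f)
  naturality_naturality μ := R.cell_map₂_nat (Q.map₂ μ)
  naturality_id X := (congrArg ((R.nat (Q.map (𝟙 X))).hom ≫ arr (R.i (Q.obj X)) ◁ ·)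
    (Category.comp_id (S.mapIdIso X).hom)).trans (S.nat_id X)
  naturality_comp f g := (congrArg ((R.nat (Q.map (f ≫ g))).hom ≫ arr (R.i (Q.obj _)) ◁ ·)
    (Category.comp_id (S.mapCompIso f g).hom)).trans (S.nat_comp f g)

end ReplacementPseudofunctor

lemma CofibrantReplacement.w_map {X Y : C} {f : X ⟶ Y} (hf : M.W f) : M.W (Q.map f) :=
  M.w_of_comp_right _ (Q.p Y) _ (Q.ρ f) (Q.weq Y) (M.w_comp (Q.p X) f _ (Iso.refl _) (Q.weq X) hf)

lemma FibrantReplacement.w_map {X Y : C} {f : X ⟶ Y} (hf : M.W f) : M.W (R.map f) :=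
  M.w_of_comp_left (R.i X) _ _ (R.lam f).symm (R.weq X)
    (M.w_comp f (R.i Y) _ (Iso.refl _) hf (R.weq Y))

theorem ReplacementPseudofunctor.inverts {Q : M.CofibrantReplacement} {R : M.FibrantReplacement}
    (S : ReplacementPseudofunctor Q R) : Inverts M.W S.r :=
  fun _ _ _ hf => isEquiv_of_w _ (R.w_map (Q.w_map hf))

end ModelStructure

/-! ### Reduction of arbitrary targets to test functors. -/

section Generated

variable {C : Type u} [Bicategory.{w, v} C]

/-- Formal expressions for the 2-cells generated by those of `C`, under compositions and
cancellation of arrows of `W`. -/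
inductive FormalCell (W : ArrowClass C) :
    ∀ {X Y : C}, (X ⟶ Y) → (X ⟶ Y) → Type (max u v w)
  | cell {X Y : C} {f g : X ⟶ Y} (μ : f ⟶ g) : FormalCell W f g
  | comp {X Y : C} {f g h : X ⟶ Y} (s : FormalCell W f g) (t : FormalCell W g h) :
      FormalCell W f h
  | whiskerLeft {X Y Z : C} (l : X ⟶ Y) {f g : Y ⟶ Z} (t : FormalCell W f g) :
      FormalCell W (l ≫ f) (l ≫ g)
  | whiskerRight {X Y Z : C} {f g : X ⟶ Y} (t : FormalCell W f g) (r : Y ⟶ Z) :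
      FormalCell W (f ≫ r) (g ≫ r)
  | cancelRight {X Y Z : C} {f g : X ⟶ Y} (s : Y ⟶ Z) (hs : W s)
      (t : FormalCell W (f ≫ s) (g ≫ s)) : FormalCell W f g
  | cancelLeft {X Y Z : C} {f g : Y ⟶ Z} (s : X ⟶ Y) (hs : W s)
      (t : FormalCell W (s ≫ f) (s ≫ g)) : FormalCell W f g

variable {W : ArrowClass C} {D : Type u₁} [Bicategory.{w₁, v₁} D] (F : C ⥤ᵖ D)
  (hF : ∀ ⦃X Y : C⦄ (f : X ⟶ Y), W f → IsQuasiequiv (F.map f))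

/-- The value of a formal expression in the target of a pseudofunctor which maps `W` to
quasiequivalences. -/
noncomputable def FormalCell.eval : ∀ {X Y : C} {f g : X ⟶ Y}, FormalCell W f g →
    (F.map f ⟶ F.map g)
  | _, _, _, _, .cell μ => F.map₂ μ
  | _, _, _, _, .comp s t => s.eval ≫ t.eval
  | _, _, _, _, .whiskerLeft l t => (F.mapComp l _).hom ≫ F.map l ◁ t.eval ≫ (F.mapComp l _).inv
  | _, _, _, _, .whiskerRight t r => (F.mapComp _ r).hom ≫ t.eval ▷ F.map r ≫ (F.mapComp _ r).inv
  | _, _, _, _, .cancelRight s hs t => (((hF s hs).1 _ _ _).2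
      ((F.mapComp _ s).inv ≫ t.eval ≫ (F.mapComp _ s).hom)).choose
  | _, _, _, _, .cancelLeft s hs t => (((hF s hs).2 _ _ _).2
      ((F.mapComp s _).inv ≫ t.eval ≫ (F.mapComp s _).hom)).choose

lemma FormalCell.eval_cancelRight {X Y Z : C} {f g : X ⟶ Y} (s : Y ⟶ Z) (hs : W s)
    (t : FormalCell W (f ≫ s) (g ≫ s)) : (cancelRight s hs t).eval F hF ▷ F.map s =
      (F.mapComp f s).inv ≫ t.eval F hF ≫ (F.mapComp g s).hom :=
  (((hF s hs).1 _ _ _).2 ((F.mapComp f s).inv ≫ t.eval F hF ≫ (F.mapComp g s).hom)).choose_spec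

lemma FormalCell.eval_cancelLeft {X Y Z : C} {f g : Y ⟶ Z} (s : X ⟶ Y) (hs : W s)
    (t : FormalCell W (s ≫ f) (s ≫ g)) : F.map s ◁ (cancelLeft s hs t).eval F hF =
      (F.mapComp s f).inv ≫ t.eval F hF ≫ (F.mapComp s g).hom :=
  (((hF s hs).2 _ _ _).2 ((F.mapComp s f).inv ≫ t.eval F hF ≫ (F.mapComp s g).hom)).choose_spec

/-- The 2-cells of the target of `F` generated by the image of `F`, as a type in a universe which
depends on `C` only. -/
def GeneratedCell {X Y : C} (f g : X ⟶ Y) : Type (max u v w) :=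
  Quotient (Setoid.ker (FormalCell.eval F hF : FormalCell W f g → _))

namespace GeneratedCell

variable {F hF}

/-- The generated 2-cell given by a formal expression. -/
noncomputable def mk {X Y : C} {f g : X ⟶ Y} (t : FormalCell W f g) : GeneratedCell F hF f g :=
  Quotient.mk _ t

/-- The underlying 2-cell. -/
noncomputable def ev {X Y : C} {f g : X ⟶ Y} (a : GeneratedCell F hF f g) : F.map f ⟶ F.map g :=
  Quotient.lift (FormalCell.eval F hF) (fun _ _ h => h) a

lemma ext {X Y : C} {f g : X ⟶ Y} {a b : GeneratedCell F hF f g} (h : a.ev = b.ev) : a = b := by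
  induction a using Quotient.inductionOn with | _ s =>
  induction b using Quotient.inductionOn with | _ t =>
  exact Quotient.sound h

/-- The image of a 2-cell of `C`. -/
noncomputable def ofCell {X Y : C} {f g : X ⟶ Y} (μ : f ⟶ g) : GeneratedCell F hF f g :=
  mk (.cell μ)

@[simp] lemma ev_ofCell {X Y : C} {f g : X ⟶ Y} (μ : f ⟶ g) :
    (ofCell μ : GeneratedCell F hF f g).ev = F.map₂ μ := rfl

/-- Vertical composition. -/
noncomputable def comp {X Y : C} {f g h : X ⟶ Y} (a : GeneratedCell F hF f g) (b : GeneratedCell F hF g h) :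
    GeneratedCell F hF f h :=
  Quotient.map₂ .comp (fun _ _ h _ _ h' => congrArg₂ (· ≫ ·) h h') a b

@[simp] lemma ev_comp {X Y : C} {f g h : X ⟶ Y} (a : GeneratedCell F hF f g)
    (b : GeneratedCell F hF g h) : (a.comp b).ev = a.ev ≫ b.ev := by
  induction a using Quotient.inductionOn with | _ s =>
  induction b using Quotient.inductionOn with | _ t =>
  rfl

/-- Whiskering with an arrow into the source. -/
noncomputable def whiskerLeft {X Y Z : C} (l : X ⟶ Y) {f g : Y ⟶ Z} (a : GeneratedCell F hF f g) :
    GeneratedCell F hF (l ≫ f) (l ≫ g) :=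
  Quotient.map (.whiskerLeft l)
    (fun _ _ h => congrArg (fun z => (F.mapComp l f).hom ≫ F.map l ◁ z ≫ (F.mapComp l g).inv) h) a

@[simp] lemma ev_whiskerLeft {X Y Z : C} (l : X ⟶ Y) {f g : Y ⟶ Z} (a : GeneratedCell F hF f g) :
    (a.whiskerLeft l).ev = (F.mapComp l f).hom ≫ F.map l ◁ a.ev ≫ (F.mapComp l g).inv := by
  induction a using Quotient.inductionOn with | _ s =>
  rfl

/-- Whiskering with an arrow out of the target. -/
noncomputable def whiskerRight {X Y Z : C} {f g : X ⟶ Y} (a : GeneratedCell F hF f g) (r : Y ⟶ Z) :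
    GeneratedCell F hF (f ≫ r) (g ≫ r) :=
  Quotient.map (fun t => .whiskerRight t r)
    (fun _ _ h => congrArg (fun z => (F.mapComp f r).hom ≫ z ▷ F.map r ≫ (F.mapComp g r).inv) h) a

@[simp] lemma ev_whiskerRight {X Y Z : C} {f g : X ⟶ Y} (a : GeneratedCell F hF f g)
    (r : Y ⟶ Z) :
    (a.whiskerRight r).ev = (F.mapComp f r).hom ≫ a.ev ▷ F.map r ≫ (F.mapComp g r).inv := by
  induction a using Quotient.inductionOn with | _ s =>
  rfl

/-- The formal cancellation constructor supplies the preimage. This closure property makes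
whiskering with `W` full on the generated 2-cells. -/
lemma exists_cancelRight {X Y Z : C} {f g : X ⟶ Y} (s : Y ⟶ Z) (hs : W s)
    (a : GeneratedCell F hF (f ≫ s) (g ≫ s)) :
    ∃ b : GeneratedCell F hF f g, b.whiskerRight s = a := by
  induction a using Quotient.inductionOn with | _ t =>
  refine ⟨mk (.cancelRight s hs t), ext ?_⟩
  rw [ev_whiskerRight]
  change (F.mapComp f s).hom ≫ (FormalCell.cancelRight s hs t).eval F hF ▷ F.map s ≫
    (F.mapComp g s).inv = t.eval F hF
  simp [FormalCell.eval_cancelRight]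

lemma exists_cancelLeft {X Y Z : C} {f g : Y ⟶ Z} (s : X ⟶ Y) (hs : W s)
    (a : GeneratedCell F hF (s ≫ f) (s ≫ g)) :
    ∃ b : GeneratedCell F hF f g, b.whiskerLeft s = a := by
  induction a using Quotient.inductionOn with | _ t =>
  refine ⟨mk (.cancelLeft s hs t), ext ?_⟩
  rw [ev_whiskerLeft]
  change (F.mapComp s f).hom ≫ F.map s ◁ (FormalCell.cancelLeft s hs t).eval F hF ≫
    (F.mapComp s g).inv = t.eval F hF
  simp [FormalCell.eval_cancelLeft]


/-- The identity. -/
noncomputable def id {X Y : C} (f : X ⟶ Y) : GeneratedCell F hF f f := ofCell (𝟙 f)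

@[simp] lemma ev_id {X Y : C} (f : X ⟶ Y) : (id f : GeneratedCell F hF f f).ev = 𝟙 (F.map f) :=
  F.map₂_id f

lemma ofCell_comp {X Y : C} {f g k : X ⟶ Y} (μ : f ⟶ g) (ν : g ⟶ k) :
    (ofCell μ).comp (ofCell ν) = (ofCell (μ ≫ ν) : GeneratedCell F hF f k) :=
  ext (by simp)

lemma whiskerLeft_ofCell {X Y Z : C} (l : X ⟶ Y) {f g : Y ⟶ Z} (μ : f ⟶ g) :
    (ofCell μ).whiskerLeft l = (ofCell (l ◁ μ) : GeneratedCell F hF _ _) :=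
  ext (by simp)

lemma whiskerRight_ofCell {X Y Z : C} {f g : X ⟶ Y} (μ : f ⟶ g) (r : Y ⟶ Z) :
    (ofCell μ).whiskerRight r = (ofCell (μ ▷ r) : GeneratedCell F hF _ _) :=
  ext (by simp)

lemma id_comp {X Y : C} {f g : X ⟶ Y} (a : GeneratedCell F hF f g) : (id f).comp a = a :=
  ext (by simp)

lemma comp_id {X Y : C} {f g : X ⟶ Y} (a : GeneratedCell F hF f g) : a.comp (id g) = a :=
  ext (by simp)

lemma comp_assoc {X Y : C} {f g h k : X ⟶ Y} (a : GeneratedCell F hF f g)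
    (b : GeneratedCell F hF g h) (c : GeneratedCell F hF h k) :
    (a.comp b).comp c = a.comp (b.comp c) :=
  ext (by simp)

lemma whiskerLeft_id {X Y Z : C} (f : X ⟶ Y) (g : Y ⟶ Z) :
    (id g : GeneratedCell F hF g g).whiskerLeft f = id (f ≫ g) :=
  ext (by simp)

lemma id_whiskerRight {X Y Z : C} (f : X ⟶ Y) (g : Y ⟶ Z) :
    (id f : GeneratedCell F hF f f).whiskerRight g = id (f ≫ g) :=
  ext (by simp)

lemma whiskerLeft_comp {X Y Z : C} (f : X ⟶ Y) {g h i : Y ⟶ Z} (a : GeneratedCell F hF g h)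
    (b : GeneratedCell F hF h i) :
    (a.comp b).whiskerLeft f = (a.whiskerLeft f).comp (b.whiskerLeft f) :=
  ext (by simp)

lemma comp_whiskerRight {X Y Z : C} {g h i : X ⟶ Y} (a : GeneratedCell F hF g h)
    (b : GeneratedCell F hF h i) (r : Y ⟶ Z) :
    (a.comp b).whiskerRight r = (a.whiskerRight r).comp (b.whiskerRight r) :=
  ext (by simp)

lemma id_whiskerLeft {X Y : C} {f g : X ⟶ Y} (a : GeneratedCell F hF f g) :
    a.whiskerLeft (𝟙 X) = (ofCell (λ_ f).hom).comp (a.comp (ofCell (λ_ g).inv)) :=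
  ext (by
    have h := Bicategory.whisker_exchange (F.mapId X).hom a.ev
    simp only [ev_whiskerLeft, ev_comp, ev_ofCell, Pseudofunctor.map₂_left_unitor,
      map₂_leftUnitor_inv', Category.assoc]
    rw [Bicategory.id_whiskerLeft] at h
    simp [← reassoc_of% h])

lemma whiskerRight_id {X Y : C} {f g : X ⟶ Y} (a : GeneratedCell F hF f g) :
    a.whiskerRight (𝟙 Y) = (ofCell (ρ_ f).hom).comp (a.comp (ofCell (ρ_ g).inv)) :=
  ext (by
    have h := Bicategory.whisker_exchange a.ev (F.mapId Y).hom
    simp only [ev_whiskerRight, ev_comp, ev_ofCell, Pseudofunctor.map₂_right_unitor,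
      map₂_rightUnitor_inv', Category.assoc]
    rw [Bicategory.whiskerRight_id] at h
    simp [reassoc_of% h])

lemma comp_whiskerLeft {X Y Z V : C} (f : X ⟶ Y) (g : Y ⟶ Z) {h k : Z ⟶ V}
    (a : GeneratedCell F hF h k) :
    a.whiskerLeft (f ≫ g) = (ofCell (α_ f g h).hom).comp
      (((a.whiskerLeft g).whiskerLeft f).comp (ofCell (α_ f g k).inv)) :=
  ext (by
    have h := Bicategory.whisker_exchange (F.mapComp f g).hom a.ev
    rw [Bicategory.comp_whiskerLeft] at h
    simp [map₂_associator_inv', ← reassoc_of% h])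

lemma whiskerRight_comp {X Y Z V : C} {f k : X ⟶ Y} (a : GeneratedCell F hF f k) (g : Y ⟶ Z)
    (h : Z ⟶ V) :
    a.whiskerRight (g ≫ h) = (ofCell (α_ f g h).inv).comp
      (((a.whiskerRight g).whiskerRight h).comp (ofCell (α_ k g h).hom)) :=
  ext (by
    have h := Bicategory.whisker_exchange a.ev (F.mapComp g h).hom
    rw [Bicategory.whiskerRight_comp] at h
    simp [map₂_associator_inv', reassoc_of% h])

lemma whisker_assoc {X Y Z V : C} (f : X ⟶ Y) {g k : Y ⟶ Z} (a : GeneratedCell F hF g k)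
    (h : Z ⟶ V) :
    (a.whiskerLeft f).whiskerRight h = (ofCell (α_ f g h).hom).comp
      (((a.whiskerRight h).whiskerLeft f).comp (ofCell (α_ f k h).inv)) :=
  ext (by simp [map₂_associator_inv'])

lemma whisker_exchange {X Y Z : C} {f g : X ⟶ Y} {h i : Y ⟶ Z} (a : GeneratedCell F hF f g)
    (b : GeneratedCell F hF h i) :
    (b.whiskerLeft f).comp (a.whiskerRight i) = (a.whiskerRight h).comp (b.whiskerLeft g) :=
  ext (by simp [Bicategory.whisker_exchange_assoc])

lemma pentagon {V X Y Z T : C} (f : V ⟶ X) (g : X ⟶ Y) (h : Y ⟶ Z) (k : Z ⟶ T) :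
    ((ofCell (α_ f g h).hom).whiskerRight k).comp
      ((ofCell (α_ f (g ≫ h) k).hom).comp ((ofCell (α_ g h k).hom).whiskerLeft f)) =
    (ofCell (α_ (f ≫ g) h k).hom).comp
      (ofCell (α_ f g (h ≫ k)).hom : GeneratedCell F hF _ _) := by
  rw [whiskerRight_ofCell, whiskerLeft_ofCell, ofCell_comp, ofCell_comp, ofCell_comp,
    Bicategory.pentagon]

lemma triangle {X Y Z : C} (f : X ⟶ Y) (g : Y ⟶ Z) :
    (ofCell (α_ f (𝟙 Y) g).hom).comp ((ofCell (λ_ g).hom).whiskerLeft f) =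
    (ofCell (ρ_ f).hom : GeneratedCell F hF _ _).whiskerRight g := by
  rw [whiskerRight_ofCell, whiskerLeft_ofCell, ofCell_comp, Bicategory.triangle]

end GeneratedCell

/-- The objects of the bicategory with the objects and the arrows of `C`, and with the 2-cells of
the target of `F` generated by the image of `F`. -/
structure Generated {D : Type u₁} [Bicategory.{w₁, v₁} D] (F : C ⥤ᵖ D)
    (hF : ∀ ⦃X Y : C⦄ (f : X ⟶ Y), W f → IsQuasiequiv (F.map f)) : Type u where
  obj : C

namespace Generated

variable {F hF}

/-- The arrows of `Generated F hF`. -/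
structure Hom (X Y : Generated F hF) : Type v where
  arrow : X.obj ⟶ Y.obj

instance : CategoryStruct (Generated F hF) where
  Hom X Y := Hom X Y
  id X := ⟨𝟙 X.obj⟩
  comp f g := ⟨f.arrow ≫ g.arrow⟩

/-- The 2-cells of `Generated F hF`. -/
@[ext]
structure Hom₂ {X Y : Generated F hF} (f g : X ⟶ Y) : Type (max u v w) where
  cls : GeneratedCell F hF f.arrow g.arrow

noncomputable instance homCategory (X Y : Generated F hF) : Category (X ⟶ Y) where
  Hom f g := Hom₂ f g
  id f := ⟨.id f.arrow⟩
  comp a b := ⟨a.cls.comp b.cls⟩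
  id_comp a := Hom₂.ext (GeneratedCell.id_comp a.cls)
  comp_id a := Hom₂.ext (GeneratedCell.comp_id a.cls)
  assoc a b c := Hom₂.ext (GeneratedCell.comp_assoc a.cls b.cls c.cls)

/-- The invertible 2-cell given by an invertible 2-cell of `C`. -/
noncomputable def isoOfCell {X Y : Generated F hF} {f g : X ⟶ Y} (μ : f.arrow ≅ g.arrow) :
    f ≅ g where
  hom := Hom₂.mk (.ofCell μ.hom)
  inv := Hom₂.mk (.ofCell μ.inv)
  hom_inv_id := Hom₂.ext ((GeneratedCell.ofCell_comp μ.hom μ.inv).trans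
    (by rw [μ.hom_inv_id]; rfl))
  inv_hom_id := Hom₂.ext ((GeneratedCell.ofCell_comp μ.inv μ.hom).trans
    (by rw [μ.inv_hom_id]; rfl))

noncomputable instance bicategory : Bicategory.{max u v w, v} (Generated F hF) where
  homCategory := homCategory
  whiskerLeft l _ _ a := Hom₂.mk ((Hom₂.cls a).whiskerLeft l.arrow)
  whiskerRight a r := Hom₂.mk ((Hom₂.cls a).whiskerRight r.arrow)
  associator f g h := isoOfCell (α_ f.arrow g.arrow h.arrow)
  leftUnitor f := isoOfCell (λ_ f.arrow)
  rightUnitor f := isoOfCell (ρ_ f.arrow)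
  whiskerLeft_id f g := Hom₂.ext (GeneratedCell.whiskerLeft_id f.arrow g.arrow)
  whiskerLeft_comp f _ _ _ a b := Hom₂.ext (GeneratedCell.whiskerLeft_comp f.arrow a.cls b.cls)
  id_whiskerLeft a := Hom₂.ext (GeneratedCell.id_whiskerLeft a.cls)
  comp_whiskerLeft f g _ _ a :=
    Hom₂.ext (GeneratedCell.comp_whiskerLeft f.arrow g.arrow a.cls)
  id_whiskerRight f g := Hom₂.ext (GeneratedCell.id_whiskerRight f.arrow g.arrow)
  comp_whiskerRight a b r :=
    Hom₂.ext (GeneratedCell.comp_whiskerRight a.cls b.cls r.arrow)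
  whiskerRight_id a := Hom₂.ext (GeneratedCell.whiskerRight_id a.cls)
  whiskerRight_comp a g h :=
    Hom₂.ext (GeneratedCell.whiskerRight_comp a.cls g.arrow h.arrow)
  whisker_assoc f _ _ a h := Hom₂.ext (GeneratedCell.whisker_assoc f.arrow a.cls h.arrow)
  whisker_exchange a b := Hom₂.ext (GeneratedCell.whisker_exchange a.cls b.cls)
  pentagon f g h k := Hom₂.ext (GeneratedCell.pentagon f.arrow g.arrow h.arrow k.arrow)
  triangle f g := Hom₂.ext (GeneratedCell.triangle f.arrow g.arrow)

/-- The underlying 2-cell of the target of `F`. -/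
noncomputable def ev {X Y : Generated F hF} {f g : X ⟶ Y} (a : f ⟶ g) :
    F.map f.arrow ⟶ F.map g.arrow :=
  GeneratedCell.ev (Hom₂.cls a)

lemma ext_ev {X Y : Generated F hF} {f g : X ⟶ Y} {a b : f ⟶ g} (h : ev a = ev b) : a = b :=
  Hom₂.ext (GeneratedCell.ext h)

lemma ev_comp {X Y : Generated F hF} {f g h : X ⟶ Y} (a : f ⟶ g) (b : g ⟶ h) :
    ev (a ≫ b) = ev a ≫ ev b :=
  GeneratedCell.ev_comp _ _

lemma ev_whiskerRight {X Y Z : Generated F hF} {f g : X ⟶ Y} (a : f ⟶ g) (r : Y ⟶ Z) :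
    ev (a ▷ r) = (F.mapComp f.arrow r.arrow).hom ≫ ev a ▷ F.map r.arrow ≫
      (F.mapComp g.arrow r.arrow).inv :=
  GeneratedCell.ev_whiskerRight _ _

lemma ev_whiskerLeft {X Y Z : Generated F hF} (l : X ⟶ Y) {f g : Y ⟶ Z} (a : f ⟶ g) :
    ev (l ◁ a) = (F.mapComp l.arrow f.arrow).hom ≫ F.map l.arrow ◁ ev a ≫
      (F.mapComp l.arrow g.arrow).inv :=
  GeneratedCell.ev_whiskerLeft _ _

lemma ev_comp_whiskerRight_comp {X Y Z : Generated F hF} {f g : X ⟶ Y} {h k : X ⟶ Z} {r : Y ⟶ Z}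
    (a : h ⟶ f ≫ r) (b : f ⟶ g) (c : g ≫ r ⟶ k) :
    ev (a ≫ b ▷ r ≫ c) = ev a ≫ ((F.mapComp f.arrow r.arrow).hom ≫ ev b ▷ F.map r.arrow ≫
      (F.mapComp g.arrow r.arrow).inv) ≫ ev c := by
  rw [ev_comp, ev_comp, ev_whiskerRight]

/-- Faithfulness is inherited from the target of `F`, because `ev` is injective; fullness is the
closure of generated cells under cancellation. -/
lemma isQuasiequiv {X Y : Generated F hF} (s : X ⟶ Y) (hs : W s.arrow) : IsQuasiequiv s := by
  have h := (hF s.arrow hs).isCancellable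
  refine ⟨fun Z g k => ⟨fun a b e => ?_, fun c => ?_⟩, fun Z g k => ⟨fun a b e => ?_, fun c => ?_⟩⟩
  · have e' : ev (a ▷ s) = ev (b ▷ s) := congrArg ev e
    rw [ev_whiskerRight, ev_whiskerRight] at e'
    exact ext_ev (h.right ((cancel_mono _).1 ((cancel_epi _).1 e')))
  · obtain ⟨b, hb⟩ := GeneratedCell.exists_cancelRight (f := g.arrow) (g := k.arrow) s.arrow hs
      (Hom₂.cls c)
    exact ⟨Hom₂.mk b, Hom₂.ext hb⟩
  · have e' : ev (s ◁ a) = ev (s ◁ b) := congrArg ev e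
    rw [ev_whiskerLeft, ev_whiskerLeft] at e'
    exact ext_ev (h.left ((cancel_mono _).1 ((cancel_epi _).1 e')))
  · obtain ⟨b, hb⟩ := GeneratedCell.exists_cancelLeft (f := g.arrow) (g := k.arrow) s.arrow hs
      (Hom₂.cls c)
    exact ⟨Hom₂.mk b, Hom₂.ext hb⟩

variable (F hF) in
/-- An arrow of `C`, as an arrow of `Generated F hF`. -/
abbrev ofArrow {X Y : C} (f : X ⟶ Y) : (⟨X⟩ : Generated F hF) ⟶ ⟨Y⟩ :=
  Hom.mk f

variable (F hF)

/-- A 2-cell of `C`, as a 2-cell of `Generated F hF`. -/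
noncomputable abbrev ofCell {X Y : C} {f g : X ⟶ Y} (μ : f ⟶ g) : ofArrow F hF f ⟶ ofArrow F hF g :=
  Hom₂.mk (.ofCell μ)

lemma whiskerLeft_ofCell {X Y Z : C} (f : X ⟶ Y) {g h : Y ⟶ Z} (μ : g ⟶ h) :
    ofArrow F hF f ◁ ofCell F hF μ = ofCell F hF (f ◁ μ) :=
  Hom₂.ext (GeneratedCell.whiskerLeft_ofCell f μ)

lemma ofCell_whiskerRight {X Y Z : C} {f g : X ⟶ Y} (μ : f ⟶ g) (h : Y ⟶ Z) :
    ofCell F hF μ ▷ ofArrow F hF h = ofCell F hF (μ ▷ h) :=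
  Hom₂.ext (GeneratedCell.whiskerRight_ofCell μ h)

/-- The 2-functor from `C` to the bicategory generated by the image of `F`. -/
noncomputable def functor : StrictPseudofunctor C (Generated F hF) where
  obj X := ⟨X⟩
  map f := ⟨f⟩
  map₂ μ := ofCell F hF μ
  map₂_id f := rfl
  map₂_comp μ ν := Hom₂.ext (GeneratedCell.ofCell_comp μ ν).symm
  mapId _ := Iso.refl _
  mapComp _ _ := Iso.refl _
  map₂_whisker_left f _ _ μ := by
    rw [← whiskerLeft_ofCell]
    exact (id_comp_comp_id _).symm
  map₂_whisker_right μ h := by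
    rw [← ofCell_whiskerRight]
    exact (id_comp_comp_id _).symm
  map₂_associator f g h := assoc_aux (ofArrow F hF f) (ofArrow F hF g) (ofArrow F hF h)
  map₂_left_unitor f := leftUnitor_aux (ofArrow F hF f)
  map₂_right_unitor f := rightUnitor_aux (ofArrow F hF f)
  map_id _ := rfl
  map_comp _ _ := rfl
  mapId_eq_eqToIso _ := rfl
  mapComp_eq_eqToIso _ _ := rfl

/-- The test functor given by the 2-cells generated by the image of `F`. -/
noncomputable def testFunctor : TestFunctor W where
  D := Generated F hF
  F := functor F hF
  inverts _ _ s hs := isQuasiequiv (ofArrow F hF s) hs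

/-- `ev`, for 2-cells between images of arrows of `C`. -/
noncomputable abbrev evArrow {X Y : C} {f g : X ⟶ Y} (a : ofArrow F hF f ⟶ ofArrow F hF g) :
    F.map f ⟶ F.map g :=
  ev a

/-- The 2-cell attached to a cylinder is characterized by its whiskering with `s`, and `ev` carries
the characterization in the generated bicategory to the one in `D`. -/
lemma ev_cylinder_hat {X : C} (K : Cylinder W X) :
    evArrow F hF (f := K.d₀) (g := K.d₁)
      (K.hat (testFunctor F hF).psf (testFunctor F hF).inverts) = K.hat F hF := by
  refine (K.hat_unique F hF _ ?_).symm
  have h := K.hat_whiskerRight (testFunctor F hF).psf (testFunctor F hF).inverts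
  have h' := congrArg (fun z => evArrow F hF (f := K.d₀ ≫ K.s) (g := K.d₁ ≫ K.s) z)
    (h.trans (id_comp_comp_id _))
  have h'' := (ev_whiskerRight _ (ofArrow F hF K.s)).symm.trans h'
  rw [← cancel_epi (F.mapComp K.d₀ K.s).hom, ← cancel_mono (F.mapComp K.d₁ K.s).inv]
  simp only [Category.assoc, Iso.hom_inv_id_assoc, Iso.hom_inv_id, Category.comp_id]
  exact h''

lemma ev_homotopy_hat {X Y : C} {f g : X ⟶ Y} (H : Homotopy W f g) :
    evArrow F hF (f := f) (g := g)
      (H.hat (testFunctor F hF).psf (testFunctor F hF).inverts) = H.hat F hF := by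
  have h : H.hat (testFunctor F hF).psf (testFunctor F hF).inverts =
      (testFunctor F hF).psf.map₂ H.start ≫
        H.C.hat (testFunctor F hF).psf (testFunctor F hF).inverts ▷ (testFunctor F hF).psf.map H.h ≫
          (testFunctor F hF).psf.map₂ H.finish :=
    congrArg ((testFunctor F hF).psf.map₂ H.start ≫ ·) ((Category.id_comp _).trans
      (congrArg (_ ≫ ·) (Category.id_comp _)))
  have h₁ : evArrow F hF (f := f) (g := g)
      (H.hat (testFunctor F hF).psf (testFunctor F hF).inverts) =
      F.map₂ H.start ≫ ((F.mapComp H.C.d₀ H.h).hom ≫ evArrow F hF (f := H.C.d₀) (g := H.C.d₁)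
        (H.C.hat (testFunctor F hF).psf (testFunctor F hF).inverts) ▷ F.map H.h ≫
          (F.mapComp H.C.d₁ H.h).inv) ≫ F.map₂ H.finish :=
    (congrArg (evArrow F hF (f := f) (g := g)) h).trans (ev_comp_whiskerRight_comp
      (f := ofArrow F hF H.C.d₀) (g := ofArrow F hF H.C.d₁) (h := ofArrow F hF f)
      (k := ofArrow F hF g) (r := ofArrow F hF H.h) (ofCell F hF H.start)
      (H.C.hat (testFunctor F hF).psf (testFunctor F hF).inverts) (ofCell F hF H.finish))
  rw [h₁, ev_cylinder_hat]
  simp only [Homotopy.hat, Category.assoc]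

lemma ev_hat {X Y : C} {f g : X ⟶ Y} (S : HomotopySeq W f g) :
    evArrow F hF (f := f) (g := g)
      (S.hat (testFunctor F hF).psf (testFunctor F hF).inverts) = S.hat F hF := by
  induction S with
  | nil f => exact F.map₂_id f
  | cons H S ih => exact (ev_comp _ _).trans (congrArg₂ (· ≫ ·) (ev_homotopy_hat F hF H) ih)

end Generated

/-- Sequences in the same class have the same value under any pseudofunctor which maps `W` to
quasiequivalences. -/
theorem HomotopySeq.hat_eq_hat {X Y : C} {f g : X ⟶ Y} {S S' : HomotopySeq W f g}
    (h : (HomotopySeq.setoid W f g).r S S') : S.hat F hF = S'.hat F hF := by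
  -- Both values in `D` are images under `ev` of the values of one test functor, and equivalent
  -- sequences have the same value there.
  rw [← Generated.ev_hat F hF S, ← Generated.ev_hat F hF S']
  exact congrArg _ (h (Generated.testFunctor F hF))

end Generated

/-! ### Naturality under whiskering, and interchange of pseudonatural transformations. -/

section Naturality

variable {B : Type u} [Bicategory.{w, v} B] {D : Type u₁} [Bicategory.{w₁, v₁} D] {F G : B ⥤ᵖ D}

section

variable {X Y Z : B} {f g : X ⟶ Y} (r : Y ⟶ Z) (a : f ⟶ g) {θX : F.obj X ⟶ G.obj X}
  {θY : F.obj Y ⟶ G.obj Y} {θZ : F.obj Z ⟶ G.obj Z}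
  {nf : F.map f ≫ θY ≅ θX ≫ G.map f} {ng : F.map g ≫ θY ≅ θX ≫ G.map g}
  {nr : F.map r ≫ θZ ≅ θY ≫ G.map r} {nfr : F.map (f ≫ r) ≫ θZ ≅ θX ≫ G.map (f ≫ r)}
  {ngr : F.map (g ≫ r) ≫ θZ ≅ θX ≫ G.map (g ≫ r)}

/-- Naturality with respect to `a ▷ r` is naturality with respect to `a`, whiskered with `G.map r`.
From right to left this gives stability under right whiskering; from left to right it allows the
cancellation of `r` when `G.map r` can be cancelled. -/
lemma natural_whiskerRight_iff
    (hf : nfr.hom ≫ θX ◁ (G.mapComp f r).hom = (F.mapComp f r).hom ▷ θZ ≫ (α_ _ _ _).hom ≫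
      F.map f ◁ nr.hom ≫ (α_ _ _ _).inv ≫ nf.hom ▷ G.map r ≫ (α_ _ _ _).hom)
    (hg : ngr.hom ≫ θX ◁ (G.mapComp g r).hom = (F.mapComp g r).hom ▷ θZ ≫ (α_ _ _ _).hom ≫
      F.map g ◁ nr.hom ≫ (α_ _ _ _).inv ≫ ng.hom ▷ G.map r ≫ (α_ _ _ _).hom) :
    F.map₂ (a ▷ r) ▷ θZ ≫ ngr.hom = nfr.hom ≫ θX ◁ G.map₂ (a ▷ r) ↔
      (F.map₂ a ▷ θY ≫ ng.hom) ▷ G.map r = (nf.hom ≫ θX ◁ G.map₂ a) ▷ G.map r := by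
  -- Each side is written as the same invertible 2-cell, followed by the corresponding side for `a`
  -- whiskered with `G.map r`, followed by an associator.
  have h1 : (F.map₂ (a ▷ r) ▷ θZ ≫ ngr.hom) ≫ θX ◁ (G.mapComp g r).hom =
      ((F.mapComp f r).hom ▷ θZ ≫ (α_ _ _ _).hom ≫ F.map f ◁ nr.hom ≫ (α_ _ _ _).inv) ≫
        (F.map₂ a ▷ θY ≫ ng.hom) ▷ G.map r ≫ (α_ _ _ _).hom := by
    rw [Category.assoc, hg, F.map₂_whisker_right]
    simp only [comp_whiskerRight, Category.assoc, inv_hom_whiskerRight_assoc]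
    calc _ = (F.mapComp f r).hom ▷ θZ ⊗≫ (F.map₂ a ▷ (F.map r ≫ θZ) ≫ F.map g ◁ nr.hom) ⊗≫
          ng.hom ▷ G.map r ⊗≫ 𝟙 _ := by bicategory
      _ = _ := by rw [← whisker_exchange]; bicategory
  have h2 : (nfr.hom ≫ θX ◁ G.map₂ (a ▷ r)) ≫ θX ◁ (G.mapComp g r).hom =
      ((F.mapComp f r).hom ▷ θZ ≫ (α_ _ _ _).hom ≫ F.map f ◁ nr.hom ≫ (α_ _ _ _).inv) ≫
        (nf.hom ≫ θX ◁ G.map₂ a) ▷ G.map r ≫ (α_ _ _ _).hom := by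
    rw [Category.assoc, ← Bicategory.whiskerLeft_comp, G.map₂_whisker_right]
    simp only [Category.assoc, Iso.inv_hom_id, Category.comp_id, Bicategory.whiskerLeft_comp]
    rw [reassoc_of% hf]
    simp
  rw [← cancel_mono (θX ◁ (G.mapComp g r).hom), h1, h2]
  constructor
  · intro h
    exact (cancel_mono _).1 ((cancel_epi _).1 h)
  · intro h
    rw [h]

end

/-- Postcomposition of a pseudonatural transformation with a pseudofunctor. -/
def postcompTrans {C : Type*} [Bicategory C] {K L : C ⥤ᵖ B} (θ : K ⟶ L) (F : B ⥤ᵖ D) :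
    K.comp F ⟶ L.comp F where
  app X := F.map (θ.app X)
  naturality f := (F.mapComp _ _).symm ≪≫ F.map₂Iso (θ.naturality f) ≪≫ F.mapComp _ _
  naturality_naturality {X Y f g} η := by
    have h : F.map₂ (K.map₂ η) ▷ F.map (θ.app Y) ≫ (F.mapComp _ _).inv ≫
        F.map₂ (θ.naturality g).hom ≫ (F.mapComp _ _).hom = ((F.mapComp _ _).inv ≫
        F.map₂ (θ.naturality f).hom ≫ (F.mapComp _ _).hom) ≫ F.map (θ.app X) ◁ F.map₂ (L.map₂ η) := by
      have h1 := congrArg F.map₂ (θ.naturality_naturality η)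
      simp only [F.map₂_comp, F.map₂_whisker_left, F.map₂_whisker_right] at h1
      rw [← cancel_epi (F.mapComp _ _).hom, ← cancel_mono (F.mapComp _ _).inv]
      simpa using h1
    exact h
  naturality_id X := by
    have h : ((F.mapComp _ _).inv ≫ F.map₂ (θ.naturality (𝟙 X)).hom ≫ (F.mapComp _ _).hom) ≫
        F.map (θ.app X) ◁ (F.map₂ (L.mapId X).hom ≫ (F.mapId _).hom) =
        (F.map₂ (K.mapId X).hom ≫ (F.mapId _).hom) ▷ F.map (θ.app X) ≫ (λ_ _).hom ≫
        (ρ_ _).inv := by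
      have h1 := congrArg F.map₂ (θ.naturality_id X)
      simp only [F.map₂_comp, F.map₂_whisker_left, F.map₂_whisker_right, F.map₂_left_unitor,
        map₂_rightUnitor_inv', Category.assoc] at h1
      rw [← cancel_epi (F.mapComp _ _).hom, ← cancel_mono (F.map (θ.app X) ◁ (F.mapId _).inv),
        ← cancel_mono (F.mapComp _ _).inv]
      simpa using h1
    exact h
  naturality_comp {X Y Z} f g := by
    have h : ((F.mapComp _ _).inv ≫ F.map₂ (θ.naturality (f ≫ g)).hom ≫ (F.mapComp _ _).hom) ≫
        F.map (θ.app X) ◁ (F.map₂ (L.mapComp f g).hom ≫ (F.mapComp _ _).hom) =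
        (F.map₂ (K.mapComp f g).hom ≫ (F.mapComp _ _).hom) ▷ F.map (θ.app Z) ≫ (α_ _ _ _).hom ≫
        F.map (K.map f) ◁ ((F.mapComp _ _).inv ≫ F.map₂ (θ.naturality g).hom ≫
          (F.mapComp _ _).hom) ≫ (α_ _ _ _).inv ≫ ((F.mapComp _ _).inv ≫
          F.map₂ (θ.naturality f).hom ≫ (F.mapComp _ _).hom) ▷ F.map (L.map g) ≫
            (α_ _ _ _).hom := by
      have h1 := congrArg F.map₂ (θ.naturality_comp f g)
      simp only [F.map₂_comp, F.map₂_whisker_left, F.map₂_whisker_right, F.map₂_associator,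
        map₂_associator_inv', Category.assoc] at h1
      rw [← cancel_epi (F.mapComp _ _).hom,
        ← cancel_mono (F.map (θ.app X) ◁ (F.mapComp _ _).inv),
        ← cancel_mono (F.mapComp _ _).inv]
      simpa using h1
    exact h

/-- The interchange of pseudonatural transformations. -/
def interchangeIso {C : Type*} [Bicategory C] {K L : C ⥤ᵖ B} (θ : K ⟶ L) (η : F ⟶ G) :
    postcompTrans θ F ≫ precompTrans L η ≅ precompTrans K η ≫ postcompTrans θ G :=
  Pseudofunctor.StrongTrans.isoMk (fun X => η.naturality (θ.app X)) (fun {X Y} f => by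
    have h : F.map (K.map f) ◁ (η.naturality (θ.app Y)).hom ≫
      ((α_ _ _ _).inv ≫ (η.naturality (K.map f)).hom ▷ G.map (θ.app Y) ≫ (α_ _ _ _).hom ≫
        η.app (K.obj X) ◁ ((G.mapComp _ _).inv ≫ G.map₂ (θ.naturality f).hom ≫
          (G.mapComp _ _).hom) ≫ (α_ _ _ _).inv) =
      ((α_ _ _ _).inv ≫ ((F.mapComp _ _).inv ≫ F.map₂ (θ.naturality f).hom ≫
          (F.mapComp _ _).hom) ▷ η.app (L.obj Y) ≫ (α_ _ _ _).hom ≫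
        F.map (θ.app X) ◁ (η.naturality (L.map f)).hom ≫ (α_ _ _ _).inv) ≫
        (η.naturality (θ.app X)).hom ▷ G.map (L.map f) := by
      -- The naturality of `η` with respect to the 2-cell `θ.naturality f`, with its cells at the
      -- two composites expanded by `naturality_comp`, is the required identity.
      have h1 := η.naturality_naturality (θ.naturality f).hom
      have h2 := η.naturality_comp (K.map f) (θ.app Y)
      have h3 := η.naturality_comp (θ.app X) (L.map f)
      rw [← cancel_mono (α_ _ _ _).hom, ← cancel_epi (α_ _ _ _).hom,
        ← cancel_epi ((F.mapComp _ _).hom ▷ _)]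
      simp only [Category.assoc, Iso.inv_hom_id, Category.comp_id, Iso.hom_inv_id_assoc,
        comp_whiskerRight, hom_inv_whiskerRight_assoc]
      rw [← h3, reassoc_of% h1]
      have h2' := congrArg (· ≫ η.app (K.obj X) ◁ (G.mapComp (K.map f) (θ.app Y)).inv) h2
      simp only [Category.assoc, whiskerLeft_hom_inv, Category.comp_id] at h2'
      rw [h2']
      simp only [Bicategory.whiskerLeft_comp, Category.assoc]
    exact h)

end Naturality

variable {C : Type u} [Bicategory.{w, v} C]

/-! ### Values on classes, and generators of the 2-cells of `Ho(C, W)`. -/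

namespace HomotopyClass

variable {W : ArrowClass C} {D : Type u₁} [Bicategory.{w₁, v₁} D] (F : C ⥤ᵖ D)
  (hF : ∀ ⦃X Y : C⦄ (f : X ⟶ Y), W f → IsQuasiequiv (F.map f))

/-- The value of a pseudofunctor which maps `W` to quasiequivalences on a class. -/
noncomputable def hat {X Y : C} {f g : X ⟶ Y} (a : HomotopyClass W f g) : F.map f ⟶ F.map g :=
  Quotient.lift (fun S : HomotopySeq W f g => S.hat F hF)
    (fun (_ _ : HomotopySeq W f g) (h : (HomotopySeq.setoid W f g).r _ _) =>
      HomotopySeq.hat_eq_hat F hF h) a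

@[simp] lemma hat_comp {X Y : C} {f g k : X ⟶ Y} (a : HomotopyClass W f g)
    (b : HomotopyClass W g k) : (a.comp b).hat F hF = a.hat F hF ≫ b.hat F hF := by
  induction a using Quotient.inductionOn with | _ S =>
  induction b using Quotient.inductionOn with | _ S' =>
  exact HomotopySeq.hat_append _ _ S S'

@[simp] lemma hat_whiskerLeft {X' X Y : C} (l : X' ⟶ X) {f g : X ⟶ Y} (a : HomotopyClass W f g) :
    (a.whiskerLeft l).hat F hF =
      (F.mapComp l f).hom ≫ F.map l ◁ a.hat F hF ≫ (F.mapComp l g).inv := by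
  induction a using Quotient.inductionOn with | _ S =>
  exact HomotopySeq.hat_precomp _ _ l S

@[simp] lemma hat_whiskerRight {X Y Y' : C} {f g : X ⟶ Y} (a : HomotopyClass W f g)
    (r : Y ⟶ Y') :
    (a.whiskerRight r).hat F hF =
      (F.mapComp f r).hom ≫ a.hat F hF ▷ F.map r ≫ (F.mapComp g r).inv := by
  induction a using Quotient.inductionOn with | _ S =>
  exact HomotopySeq.hat_postcomp _ _ r S

@[simp] lemma hat_ofCell (hW : ∀ X : C, W (𝟙 X)) {X Y : C} {f g : X ⟶ Y} (μ : f ⟶ g) :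
    (ofCell hW μ).hat F hF = F.map₂ μ :=
  (HomotopySeq.hat_single _ _ _).trans (Homotopy.hat_ofCell _ _ hW μ)

/-- The class of the 2-cell determined by a cylinder. -/
def ofCylinder {X : C} (K : Cylinder W X) : HomotopyClass W K.d₀ K.d₁ :=
  mk (.single { C := K, h := 𝟙 K.cyl, start := (ρ_ K.d₀).inv, finish := (ρ_ K.d₁).hom })

lemma ev_ofCylinder (T : TestFunctor W) {X : C} (K : Cylinder W X) :
    ev T (ofCylinder K) = K.hat T.psf T.inverts := by
  refine (HomotopySeq.hat_single _ _ _).trans ?_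
  have h := Bicategory.whisker_exchange (K.hat T.psf T.inverts) (T.psf.mapId K.cyl).hom
  rw [Bicategory.whiskerRight_id] at h
  simp only [Homotopy.hat, map₂_rightUnitor_inv', Pseudofunctor.map₂_right_unitor, Category.assoc,
    Iso.inv_hom_id_assoc]
  rw [← reassoc_of% h]
  simp

/-- Every test functor sends both sides to the same 2-cell, by the characterization of `hat`. So the
class of a cylinder arises from a 2-cell of `C` by cancelling an arrow of `W`. -/
lemma ofCylinder_whiskerRight (hW : ∀ X : C, W (𝟙 X)) {X : C} (K : Cylinder W X) :
    (ofCylinder K).whiskerRight K.s = ofCell hW K.tilde :=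
  ext fun T => by simp [ev_ofCylinder, K.hat_whiskerRight T.psf T.inverts]

/-- With `ofCylinder_whiskerRight`, this exhibits each one-term sequence as built from cells of `C`
by composition, right whiskering and right cancellation. -/
lemma mk_single (hW : ∀ X : C, W (𝟙 X)) {X Y : C} {f g : X ⟶ Y} (H : Homotopy W f g) :
    mk (.single H) = (ofCell hW H.start).comp (((ofCylinder H.C).whiskerRight H.h).comp
      (ofCell hW H.finish)) :=
  ext fun T => by
    refine (HomotopySeq.hat_single _ _ _).trans ?_
    simp [ev_ofCylinder, Homotopy.hat]

end HomotopyClass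

namespace ModelStructure

variable {M : ModelStructure C}

namespace HoSigma

/-- The 2-cells of `Ho(C, W)` are generated by those of `C` under vertical composition, whiskering
on the right, and cancellation on the right of arrows of `W`. -/
theorem induction_cell
    {P : ∀ {X Y : HoSigma M} {f g : X ⟶ Y}, (f ⟶ g) → Prop}
    (cell : ∀ {X Y : HoSigma M} {f g : X ⟶ Y} (μ : f.arrow ⟶ g.arrow), P (proj₂ μ : f ⟶ g))
    (comp : ∀ {X Y : HoSigma M} {f g h : X ⟶ Y} (a : f ⟶ g) (b : g ⟶ h), P a → P b → P (a ≫ b))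
    (whiskerRight : ∀ {X Y Z : HoSigma M} {f g : X ⟶ Y} (a : f ⟶ g) (r : Y ⟶ Z), P a → P (a ▷ r))
    (cancel : ∀ {X Y Z : HoSigma M} {f g : X ⟶ Y} (a : f ⟶ g) (s : Y ⟶ Z), M.W s.arrow →
      P (a ▷ s) → P a)
    {X Y : HoSigma M} {f g : X ⟶ Y} (a : f ⟶ g) : P a := by
  have key : ∀ {X Y : C} {f g : X ⟶ Y} (S : HomotopySeq M.W f g),
      P (Hom₂.mk (HomotopyClass.mk S) : (arr f : (⟨X⟩ : HoSigma M) ⟶ ⟨Y⟩) ⟶ arr g) := by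
    intro X Y f g S
    induction S with
    | nil f =>
      have e : (Hom₂.mk (HomotopyClass.mk (.nil f)) :
          (arr f : (⟨X⟩ : HoSigma M) ⟶ ⟨Y⟩) ⟶ arr f) = proj₂ (𝟙 f) := (cell_id f).symm
      rw [e]
      exact cell _
    | @cons f g k H S ih =>
      -- The only 2-cell in the class of `H` which need not come from `C` is the one of its
      -- cylinder, and whiskering it with `s` gives a cell of `C`.
      let κ : (arr H.C.d₀ : (⟨X⟩ : HoSigma M) ⟶ ⟨H.C.cyl⟩) ⟶ arr H.C.d₁ :=
        Hom₂.mk (HomotopyClass.ofCylinder H.C)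
      have hκ : P κ := by
        refine cancel κ (arr H.C.s) H.C.s_mem ?_
        have e : κ ▷ arr H.C.s = proj₂ H.C.tilde :=
          Hom₂.ext (HomotopyClass.ofCylinder_whiskerRight M.w_id H.C)
        rw [e]
        exact cell _
      have e : (Hom₂.mk (HomotopyClass.mk (.single H)) :
          (arr f : (⟨X⟩ : HoSigma M) ⟶ ⟨Y⟩) ⟶ arr g) =
          proj₂ H.start ≫ κ ▷ arr H.h ≫ proj₂ H.finish :=
        Hom₂.ext (HomotopyClass.mk_single M.w_id H)
      have h1 : P (Hom₂.mk (HomotopyClass.mk (.single H)) :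
          (arr f : (⟨X⟩ : HoSigma M) ⟶ ⟨Y⟩) ⟶ arr g) := by
        rw [e]
        exact comp _ _ (cell _) (comp _ _ (whiskerRight _ _ hκ) (cell _))
      exact comp _ _ h1 ih
  obtain ⟨c⟩ := a
  induction c using Quotient.inductionOn with | _ S =>
  exact key S

end HoSigma

/-! ### Extension of pseudofunctors and transformations from `C` to `Ho(C, W)`. -/

section Extension

variable {D : Type u₁} [Bicategory.{w₁, v₁} D] (F : C ⥤ᵖ D)
  (hF : ∀ ⦃X Y : C⦄ (f : X ⟶ Y), M.W f → IsQuasiequiv (F.map f))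

/-- The extension to `Ho(C, W)` of a pseudofunctor which maps `W` to quasiequivalences. -/
noncomputable def extend : HoSigma M ⥤ᵖ D where
  obj X := F.obj X.obj
  map f := F.map f.arrow
  map₂ a := (HoSigma.Hom₂.cls a).hat F hF
  map₂_id _ := rfl
  map₂_comp _ _ := HomotopyClass.hat_comp F hF _ _
  mapId X := F.mapId X.obj
  mapComp f g := F.mapComp f.arrow g.arrow
  map₂_whisker_left _ _ _ _ := HomotopyClass.hat_whiskerLeft F hF _ _
  map₂_whisker_right _ _ := HomotopyClass.hat_whiskerRight F hF _ _
  map₂_associator f g h := (HomotopyClass.hat_ofCell F hF M.w_id _).trans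
    (F.map₂_associator f.arrow g.arrow h.arrow)
  map₂_left_unitor f := (HomotopyClass.hat_ofCell F hF M.w_id _).trans
    (F.map₂_left_unitor f.arrow)
  map₂_right_unitor f := (HomotopyClass.hat_ofCell F hF M.w_id _).trans
    (F.map₂_right_unitor f.arrow)

lemma extend_map₂_proj₂ {X Y : HoSigma M} {f g : X ⟶ Y} (μ : f.arrow ⟶ g.arrow) :
    (extend F hF).map₂ (HoSigma.proj₂ μ : f ⟶ g) = F.map₂ μ :=
  HomotopyClass.hat_ofCell F hF M.w_id μ

/-- A family of arrows and of invertible 2-cells which is natural with respect to the 2-cells of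
`C` is natural with respect to those of `Ho(C, W)`. -/
theorem HoSigma.naturality_of_cell {F G : HoSigma M ⥤ᵖ D}
    (hG : ∀ ⦃X Y : HoSigma M⦄ (s : X ⟶ Y), M.W s.arrow → IsQuasiequiv (G.map s))
    (θ : ∀ X, F.obj X ⟶ G.obj X) (n : ∀ {X Y : HoSigma M} (f : X ⟶ Y),
      F.map f ≫ θ Y ≅ θ X ≫ G.map f)
    (cell : ∀ {X Y : HoSigma M} {f g : X ⟶ Y} (μ : f.arrow ⟶ g.arrow),
      F.map₂ (HoSigma.proj₂ μ : f ⟶ g) ▷ θ Y ≫ (n g).hom =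
        (n f).hom ≫ θ X ◁ G.map₂ (HoSigma.proj₂ μ : f ⟶ g))
    (comp : ∀ {X Y Z : HoSigma M} (f : X ⟶ Y) (g : Y ⟶ Z),
      (n (f ≫ g)).hom ≫ θ X ◁ (G.mapComp f g).hom = (F.mapComp f g).hom ▷ θ Z ≫ (α_ _ _ _).hom ≫
        F.map f ◁ (n g).hom ≫ (α_ _ _ _).inv ≫ (n f).hom ▷ G.map g ≫ (α_ _ _ _).hom)
    {X Y : HoSigma M} {f g : X ⟶ Y} (a : f ⟶ g) :
    F.map₂ a ▷ θ Y ≫ (n g).hom = (n f).hom ≫ θ X ◁ G.map₂ a := by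
  refine HoSigma.induction_cell (P := fun {X Y f g} a =>
    F.map₂ a ▷ θ Y ≫ (n g).hom = (n f).hom ≫ θ X ◁ G.map₂ a) cell ?_ ?_ ?_ a
  · intro X Y f g h a b ha hb
    rw [F.map₂_comp, G.map₂_comp, comp_whiskerRight, Category.assoc, hb, reassoc_of% ha,
      Bicategory.whiskerLeft_comp]
  · intro X Y Z f g a r h
    -- Stability under whiskering and, in the last case, cancellation are the two directions of the
    -- same equivalence.
    refine (natural_whiskerRight_iff r a (comp f r) (comp g r)).2 ?_
    rw [h]
  · intro X Y Z f g a s hs h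
    exact (hG s hs).isCancellable.right
      ((natural_whiskerRight_iff s a (comp f s) (comp g s)).1 h)

variable {F hF}

/-- The extension to `Ho(C, W)` of a pseudonatural transformation. -/
noncomputable def extendTrans {G : C ⥤ᵖ D}
    {hG : ∀ ⦃X Y : C⦄ (f : X ⟶ Y), M.W f → IsQuasiequiv (G.map f)} (θ : F ⟶ G) :
    extend F hF ⟶ extend G hG where
  app X := θ.app X.obj
  naturality f := θ.naturality f.arrow
  naturality_naturality a := HoSigma.naturality_of_cell (F := extend F hF) (G := extend G hG)
    (fun _ _ s hs => hG s.arrow hs) (fun X => θ.app X.obj) (fun f => θ.naturality f.arrow)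
    (fun {X Y f g} μ => by
      rw [extend_map₂_proj₂, extend_map₂_proj₂]
      exact θ.naturality_naturality μ)
    (fun f g => θ.naturality_comp f.arrow g.arrow) a
  naturality_id X := θ.naturality_id X.obj
  naturality_comp f g := θ.naturality_comp f.arrow g.arrow

/-- By the generation of 2-cells, an assignment compatible with vertical composition and right
whiskering is determined by its values on cells of `C`, since the images of `W` can be cancelled.
This is the uniqueness of extensions on 2-cells. -/
lemma HoSigma.map₂_eq_of_cell {F : HoSigma M ⥤ᵖ D}
    (hF : ∀ ⦃X Y : HoSigma M⦄ (s : X ⟶ Y), M.W s.arrow → IsQuasiequiv (F.map s))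
    (φ : ∀ {X Y : HoSigma M} {f g : X ⟶ Y}, (f ⟶ g) → (F.map f ⟶ F.map g))
    (cell : ∀ {X Y : HoSigma M} {f g : X ⟶ Y} (μ : f.arrow ⟶ g.arrow),
      φ (HoSigma.proj₂ μ : f ⟶ g) = F.map₂ (HoSigma.proj₂ μ : f ⟶ g))
    (comp : ∀ {X Y : HoSigma M} {f g h : X ⟶ Y} (a : f ⟶ g) (b : g ⟶ h),
      φ (a ≫ b) = φ a ≫ φ b)
    (whiskerRight : ∀ {X Y Z : HoSigma M} {f g : X ⟶ Y} (a : f ⟶ g) (r : Y ⟶ Z),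
      φ (a ▷ r) = (F.mapComp f r).hom ≫ φ a ▷ F.map r ≫ (F.mapComp g r).inv)
    {X Y : HoSigma M} {f g : X ⟶ Y} (a : f ⟶ g) : φ a = F.map₂ a := by
  refine HoSigma.induction_cell (P := fun {X Y f g} a => φ a = F.map₂ a) cell ?_ ?_ ?_ a
  · intro X Y f g h a b ha hb
    rw [comp, ha, hb, F.map₂_comp]
  · intro X Y Z f g a r h
    rw [whiskerRight, h, F.map₂_whisker_right]
  · intro X Y Z f g a s hs h
    rw [whiskerRight, F.map₂_whisker_right] at h
    exact (hF s hs).isCancellable.right ((cancel_mono _).1 ((cancel_epi _).1 h))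

lemma extend_proj_comp_map₂ {F : HoSigma M ⥤ᵖ D}
    (hF : ∀ ⦃X Y : C⦄ (f : X ⟶ Y), M.W f → IsQuasiequiv (((proj M).comp F).map f))
    {X Y : HoSigma M} {f g : X ⟶ Y} (a : f ⟶ g) :
    (extend ((proj M).comp F) hF).map₂ a = F.map₂ a := by
  have hw : ∀ {X Y Z : HoSigma M} {f g : X ⟶ Y} (a : f ⟶ g) (r : Y ⟶ Z),
      (extend ((proj M).comp F) hF).map₂ (a ▷ r) = (F.mapComp f r).hom ≫
        (extend ((proj M).comp F) hF).map₂ a ▷ F.map r ≫ (F.mapComp g r).inv := by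
    intro X Y Z f g a r
    rw [Pseudofunctor.map₂_whisker_right]
    -- Composing with the projection adds a factor `F.map₂ (𝟙 _)` to the structural cells, so these
    -- agree with those of `F` only up to an identity.
    have e : ∀ (f : X ⟶ Y), (extend ((proj M).comp F) hF).mapComp f r = F.mapComp f r := by
      intro f
      ext
      exact (congrArg (· ≫ (F.mapComp f r).hom) (F.map₂_id (f ≫ r))).trans (Category.id_comp _)
    rw [e f, e g]
    rfl
  exact HoSigma.map₂_eq_of_cell (F := F) (fun X Y s hs => hF s.arrow hs)
    (fun {X Y f g} a => (extend ((proj M).comp F) hF).map₂ a)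
    (fun μ => extend_map₂_proj₂ _ hF μ)
    (fun a b => (extend ((proj M).comp F) hF).map₂_comp a b) hw a

lemma extend_comp_map₂ {A : Type*} [Bicategory A] {K : C ⥤ᵖ A}
    (hK : ∀ ⦃X Y : C⦄ (f : X ⟶ Y), M.W f → IsQuasiequiv (K.map f)) {G : A ⥤ᵖ D}
    (hG : ∀ ⦃X Y : C⦄ (f : X ⟶ Y), M.W f → IsQuasiequiv ((K.comp G).map f))
    {X Y : HoSigma M} {f g : X ⟶ Y} (a : f ⟶ g) :
    (extend (K.comp G) hG).map₂ a = G.map₂ ((extend K hK).map₂ a) := by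
  symm
  refine HoSigma.map₂_eq_of_cell (F := extend (K.comp G) hG) (fun X Y s hs => hG s.arrow hs)
    (fun {X Y f g} a => G.map₂ ((extend K hK).map₂ a)) (fun {X Y f g} μ => ?_) (fun a b => ?_)
    (fun a r => ?_) a
  · rw [extend_map₂_proj₂, extend_map₂_proj₂]
    rfl
  · exact ((extend K hK).comp G).map₂_comp a b
  · exact ((extend K hK).comp G).map₂_whisker_right a r

end Extension

end ModelStructure

/-! ### The endomorphism of `Ho(C)` induced by `r` is equivalent to the identity. -/

lemma IsCancellable.eq_of_whiskerRight_comp {B : Type*} [Bicategory B] {X Y : B} {e : X ⟶ Y}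
    (he : IsCancellable e) {Z : B} {f g : Z ⟶ X} {a b : f ⟶ g} {k : Z ⟶ Y} (n : g ≫ e ≅ k)
    {c : f ≫ e ⟶ k} (h : a ▷ e ≫ n.hom = c) (h' : b ▷ e ≫ n.hom = c) : a = b :=
  he.right ((cancel_mono n.hom).1 (h.trans h'.symm))

namespace ModelStructure

variable {C : Type u} [Bicategory.{w, v} C] {M : ModelStructure C}
  {Q : M.CofibrantReplacement} {R : M.FibrantReplacement}

/-- This passes between a naturality equation for the squares obtained from `nf` and `ng` by
applying `F`, and the image under `F` of a naturality equation in `B`. -/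
lemma map₂_natural_iff {B : Type*} [Bicategory B] {D : Type*} [Bicategory D] (F : B ⥤ᵖ D)
    {X Y X' Y' : B} {f g : X ⟶ Y} {f' g' : X' ⟶ Y'} {e : X ⟶ X'} {e' : Y ⟶ Y'}
    (nf : f ≫ e' ≅ e ≫ f') (ng : g ≫ e' ≅ e ≫ g') (a : f ⟶ g) (b : f' ⟶ g') :
    F.map₂ a ▷ F.map e' ≫ ((F.mapComp _ _).inv ≫ F.map₂ ng.hom ≫ (F.mapComp _ _).hom) =
      ((F.mapComp _ _).inv ≫ F.map₂ nf.hom ≫ (F.mapComp _ _).hom) ≫ F.map e ◁ F.map₂ b ↔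
    F.map₂ (a ▷ e' ≫ ng.hom) = F.map₂ (nf.hom ≫ e ◁ b) := by
  rw [← cancel_epi (F.mapComp f e').hom, ← cancel_mono (F.mapComp e g').inv]
  simp

lemma HoSigma.ext_extend {X Y : HoSigma M} {f g : X ⟶ Y} {a b : f ⟶ g}
    (h : ∀ T : TestFunctor M.W, (extend T.psf T.inverts).map₂ a =
      (extend T.psf T.inverts).map₂ b) : a = b :=
  HoSigma.Hom₂.ext (HomotopyClass.ext h)

section

variable (Q)

/-- The cofibrant replacement of an object of `Ho(C)`. -/
def cofObj (A : Ho M) : Ho M :=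
  ⟨Q.obj A.1, A.2.1.comp (Q.p A.1) (Q.fib A.1), Q.cofibrant A.1⟩

/-- The arrow from the cofibrant replacement, in `Ho(C)`. -/
def cofArrow (A : Ho M) : cofObj Q A ⟶ A :=
  Ho.ofArrow (X := cofObj Q A) (Q.p A.1)

lemma isEquiv_cofArrow (A : Ho M) : IsEquiv (cofArrow Q A) :=
  isEquiv_of_w _ (Q.weq A.1)

/-- The cofibrant replacement of an arrow of `Ho(C)`. -/
def cofMap {A B : Ho M} (f : A ⟶ B) : cofObj Q A ⟶ cofObj Q B :=
  Ho.ofArrow (X := cofObj Q A) (Y := cofObj Q B) (Q.map f.hom.arrow)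

/-- The cells `ρ`, in `Ho(C)`. -/
def cofNat {A B : Ho M} (f : A ⟶ B) : cofMap Q f ≫ cofArrow Q B ≅ cofArrow Q A ≫ f :=
  InducedBicategory.isoMk (Q.nat f.hom.arrow)

/-- A 2-cell of `Ho(C)` need not come from `C`, so the choice `Q.map₂` does not apply. The lift
exists because `cofArrow Q B` is an equivalence in `Ho(C)` by the Whitehead theorem. -/
lemma exists_cofMap₂ {A B : Ho M} {f g : A ⟶ B} (a : f ⟶ g) : ∃ b : cofMap Q f ⟶ cofMap Q g,
    b ▷ cofArrow Q B ≫ (cofNat Q g).hom = (cofNat Q f).hom ≫ cofArrow Q A ◁ a := by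
  obtain ⟨b, hb⟩ := ((isEquiv_cofArrow Q B).isQuasiequiv.1 _ (cofMap Q f) (cofMap Q g)).2
    ((cofNat Q f).hom ≫ cofArrow Q A ◁ a ≫ (cofNat Q g).inv)
  refine ⟨b, (congrArg (· ≫ (cofNat Q g).hom) hb).trans ?_⟩
  simp

/-- The cofibrant replacement, as the data which define a pseudofunctor from `Ho(C)` to
`Ho(C)`. -/
noncomputable def cofLiftData : LiftData (Pseudofunctor.id (Ho M)) where
  obj A := cofObj Q A
  e A := cofArrow Q A
  cancel e := (isEquiv_cofArrow Q _).isCancellable.right e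
  map f := cofMap Q f
  nat f := cofNat Q f
  map₂ a := (exists_cofMap₂ Q a).choose
  map₂_e a := (exists_cofMap₂ Q a).choose_spec
  mapId A := InducedBicategory.isoMk (Q.mapIdIso A.1)
  mapId_e A := (comp_whiskerLeft_id_eq _ _ _).trans (InducedBicategory.hom₂_ext (Q.nat_id A.1))
  mapComp f g := InducedBicategory.isoMk (Q.mapCompIso f.hom.arrow g.hom.arrow)
  mapComp_e f g := (comp_whiskerLeft_id_eq _ _ _).trans
    (InducedBicategory.hom₂_ext (Q.nat_comp f.hom.arrow g.hom.arrow))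

/-- The cofibrant replacement, as a pseudofunctor from `Ho(C)` to `Ho(C)`. -/
noncomputable def cofPsf : Ho M ⥤ᵖ Ho M :=
  (cofLiftData Q).pseudofunctor

/-- The cofibrant replacement is equivalent to the identity of `Ho(C)`. -/
noncomputable def cofTrans : cofPsf Q ⟶ Pseudofunctor.id (Ho M) :=
  (cofLiftData Q).trans

end

namespace ReplacementPseudofunctor

variable (S : ReplacementPseudofunctor Q R)

lemma isQuasiequiv_map ⦃X Y : C⦄ (f : X ⟶ Y) (hf : M.W f) : IsQuasiequiv (S.r.map f) :=
  (S.inverts f hf).isQuasiequiv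

/-- The extension of `r` to `Ho(C, W)`. -/
noncomputable def ext : HoSigma M ⥤ᵖ Ho M :=
  extend S.r S.isQuasiequiv_map

/-- The restriction of `S.ext` to `Ho(C)`. -/
noncomputable def endo : Ho M ⥤ᵖ Ho M :=
  (incl M).comp S.ext

/-- The arrow to the fibrant-cofibrant replacement, in `Ho(C)`. -/
def fibArrow (R : M.FibrantReplacement) (A : Ho M) : cofObj Q A ⟶ rqObj Q R A.1 :=
  Ho.ofArrow (X := cofObj Q A) (Y := rqObj Q R A.1) (R.i (Q.obj A.1))

/-- The cells `lam`, in `Ho(C)`. -/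
def fibNat (R : M.FibrantReplacement) {A B : Ho M} (f : A ⟶ B) :
    cofMap Q f ≫ fibArrow R B ≅ fibArrow R A ≫ rqMap Q R f.hom.arrow :=
  InducedBicategory.isoMk (R.nat (Q.map f.hom.arrow))

/-- Two ways of applying `Q` to a 2-cell of `Ho(C)` are compared: extending the composite of `Q.psf`
with a test functor, and lifting along `p` inside `Ho(C)`. The detour through a test functor is made
because only cancellation of `W` in `Ho(C, W)` has been established, while `extend` asks for
quasiequivalences. Both results are natural with respect to the image of `p`, which can be
cancelled. -/
lemma extend_map₂_cofPsf (T : TestFunctor M.W) {A B : Ho M} {f g : A ⟶ B} (a : f ⟶ g)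
    (hQ : ∀ ⦃X Y : C⦄ (f : X ⟶ Y), M.W f →
      IsQuasiequiv ((Q.psf.comp (extend T.psf T.inverts)).map f)) :
    (extend (Q.psf.comp (extend T.psf T.inverts)) hQ).map₂ a.hom =
      (extend T.psf T.inverts).map₂ ((cofPsf Q).map₂ a).hom := by
  have hT : ∀ ⦃X Y : C⦄ (f : X ⟶ Y), M.W f →
      IsQuasiequiv (((proj M).comp (extend T.psf T.inverts)).map f) :=
    fun X Y f hf => T.inverts f hf
  have h := (extendTrans (hF := hQ) (hG := hT)
    (postcompTrans Q.trans (extend T.psf T.inverts))).naturality_naturality a.hom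
  have h1 := congrArg (fun z => z.hom) ((cofTrans Q).naturality_naturality a)
  have h2 := (map₂_natural_iff (extend T.psf T.inverts) (Q.nat f.hom.arrow) (Q.nat g.hom.arrow)
    ((cofPsf Q).map₂ a).hom a.hom).2 (congrArg (extend T.psf T.inverts).map₂ h1)
  exact (T.inverts _ (Q.weq B.1)).isCancellable.eq_of_whiskerRight_comp
    (((postcompTrans Q.trans (extend T.psf T.inverts)).naturality g.hom.arrow))
    (h.trans (congrArg (fun z => ((postcompTrans Q.trans (extend T.psf T.inverts)).naturality
      f.hom.arrow).hom ≫ T.psf.map (Q.p A.1) ◁ z) (extend_proj_comp_map₂ hT a.hom))) h2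

/-- The equation is tested on each test functor `T`. Postcomposed with `T`, the transformation with
components `i` extends to `Ho(C, W)`, hence is natural with respect to `a`; `e1` and `e2` identify
the values of the extensions on `a`. -/
theorem cofPsf_map₂_natural {A B : Ho M} {f g : A ⟶ B} (a : f ⟶ g) :
    (cofPsf Q).map₂ a ▷ fibArrow R B ≫ (fibNat R g).hom =
      (fibNat R f).hom ≫ fibArrow R A ◁ S.endo.map₂ a := by
  refine InducedBicategory.hom₂_ext (HoSigma.ext_extend fun T => ?_)
  have hQ : ∀ ⦃X Y : C⦄ (f : X ⟶ Y), M.W f →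
      IsQuasiequiv ((Q.psf.comp (extend T.psf T.inverts)).map f) :=
    fun X Y f hf => T.inverts (Q.map f) (Q.w_map hf)
  have hS : ∀ ⦃X Y : C⦄ (f : X ⟶ Y), M.W f →
      IsQuasiequiv (((S.r.comp (incl M)).comp (extend T.psf T.inverts)).map f) :=
    fun X Y f hf => T.inverts (R.map (Q.map f)) (R.w_map (Q.w_map hf))
  have h := (extendTrans (hF := hQ) (hG := hS)
    (postcompTrans S.trans (extend T.psf T.inverts))).naturality_naturality a.hom
  refine (map₂_natural_iff (extend T.psf T.inverts) (R.nat (Q.map f.hom.arrow))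
    (R.nat (Q.map g.hom.arrow)) ((cofPsf Q).map₂ a).hom (S.endo.map₂ a).hom).1 ?_
  have e1 := extend_map₂_cofPsf T a hQ
  have e2 : (extend ((S.r.comp (incl M)).comp (extend T.psf T.inverts)) hS).map₂ a.hom =
      (extend T.psf T.inverts).map₂ (S.endo.map₂ a).hom :=
    (extend_comp_map₂ (K := S.r.comp (incl M)) (fun X Y f hf => ((S.inverts f hf).map
      (incl M)).isQuasiequiv) hS a.hom).trans (congrArg (extend T.psf T.inverts).map₂
        (extend_comp_map₂ S.isQuasiequiv_map (G := incl M) _ a.hom))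
  refine (congrArg (fun z => z ▷ T.psf.map (R.i (Q.obj B.1)) ≫
    ((postcompTrans S.trans (extend T.psf T.inverts)).naturality g.hom.arrow).hom) e1.symm).trans
      (h.trans (congrArg (fun z => ((postcompTrans S.trans (extend T.psf T.inverts)).naturality
      f.hom.arrow).hom ≫ T.psf.map (R.i (Q.obj A.1)) ◁ z) e2))

/-- The arrows to the fibrant-cofibrant replacement, as a pseudonatural transformation. -/
noncomputable def fibTrans : cofPsf Q ⟶ S.endo where
  app A := fibArrow R A
  naturality f := fibNat R f
  naturality_naturality a := S.cofPsf_map₂_natural a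
  naturality_id A := (congrArg (fun z => (fibNat R (𝟙 A)).hom ≫ fibArrow R A ◁ z)
    (Category.id_comp (S.mapId A.1).hom)).trans (InducedBicategory.hom₂_ext (S.nat_id A.1))
  naturality_comp f g := (congrArg (fun z => (fibNat R (f ≫ g)).hom ≫ fibArrow R _ ◁ z)
    (Category.id_comp (S.mapComp f.hom.arrow g.hom.arrow).hom)).trans
      (InducedBicategory.hom₂_ext (S.nat_comp f.hom.arrow g.hom.arrow))

/-- The fibrant-cofibrant replacement is equivalent to the identity of `Ho(C)`. -/
theorem exists_endo_equiv : ∃ u : S.endo ⟶ Pseudofunctor.id (Ho M), IsEquiv u := by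
  have hi : IsEquiv S.fibTrans := isEquiv_of_app _ fun A => isEquiv_of_w _ (R.weq (Q.obj A.1))
  have hp : IsEquiv (cofTrans Q) := isEquiv_of_app _ fun A => isEquiv_cofArrow Q A
  -- The equivalence is the zigzag through `QA`: a quasi-inverse of the arrows `i`, followed by the
  -- arrows `p`.
  obtain ⟨j, a, b⟩ := hi
  exact ⟨j ≫ cofTrans Q, IsEquiv.comp ⟨_, b, a⟩ hp⟩

end ReplacementPseudofunctor

end ModelStructure

/-! ### Modifications, studied along one arrow at a time. -/

section Naturality

variable {B : Type u} [Bicategory.{w, v} B] {D : Type u₁} [Bicategory.{w₁, v₁} D] {F G : B ⥤ᵖ D}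
  {θ η : F ⟶ G}

/-- A pair of 2-cells between components of pseudonatural transformations is natural with respect
to an arrow. -/
def IsNatural (θ η : F ⟶ G) {X Y : B} (f : X ⟶ Y) (a : θ.app X ⟶ η.app X)
    (b : θ.app Y ⟶ η.app Y) : Prop :=
  F.map f ◁ b ≫ (η.naturality f).hom = (θ.naturality f).hom ≫ a ▷ G.map f

lemma isNatural_app (Γ : θ ⟶ η) {X Y : B} (f : X ⟶ Y) :
    IsNatural θ η f (Γ.as.app X) (Γ.as.app Y) :=
  Γ.as.naturality f

namespace IsNatural

lemma of_iso {X Y : B} {f g : X ⟶ Y} {a : θ.app X ⟶ η.app X} {b : θ.app Y ⟶ η.app Y}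
    (h : IsNatural θ η f a b) (φ : f ≅ g) : IsNatural θ η g a b := by
  unfold IsNatural at h ⊢
  have h1 := θ.naturality_naturality φ.hom
  have h2 := η.naturality_naturality φ.hom
  rw [← cancel_epi (F.map₂ φ.hom ▷ θ.app Y), ← whisker_exchange_assoc, h2, reassoc_of% h,
    reassoc_of% h1, whisker_exchange]

/-- Along an arrow inverted by `F`, the component at the source determines the one at the target;
along an arrow inverted by `G` the converse holds (`eq_left`). With the existence lemmas
`exists_right` and `exists_left`, components can be transported along zigzags of weak equivalences.
-/
lemma eq_right {X Y : B} {f : X ⟶ Y} {a : θ.app X ⟶ η.app X} {b b' : θ.app Y ⟶ η.app Y}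
    (h : IsNatural θ η f a b) (h' : IsNatural θ η f a b') (hf : IsQuasiequiv (F.map f)) :
    b = b' :=
  hf.isCancellable.left ((cancel_mono _).1 (Eq.trans h (Eq.symm h')))

lemma eq_left {X Y : B} {f : X ⟶ Y} {a a' : θ.app X ⟶ η.app X} {b : θ.app Y ⟶ η.app Y}
    (h : IsNatural θ η f a b) (h' : IsNatural θ η f a' b) (hf : IsQuasiequiv (G.map f)) :
    a = a' :=
  hf.isCancellable.right ((cancel_epi _).1 (Eq.trans (Eq.symm h) h'))

lemma exists_right {X Y : B} {f : X ⟶ Y} (a : θ.app X ⟶ η.app X) (hf : IsQuasiequiv (F.map f)) :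
    ∃ b, IsNatural θ η f a b := by
  obtain ⟨b, hb⟩ := (hf.2 _ (θ.app Y) (η.app Y)).2
    ((θ.naturality f).hom ≫ a ▷ G.map f ≫ (η.naturality f).inv)
  refine ⟨b, (congrArg (· ≫ (η.naturality f).hom) hb).trans ?_⟩
  simp

lemma exists_left {X Y : B} {f : X ⟶ Y} (b : θ.app Y ⟶ η.app Y) (hf : IsQuasiequiv (G.map f)) :
    ∃ a, IsNatural θ η f a b := by
  obtain ⟨a, ha⟩ := (hf.1 _ (θ.app X) (η.app X)).2
    ((θ.naturality f).inv ≫ F.map f ◁ b ≫ (η.naturality f).hom)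
  refine ⟨a, ((congrArg ((θ.naturality f).hom ≫ ·) ha).trans ?_).symm⟩
  simp

variable {X Y Z : B} {f : X ⟶ Y} {g : Y ⟶ Z} {a : θ.app X ⟶ η.app X} {b : θ.app Y ⟶ η.app Y}
  {c : θ.app Z ⟶ η.app Z}

lemma comp_aux_left : F.map (f ≫ g) ◁ c ≫ (η.naturality (f ≫ g)).hom ≫
      η.app X ◁ (G.mapComp f g).hom =
    ((F.mapComp f g).hom ▷ θ.app Z ≫ (α_ _ _ _).hom) ≫
      F.map f ◁ (F.map g ◁ c ≫ (η.naturality g).hom) ≫ (α_ _ _ _).inv ≫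
        (η.naturality f).hom ▷ G.map g ≫ (α_ _ _ _).hom := by
  rw [η.naturality_comp, whisker_exchange_assoc]
  simp

lemma comp_aux_middle (h : IsNatural θ η f a b) :
    F.map f ◁ (θ.naturality g).hom ≫ (α_ _ _ _).inv ≫ ((θ.naturality f).hom ≫ a ▷ G.map f) ▷ G.map g =
      F.map f ◁ ((θ.naturality g).hom ≫ b ▷ G.map g) ≫ (α_ _ _ _).inv ≫
        (η.naturality f).hom ▷ G.map g := by
  rw [← show _ = _ from h]
  simp

lemma comp_aux_right : (θ.naturality (f ≫ g)).hom ≫ a ▷ G.map (f ≫ g) ≫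
      η.app X ◁ (G.mapComp f g).hom =
    ((F.mapComp f g).hom ▷ θ.app Z ≫ (α_ _ _ _).hom) ≫
      (F.map f ◁ (θ.naturality g).hom ≫ (α_ _ _ _).inv ≫
        ((θ.naturality f).hom ≫ a ▷ G.map f) ▷ G.map g) ≫ (α_ _ _ _).hom := by
  have h := θ.naturality_comp f g
  rw [← whisker_exchange, reassoc_of% h]
  simp

/-- Pasting with the structural cells turns naturality along `f ≫ g` into naturality along `g`
whiskered with `F.map f`, once naturality along `f` is known. This gives both composition and
cancellation of the first factor. -/
lemma comp_iff (h : IsNatural θ η f a b) : IsNatural θ η (f ≫ g) a c ↔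
    F.map f ◁ (F.map g ◁ c ≫ (η.naturality g).hom) =
      F.map f ◁ ((θ.naturality g).hom ≫ b ▷ G.map g) := by
  unfold IsNatural
  rw [← cancel_mono (η.app X ◁ (G.mapComp f g).hom), Category.assoc, Category.assoc,
    comp_aux_left, comp_aux_right, comp_aux_middle h]
  simp only [Category.assoc, cancel_epi]
  simp only [← Category.assoc, cancel_mono]

lemma comp (h : IsNatural θ η f a b) (h' : IsNatural θ η g b c) : IsNatural θ η (f ≫ g) a c :=
  h.comp_iff.2 (congrArg _ h')

lemma of_comp_left (h : IsNatural θ η f a b) (h' : IsNatural θ η (f ≫ g) a c)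
    (hf : IsQuasiequiv (F.map f)) : IsNatural θ η g b c :=
  hf.isCancellable.left (h.comp_iff.1 h')

/-- Here naturality along `f` is the conclusion, so `comp_iff` does not apply: naturality along `g`
is used to isolate the claim whiskered with `G.map g`. -/
lemma of_comp_right (h : IsNatural θ η g b c) (h' : IsNatural θ η (f ≫ g) a c)
    (hg : IsQuasiequiv (G.map g)) : IsNatural θ η f a b := by
  refine hg.isCancellable.right ?_
  unfold IsNatural at h'
  rw [← cancel_mono (η.app X ◁ (G.mapComp f g).hom), Category.assoc, Category.assoc,
    comp_aux_left, comp_aux_right, show _ = _ from h] at h'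
  simp only [Category.assoc, cancel_epi] at h'
  simp only [← Category.assoc, cancel_mono] at h'
  rw [← cancel_epi (F.map f ◁ (θ.naturality g).hom ≫ (α_ _ _ _).inv)]
  simp only [Bicategory.whiskerLeft_comp, comp_whiskerRight, Category.assoc] at h' ⊢
  rw [← h']
  simp

end IsNatural

end Naturality

namespace ModelStructure

variable {C : Type u} [Bicategory.{w, v} C] {M : ModelStructure C}
  {Q : M.CofibrantReplacement} {R : M.FibrantReplacement}

section Restriction

variable {D : Type u₁} [Bicategory.{w₁, v₁} D] {K L : C ⥤ᵖ D}

/-- A modification between pseudonatural transformations of pseudofunctors which map `W` to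
quasiequivalences is determined by its components at fibrant-cofibrant objects. -/
theorem modification_ext
    (hK : ∀ ⦃X Y : C⦄ (f : X ⟶ Y), M.W f → IsQuasiequiv (K.map f))
    (hL : ∀ ⦃X Y : C⦄ (f : X ⟶ Y), M.W f → IsQuasiequiv (L.map f))
    (Q : M.CofibrantReplacement) (R : M.FibrantReplacement)
    {θ η : K ⟶ L} {Γ Γ' : θ ⟶ η} (h : ∀ A : Ho M, Γ.as.app A.1 = Γ'.as.app A.1) : Γ = Γ' := by
  ext X
  -- The component at `RQX` determines the one at `QX` along `i`, and this determines the one at `X`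
  -- along `p`.
  have h1 : Γ.as.app (Q.obj X) = Γ'.as.app (Q.obj X) := by
    refine (isNatural_app Γ (R.i (Q.obj X))).eq_left ?_ (hL _ (R.weq _))
    have e : Γ.as.app (R.obj (Q.obj X)) = Γ'.as.app (R.obj (Q.obj X)) := h (rqObj Q R X)
    rw [e]
    exact isNatural_app Γ' (R.i (Q.obj X))
  refine (isNatural_app Γ (Q.p X)).eq_right ?_ (hK _ (Q.weq _))
  rw [h1]
  exact isNatural_app Γ' (Q.p X)

/-- A modification between pseudonatural transformations of pseudofunctors which map `W` to
quasiequivalences can be defined on the fibrant-cofibrant objects. -/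
theorem exists_modification
    (hK : ∀ ⦃X Y : C⦄ (f : X ⟶ Y), M.W f → IsQuasiequiv (K.map f))
    (hL : ∀ ⦃X Y : C⦄ (f : X ⟶ Y), M.W f → IsQuasiequiv (L.map f))
    (Q : M.CofibrantReplacement) (R : M.FibrantReplacement)
    {θ η : K ⟶ L} (m : ∀ A : Ho M, θ.app A.1 ⟶ η.app A.1)
    (hm : ∀ (A B : Ho M) (f : A.1 ⟶ B.1), IsNatural θ η f (m A) (m B)) :
    ∃ Γ : θ ⟶ η, ∀ A : Ho M, Γ.as.app A.1 = m A := by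
  -- The component at `X` is forced by the zigzag: `n` transports `m` back along `i` to `QX`, and
  -- `k` transports `n` forward along `p`.
  have h1 := fun X => IsNatural.exists_left (θ := θ) (η := η) (f := R.i (Q.obj X)) (m (rqObj Q R X))
    (hL _ (R.weq _))
  choose n hn using h1
  have h2 := fun X => IsNatural.exists_right (f := Q.p X) (n X) (hK _ (Q.weq _))
  choose k hk using h2
  refine ⟨⟨⟨k, fun {X Y} f => ?_⟩⟩, fun A => ?_⟩
  -- Naturality along `R (Q f)` descends to `Q f` through the square `lam`, and then to `f` through
  -- the square `ρ`.
  · have h3 : IsNatural θ η (Q.map f) (n X) (n Y) :=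
      (hn Y).of_comp_right (((hn X).comp (hm (rqObj Q R X) (rqObj Q R Y) (R.map (Q.map f)))).of_iso
        (R.lam (Q.map f)).symm) (hL _ (R.weq _))
    exact (hk X).of_comp_left ((h3.comp (hk Y)).of_iso (Q.ρ f)) (hK _ (Q.weq _))
  -- When `A` is fibrant and cofibrant, so are `QA` and `RQA`. Then `m` is itself natural along `i`
  -- and `p`, so the transported component is the original one.
  · have h3 := (hn A.1).eq_left (hm (cofObj Q A) (rqObj Q R A.1) (R.i (Q.obj A.1)))
      (hL _ (R.weq _))
    have h4 := hk A.1
    rw [h3] at h4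
    exact h4.eq_right (hm (cofObj Q A) A (Q.p A.1)) (hK _ (Q.weq _))

/-- An invertible modification between pseudonatural transformations of pseudofunctors which map
`W` to quasiequivalences can be defined on the fibrant-cofibrant objects. -/
theorem nonempty_iso_of_app
    (hK : ∀ ⦃X Y : C⦄ (f : X ⟶ Y), M.W f → IsQuasiequiv (K.map f))
    (hL : ∀ ⦃X Y : C⦄ (f : X ⟶ Y), M.W f → IsQuasiequiv (L.map f))
    (Q : M.CofibrantReplacement) (R : M.FibrantReplacement)
    {θ η : K ⟶ L} (m : ∀ A : Ho M, θ.app A.1 ≅ η.app A.1)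
    (hm : ∀ (A B : Ho M) (f : A.1 ⟶ B.1), IsNatural θ η f (m A).hom (m B).hom) :
    Nonempty (θ ≅ η) := by
  obtain ⟨Γ, hΓ⟩ := exists_modification hK hL Q R (fun A => (m A).hom) hm
  obtain ⟨Γ', hΓ'⟩ := exists_modification hK hL Q R (θ := η) (η := θ) (fun A => (m A).inv)
    (fun A B f => by
      have h := hm A B f
      unfold IsNatural at h ⊢
      rw [← cancel_epi (K.map f ◁ (m B).hom), ← cancel_mono ((m A).hom ▷ L.map f)]
      simp [h])
  refine ⟨⟨Γ, Γ', modification_ext hK hL Q R fun A => ?_, modification_ext hK hL Q R fun A => ?_⟩⟩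
  · change Γ.as.app A.1 ≫ Γ'.as.app A.1 = 𝟙 _
    rw [hΓ, hΓ', Iso.hom_inv_id]
  · change Γ'.as.app A.1 ≫ Γ.as.app A.1 = 𝟙 _
    rw [hΓ, hΓ', Iso.inv_hom_id]

end Restriction

end ModelStructure

/-! ### Rebracketing of composite pseudofunctors. -/

section Copy

variable {A : Type*} [Bicategory A] {B : Type*} [Bicategory B] {C : Type*} [Bicategory C]
  {D : Type*} [Bicategory D]

/-- The two bracketings have definitionally the same objects, arrows and 2-cell maps; only the
structural cells need an argument. A transformation can thus be moved from one bracketing to the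
other with unchanged components. -/
lemma comp_assoc_mapId (K : A ⥤ᵖ B) (G : B ⥤ᵖ C) (F : C ⥤ᵖ D) (X : A) :
    ((K.comp (G.comp F)).mapId X).hom = (((K.comp G).comp F).mapId X).hom := by
  have h : F.map₂ (G.map₂ (K.mapId X).hom) ≫ F.map₂ (G.mapId _).hom ≫ (F.mapId _).hom =
      F.map₂ (G.map₂ (K.mapId X).hom ≫ (G.mapId _).hom) ≫ (F.mapId _).hom := by
    simp
  exact h

lemma comp_assoc_mapComp (K : A ⥤ᵖ B) (G : B ⥤ᵖ C) (F : C ⥤ᵖ D) {X Y Z : A} (f : X ⟶ Y)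
    (g : Y ⟶ Z) :
    ((K.comp (G.comp F)).mapComp f g).hom = (((K.comp G).comp F).mapComp f g).hom := by
  have h : F.map₂ (G.map₂ (K.mapComp f g).hom) ≫ F.map₂ (G.mapComp _ _).hom ≫
      (F.mapComp _ _).hom =
      F.map₂ (G.map₂ (K.mapComp f g).hom ≫ (G.mapComp _ _).hom) ≫ (F.mapComp _ _).hom := by
    simp
  exact h

/-- Reassociation of the target of a pseudonatural transformation. -/
def assocTarget {K : A ⥤ᵖ B} {G : B ⥤ᵖ C} {F : C ⥤ᵖ D} {H : A ⥤ᵖ D}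
    (θ : H ⟶ (K.comp G).comp F) : H ⟶ K.comp (G.comp F) where
  app X := θ.app X
  naturality f := θ.naturality f
  naturality_naturality a := θ.naturality_naturality a
  naturality_id X := (congrArg (fun z => (θ.naturality (𝟙 X)).hom ≫ θ.app X ◁ z)
    (comp_assoc_mapId K G F X)).trans (θ.naturality_id X)
  naturality_comp {X _ _} f g := (congrArg (fun z => (θ.naturality (f ≫ g)).hom ≫ θ.app X ◁ z)
    (comp_assoc_mapComp K G F f g)).trans (θ.naturality_comp f g)

/-- Reassociation of the source of a pseudonatural transformation. -/
def assocSource {K : A ⥤ᵖ B} {G : B ⥤ᵖ C} {F : C ⥤ᵖ D} {H : A ⥤ᵖ D}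
    (θ : (K.comp G).comp F ⟶ H) : K.comp (G.comp F) ⟶ H where
  app X := θ.app X
  naturality f := θ.naturality f
  naturality_naturality a := θ.naturality_naturality a
  naturality_id X := (θ.naturality_id X).trans
    (congrArg (fun z => z ▷ θ.app X ≫ (λ_ (θ.app X)).hom ≫ (ρ_ (θ.app X)).inv)
      (comp_assoc_mapId K G F X)).symm
  naturality_comp {_ _ Z} f g := (θ.naturality_comp f g).trans
    (congrArg (fun z => z ▷ θ.app Z ≫ (α_ _ _ _).hom ≫ _ ◁ (θ.naturality g).hom ≫
      (α_ _ _ _).inv ≫ (θ.naturality f).hom ▷ _ ≫ (α_ _ _ _).hom)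
      (comp_assoc_mapComp K G F f g)).symm

lemma id_comp_mapId (F : C ⥤ᵖ D) (X : C) :
    (F.mapId X).hom = (((Pseudofunctor.id C).comp F).mapId X).hom := by
  have h : (F.mapId X).hom = F.map₂ (𝟙 _) ≫ (F.mapId X).hom := by simp
  exact h

lemma id_comp_mapComp (F : C ⥤ᵖ D) {X Y Z : C} (f : X ⟶ Y) (g : Y ⟶ Z) :
    (F.mapComp f g).hom = (((Pseudofunctor.id C).comp F).mapComp f g).hom := by
  have h : (F.mapComp f g).hom = F.map₂ (𝟙 _) ≫ (F.mapComp f g).hom := by simp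
  exact h

/-- Removal of the identity from the target of a pseudonatural transformation. -/
def idTarget {F : C ⥤ᵖ D} {H : C ⥤ᵖ D} (θ : H ⟶ (Pseudofunctor.id C).comp F) : H ⟶ F where
  app X := θ.app X
  naturality f := θ.naturality f
  naturality_naturality a := θ.naturality_naturality a
  naturality_id X := (congrArg (fun z => (θ.naturality (𝟙 X)).hom ≫ θ.app X ◁ z)
    (id_comp_mapId F X)).trans (θ.naturality_id X)
  naturality_comp {X _ _} f g := (congrArg (fun z => (θ.naturality (f ≫ g)).hom ≫ θ.app X ◁ z)
    (id_comp_mapComp F f g)).trans (θ.naturality_comp f g)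

end Copy

/-! ### The universal property of `r` on pseudofunctors, transformations and modifications. -/

namespace ModelStructure

variable {C : Type u} [Bicategory.{w, v} C] {M : ModelStructure C}
  {Q : M.CofibrantReplacement} {R : M.FibrantReplacement}
  {D : Type u₁} [Bicategory.{w₁, v₁} D]

/-- A pseudonatural transformation to the restriction of an extension, as a transformation to the
pseudofunctor extended. -/
noncomputable def extendTarget {F H : C ⥤ᵖ D}
    {hF : ∀ ⦃X Y : C⦄ (f : X ⟶ Y), M.W f → IsQuasiequiv (F.map f)}
    (θ : H ⟶ (proj M).comp (extend F hF)) : H ⟶ F where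
  app X := θ.app X
  naturality f := θ.naturality f
  naturality_naturality {X Y f g} μ := (θ.naturality_naturality μ).trans
    (congrArg (fun z => (θ.naturality f).hom ≫ θ.app X ◁ z)
      (extend_map₂_proj₂ F hF (X := ⟨X⟩) (Y := ⟨Y⟩) (f := arr f) (g := arr g) μ))
  naturality_id X := (congrArg (fun z => (θ.naturality (𝟙 X)).hom ≫ θ.app X ◁ z)
    (Category.id_comp (F.mapId X).hom).symm).trans (θ.naturality_id X)
  naturality_comp {X _ _} f g := (congrArg (fun z => (θ.naturality (f ≫ g)).hom ≫ θ.app X ◁ z)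
    (Category.id_comp (F.mapComp f g).hom).symm).trans (θ.naturality_comp f g)

/-- The extension to `Ho(C, W)` of a pseudonatural transformation between composites. -/
noncomputable def extendCompTrans {A : Type*} [Bicategory A] {K : C ⥤ᵖ A}
    (hK : ∀ ⦃X Y : C⦄ (f : X ⟶ Y), M.W f → IsEquiv (K.map f)) {F G : A ⥤ᵖ D}
    (θ : K.comp F ⟶ K.comp G) :
    (extend K (fun _ _ f hf => (hK f hf).isQuasiequiv)).comp F ⟶
      (extend K (fun _ _ f hf => (hK f hf).isQuasiequiv)).comp G where
  app X := θ.app X.obj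
  naturality f := θ.naturality f.arrow
  naturality_naturality a := HoSigma.naturality_of_cell
    (F := (extend K (fun _ _ f hf => (hK f hf).isQuasiequiv)).comp F)
    (G := (extend K (fun _ _ f hf => (hK f hf).isQuasiequiv)).comp G)
    (fun _ _ s hs => ((hK s.arrow hs).map G).isQuasiequiv) (fun X => θ.app X.obj)
    (fun f => θ.naturality f.arrow)
    (fun {X Y f g} μ => by
      refine (congrArg (fun z => F.map₂ z ▷ θ.app Y.obj ≫ (θ.naturality g.arrow).hom)
        (extend_map₂_proj₂ K _ μ)).trans ((θ.naturality_naturality μ).trans ?_)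
      exact (congrArg (fun z => (θ.naturality f.arrow).hom ≫ θ.app X.obj ◁ G.map₂ z)
        (extend_map₂_proj₂ K _ μ)).symm)
    (fun f g => θ.naturality_comp f.arrow g.arrow) a
  naturality_id X := θ.naturality_id X.obj
  naturality_comp f g := θ.naturality_comp f.arrow g.arrow

namespace ReplacementPseudofunctor

variable (S : ReplacementPseudofunctor Q R)

/-- A pseudofunctor which maps `W` to equivalences factors through `r`. -/
theorem exists_factorization (F : C ⥤ᵖ D) (hF : Inverts M.W F) :
    ∃ (F' : Ho M ⥤ᵖ D) (e : S.r.comp F' ⟶ F), IsEquiv e := by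
  let F₁ := extend F (fun _ _ f hf => (hF f hf).isQuasiequiv)
  -- The factorization is the restriction of `F₁` to `Ho(C)`. Both `i` and `p` have weak
  -- equivalences sent by `F` as components, and they link the composite with `r` to `F` through
  -- `Q.psf`.
  let i : Q.psf.comp F₁ ⟶ S.r.comp ((incl M).comp F₁) := assocTarget (postcompTrans S.trans F₁)
  let p : Q.psf.comp F₁ ⟶ F := extendTarget (postcompTrans Q.trans F₁)
  have hi : IsEquiv i := isEquiv_of_app _ fun X => hF _ (R.weq (Q.obj X))
  have hp : IsEquiv p := isEquiv_of_app _ fun X => hF _ (Q.weq X)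
  obtain ⟨j, a, b⟩ := hi
  exact ⟨_, j ≫ p, IsEquiv.comp ⟨_, b, a⟩ hp⟩

variable (u : S.endo ⟶ Pseudofunctor.id (Ho M))

/-- The image by a pseudofunctor of a pseudonatural transformation from the fibrant-cofibrant
replacement to the identity. -/
noncomputable def whiskerEndo (F : Ho M ⥤ᵖ D) : (incl M).comp (S.ext.comp F) ⟶ F :=
  assocSource (idTarget (postcompTrans u F))

variable {u}

lemma isEquiv_whiskerEndo_app (hu : IsEquiv u) (F : Ho M ⥤ᵖ D) (A : Ho M) :
    IsEquiv ((S.whiskerEndo u F).app A) :=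
  (hu.app A).map F

/-- The naturality of `whiskerEndo`. -/
noncomputable def whiskerEndoIso {F G : Ho M ⥤ᵖ D} (θ : F ⟶ G) :
    S.whiskerEndo u F ≫ θ ≅
      precompTrans (incl M) (precompTrans S.ext θ) ≫ S.whiskerEndo u G :=
  Pseudofunctor.StrongTrans.isoMk (fun A => θ.naturality (u.app A)) (fun f =>
    (interchangeIso u θ).hom.as.naturality f)

/-- A pseudonatural transformation between restrictions along `r` is, up to isomorphism, the
restriction of one. -/
theorem exists_restriction_iso {F G : Ho M ⥤ᵖ D} (θ : S.r.comp F ⟶ S.r.comp G) :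
    ∃ θ' : F ⟶ G, Nonempty (precompTrans S.r θ' ≅ θ) := by
  obtain ⟨u, hu⟩ := S.exists_endo_equiv
  obtain ⟨v, ⟨a⟩, ⟨b⟩⟩ := isEquiv_of_app _ (S.isEquiv_whiskerEndo_app hu F)
  have hG := isEquiv_of_app _ (S.isEquiv_whiskerEndo_app hu G)
  let θ₁ := precompTrans (incl M) (extendCompTrans S.inverts θ)
  -- The transformation `θ₁` goes between the composites of `endo` with `F` and `G`; it is
  -- conjugated by the equivalence of `endo` with the identity.
  let θ' : F ⟶ G := v ≫ θ₁ ≫ S.whiskerEndo u G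
  let φ : precompTrans (incl M) (precompTrans S.ext θ') ≫ S.whiskerEndo u G ≅
      θ₁ ≫ S.whiskerEndo u G :=
    (S.whiskerEndoIso θ').symm ≪≫ (α_ _ _ _).symm ≪≫ whiskerRightIso a _ ≪≫ λ_ _
  -- By the naturality of `whiskerEndo`, the restriction of `θ'` and `θ₁` become isomorphic after
  -- composition with an equivalence, which is then cancelled. At `A` the resulting `ψ` compares
  -- `θ'` at `rA` with `θ` at `A`, hence it gives the required isomorphism at fibrant-cofibrant
  -- objects.
  obtain ⟨ψ, -⟩ := hG.isQuasiequiv.exists_iso_right φ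
  refine ⟨θ', nonempty_iso_of_app (K := S.r.comp F) (L := S.r.comp G)
    (fun X Y f hf => ((S.inverts f hf).map F).isQuasiequiv)
    (fun X Y f hf => ((S.inverts f hf).map G).isQuasiequiv) Q R
    (fun A => ⟨ψ.hom.as.app A, ψ.inv.as.app A, congrArg (fun Γ => Γ.as.app A) ψ.hom_inv_id,
      congrArg (fun Γ => Γ.as.app A) ψ.inv_hom_id⟩) fun A B f => ?_⟩
  exact ψ.hom.as.naturality (Ho.ofArrow f : A ⟶ B)

/-- Restriction along `r` is full and faithful on modifications. -/
theorem existsUnique_modification {F G : Ho M ⥤ᵖ D} {θ η : F ⟶ G}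
    (Γ : precompTrans S.r θ ⟶ precompTrans S.r η) : ∃! Γ' : θ ⟶ η, precompMod S.r Γ' = Γ := by
  obtain ⟨u, hu⟩ := S.exists_endo_equiv
  have huF := fun A => ((hu.app A).map F).isQuasiequiv
  have huG := fun A => ((hu.app A).map G).isQuasiequiv
  refine existsUnique_of_exists_of_unique ?_ fun Γ₁ Γ₂ h₁ h₂ => ?_
  -- The component at `A` is the transport, along `u.app A` from `rA` to `A`, of the given component
  -- of `Γ` at `A`, which is a 2-cell over `rA`.
  · have h := fun A : Ho M => IsNatural.exists_right (θ := θ) (η := η) (f := u.app A)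
      (Γ.as.app A.1) (huF A)
    choose m hm using h
    let Γ' : θ ⟶ η := ⟨⟨m, fun {A B} f => by
      have h1 : IsNatural θ η (S.endo.map f) (Γ.as.app A.1) (Γ.as.app B.1) :=
        Γ.as.naturality f.hom.arrow
      exact (hm A).of_comp_left ((h1.comp (hm B)).of_iso (u.naturality f)) (huF A)⟩⟩
    refine ⟨Γ', modification_ext (K := S.r.comp F) (L := S.r.comp G)
      (fun X Y f hf => ((S.inverts f hf).map F).isQuasiequiv)
      (fun X Y f hf => ((S.inverts f hf).map G).isQuasiequiv) Q R fun A => ?_⟩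
    -- Conversely, transport back along `u.app A` recovers `Γ` at fibrant-cofibrant objects, and
    -- this is enough by `modification_ext`.
    exact (isNatural_app Γ' (u.app A)).eq_left (hm A) (huG A)
  · ext A
    have h : Γ₁.as.app (rqObj Q R A.1) = Γ₂.as.app (rqObj Q R A.1) :=
      congrArg (fun Γ => Γ.as.app A.1) (h₁.trans h₂.symm)
    have h1 := isNatural_app Γ₁ (u.app A)
    have h2 := isNatural_app Γ₂ (u.app A)
    refine h1.eq_right (a := Γ₁.as.app (rqObj Q R A.1)) ?_ (huF A)
    rw [h]
    exact h2

end ReplacementPseudofunctor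

end ModelStructure

/-! ### Local equivalences which are surjective on objects up to equivalence. -/

namespace IsLocalEquivalence

variable {A : Type*} [Bicategory A] {B : Type*} [Bicategory B] {C : Type*} [Bicategory C]
  {P : A ⥤ᵖ B}

lemma exists_iso (hP : IsLocalEquivalence P) {X Y : A} {f g : X ⟶ Y} (φ : P.map f ≅ P.map g) :
    ∃ ψ : f ≅ g, P.map₂ ψ.hom = φ.hom := by
  obtain ⟨a, ha⟩ := hP.full φ.hom
  obtain ⟨b, hb⟩ := hP.full φ.inv
  exact ⟨⟨a, b, hP.faithful (by simp [ha, hb]), hP.faithful (by simp [ha, hb])⟩, ha⟩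

lemma isEquiv_of_map (hP : IsLocalEquivalence P) {X Y : A} {f : X ⟶ Y}
    (hf : IsEquiv (P.map f)) : IsEquiv f := by
  obtain ⟨g', ⟨a⟩, ⟨b⟩⟩ := hf
  obtain ⟨g, ⟨φ⟩⟩ := hP.essSurj g'
  obtain ⟨a', -⟩ := hP.exists_iso (f := f ≫ g) (g := 𝟙 X)
    (P.mapComp f g ≪≫ whiskerLeftIso _ φ ≪≫ a ≪≫ (P.mapId X).symm)
  obtain ⟨b', -⟩ := hP.exists_iso (f := g ≫ f) (g := 𝟙 Y)
    (P.mapComp g f ≪≫ whiskerRightIso φ _ ≪≫ b ≪≫ (P.mapId Y).symm)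
  exact ⟨g, ⟨a'⟩, ⟨b'⟩⟩

end IsLocalEquivalence

section LocalLift

variable {A : Type*} [Bicategory A] {B : Type*} [Bicategory B] {C : Type*} [Bicategory C]

/-- The data of a lift of a pseudofunctor `K` along a local equivalence `P`, up to
equivalences `e`. -/
structure LocalLift (P : A ⥤ᵖ B) (K : C ⥤ᵖ B) where
  obj : C → A
  e : ∀ X : C, P.obj (obj X) ⟶ K.obj X
  isEquiv_e : ∀ X : C, IsEquiv (e X)
  map : ∀ {X Y : C}, (X ⟶ Y) → (obj X ⟶ obj Y)
  nat : ∀ {X Y : C} (f : X ⟶ Y), P.map (map f) ≫ e Y ≅ e X ≫ K.map f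
  map₂ : ∀ {X Y : C} {f g : X ⟶ Y}, (f ⟶ g) → (map f ⟶ map g)
  map₂_e : ∀ {X Y : C} {f g : X ⟶ Y} (μ : f ⟶ g),
    P.map₂ (map₂ μ) ▷ e Y ≫ (nat g).hom = (nat f).hom ≫ e X ◁ K.map₂ μ
  mapId : ∀ X : C, map (𝟙 X) ≅ 𝟙 (obj X)
  mapId_e : ∀ X : C, (nat (𝟙 X)).hom ≫ e X ◁ (K.mapId X).hom =
    (P.map₂Iso (mapId X) ≪≫ P.mapId (obj X)).hom ▷ e X ≫ (λ_ (e X)).hom ≫ (ρ_ (e X)).inv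
  mapComp : ∀ {X Y Z : C} (f : X ⟶ Y) (g : Y ⟶ Z), map (f ≫ g) ≅ map f ≫ map g
  mapComp_e : ∀ {X Y Z : C} (f : X ⟶ Y) (g : Y ⟶ Z),
    (nat (f ≫ g)).hom ≫ e X ◁ (K.mapComp f g).hom =
      (P.map₂Iso (mapComp f g) ≪≫ P.mapComp (map f) (map g)).hom ▷ e Z ≫ (α_ _ _ _).hom ≫
        P.map (map f) ◁ (nat g).hom ≫ (α_ _ _ _).inv ≫ (nat f).hom ▷ K.map g ≫ (α_ _ _ _).hom

namespace LocalLift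

variable {P : A ⥤ᵖ B} {K : C ⥤ᵖ B} (L : LocalLift P K)

/-- The image of a lift along `P`. -/
def liftData : LiftData K where
  obj X := P.obj (L.obj X)
  e := L.e
  cancel h := (L.isEquiv_e _).isCancellable.right h
  map f := P.map (L.map f)
  nat := L.nat
  map₂ μ := P.map₂ (L.map₂ μ)
  map₂_e := L.map₂_e
  mapId X := P.map₂Iso (L.mapId X) ≪≫ P.mapId (L.obj X)
  mapId_e := L.mapId_e
  mapComp f g := P.map₂Iso (L.mapComp f g) ≪≫ P.mapComp (L.map f) (L.map g)
  mapComp_e := L.mapComp_e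

variable (hP : IsLocalEquivalence P)

/-- The pseudofunctor given by a lift. -/
def pseudofunctor : C ⥤ᵖ A where
  obj := L.obj
  map := L.map
  map₂ := L.map₂
  -- All laws hold after applying `P`, by the transfer for `liftData`, and `P` is faithful on
  -- 2-cells. The auxiliary equalities in the later fields absorb the structural cells of `P`.
  map₂_id f := hP.faithful ((L.liftData.pseudofunctor.map₂_id f).trans (P.map₂_id _).symm)
  map₂_comp μ ν := hP.faithful ((L.liftData.pseudofunctor.map₂_comp μ ν).trans
    (P.map₂_comp _ _).symm)
  mapId := L.mapId
  mapComp := L.mapComp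
  map₂_whisker_left f g h μ := hP.faithful ((L.liftData.map₂_whisker_left f μ).trans (by
    have h1 : (P.map₂ (L.mapComp f g).hom ≫ (P.mapComp _ _).hom) ≫
        P.map (L.map f) ◁ P.map₂ (L.map₂ μ) ≫
          ((P.mapComp _ _).inv ≫ P.map₂ (L.mapComp f h).inv) =
        P.map₂ ((L.mapComp f g).hom ≫ L.map f ◁ L.map₂ μ ≫ (L.mapComp f h).inv) := by simp
    exact h1))
  map₂_whisker_right {_ _ _ f g} μ h := hP.faithful ((L.liftData.map₂_whisker_right μ h).trans (by
    have h1 : (P.map₂ (L.mapComp f h).hom ≫ (P.mapComp _ _).hom) ≫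
        P.map₂ (L.map₂ μ) ▷ P.map (L.map h) ≫
          ((P.mapComp _ _).inv ≫ P.map₂ (L.mapComp g h).inv) =
        P.map₂ ((L.mapComp f h).hom ≫ L.map₂ μ ▷ L.map h ≫ (L.mapComp g h).inv) := by simp
    exact h1))
  map₂_associator f g h := hP.faithful ((L.liftData.map₂_associator f g h).trans (by
    have h1 : (P.map₂ (L.mapComp (f ≫ g) h).hom ≫ (P.mapComp _ _).hom) ≫
        (P.map₂ (L.mapComp f g).hom ≫ (P.mapComp _ _).hom) ▷ P.map (L.map h) ≫ (α_ _ _ _).hom ≫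
          P.map (L.map f) ◁ ((P.mapComp _ _).inv ≫ P.map₂ (L.mapComp g h).inv) ≫
            ((P.mapComp _ _).inv ≫ P.map₂ (L.mapComp f (g ≫ h)).inv) =
        P.map₂ ((L.mapComp (f ≫ g) h).hom ≫ (L.mapComp f g).hom ▷ L.map h ≫ (α_ _ _ _).hom ≫
          L.map f ◁ (L.mapComp g h).inv ≫ (L.mapComp f (g ≫ h)).inv) := by
      simp [P.map₂_associator]
    exact h1))
  map₂_left_unitor {X _} f := hP.faithful
    ((L.liftData.pseudofunctor.map₂_left_unitor f).trans (by
      have h1 : (P.map₂ (L.mapComp (𝟙 X) f).hom ≫ (P.mapComp _ _).hom) ≫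
          (P.map₂ (L.mapId X).hom ≫ (P.mapId _).hom) ▷ P.map (L.map f) ≫ (λ_ _).hom =
          P.map₂ ((L.mapComp (𝟙 X) f).hom ≫ (L.mapId X).hom ▷ L.map f ≫ (λ_ _).hom) := by
        simp [P.map₂_left_unitor]
      exact h1))
  map₂_right_unitor {_ Y} f := hP.faithful
    ((L.liftData.pseudofunctor.map₂_right_unitor f).trans (by
      have h1 : (P.map₂ (L.mapComp f (𝟙 Y)).hom ≫ (P.mapComp _ _).hom) ≫
          P.map (L.map f) ◁ (P.map₂ (L.mapId Y).hom ≫ (P.mapId _).hom) ≫ (ρ_ _).hom =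
          P.map₂ ((L.mapComp f (𝟙 Y)).hom ≫ L.map f ◁ (L.mapId Y).hom ≫ (ρ_ _).hom) := by
        simp [P.map₂_right_unitor]
      exact h1))

/-- The pseudonatural transformation given by a lift. -/
def trans : (L.pseudofunctor hP).comp P ⟶ K where
  app := L.e
  naturality := L.nat
  naturality_naturality := L.map₂_e
  naturality_id := L.mapId_e
  naturality_comp := L.mapComp_e

end LocalLift

/-- Arrows are lifted by essential surjectivity, after conjugation by `e`. Each 2-cell is first
lifted along the equivalence `e` and then along `P`. The structural cells are isomorphisms lifted by
the same two steps. -/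
lemma exists_localLift {P : A ⥤ᵖ B} (hP : IsLocalEquivalence P) (K : C ⥤ᵖ B)
    (h : ∀ X : C, ∃ (Y : A) (e : P.obj Y ⟶ K.obj X), IsEquiv e) : Nonempty (LocalLift P K) := by
  choose obj e he using h
  have h1 : ∀ {X Y : C} (f : X ⟶ Y), ∃ g : obj X ⟶ obj Y,
      Nonempty (P.map g ≫ e Y ≅ e X ≫ K.map f) := by
    intro X Y f
    obtain ⟨k, -, ⟨b⟩⟩ := he Y
    obtain ⟨g, ⟨φ⟩⟩ := hP.essSurj (e X ≫ K.map f ≫ k)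
    exact ⟨g, ⟨whiskerRightIso φ _ ≪≫ α_ _ _ _ ≪≫ whiskerLeftIso (e X) (α_ _ _ _ ≪≫
      whiskerLeftIso (K.map f) b ≪≫ ρ_ _)⟩⟩
  choose map nat using @h1
  have h2 : ∀ {X Y : C} {f g : X ⟶ Y} (μ : f ⟶ g), ∃ κ : map f ⟶ map g,
      P.map₂ κ ▷ e Y ≫ (nat g).some.hom = (nat f).some.hom ≫ e X ◁ K.map₂ μ := by
    intro X Y f g μ
    obtain ⟨κ', hκ'⟩ := ((he Y).isQuasiequiv.1 _ _ _).2
      ((nat f).some.hom ≫ e X ◁ K.map₂ μ ≫ (nat g).some.inv)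
    obtain ⟨κ, rfl⟩ := hP.full κ'
    dsimp only at hκ'
    exact ⟨κ, by simp [hκ']⟩
  choose map₂ map₂_e using @h2
  have h3 : ∀ X : C, ∃ φ : map (𝟙 X) ≅ 𝟙 (obj X),
      (nat (𝟙 X)).some.hom ≫ e X ◁ (K.mapId X).hom =
        (P.map₂Iso φ ≪≫ P.mapId (obj X)).hom ▷ e X ≫ (λ_ (e X)).hom ≫ (ρ_ (e X)).inv := by
    intro X
    obtain ⟨ψ, hψ⟩ := (he X).isQuasiequiv.exists_iso_right (g := P.map (map (𝟙 X))) (h := 𝟙 _)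
      ((nat (𝟙 X)).some ≪≫ whiskerLeftIso (e X) (K.mapId X) ≪≫ ρ_ _ ≪≫ (λ_ _).symm)
    obtain ⟨φ, hφ⟩ := hP.exists_iso (f := map (𝟙 X)) (g := 𝟙 _) (ψ ≪≫ (P.mapId _).symm)
    refine ⟨φ, ?_⟩
    simp only [Iso.trans_hom, PrelaxFunctor.map₂Iso_hom, hφ, Iso.symm_hom, Category.assoc,
      Iso.inv_hom_id, Category.comp_id, hψ, whiskerLeftIso_hom, Iso.inv_hom_id_assoc,
      Iso.hom_inv_id]
  choose mapId mapId_e using h3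
  have h4 : ∀ {X Y Z : C} (f : X ⟶ Y) (g : Y ⟶ Z), ∃ φ : map (f ≫ g) ≅ map f ≫ map g,
      (nat (f ≫ g)).some.hom ≫ e X ◁ (K.mapComp f g).hom =
      (P.map₂Iso φ ≪≫ P.mapComp (map f) (map g)).hom ▷ e Z ≫ (α_ _ _ _).hom ≫
        P.map (map f) ◁ (nat g).some.hom ≫ (α_ _ _ _).inv ≫ (nat f).some.hom ▷ K.map g ≫
          (α_ _ _ _).hom := by
    intro X Y Z f g
    obtain ⟨ψ, hψ⟩ := (he Z).isQuasiequiv.exists_iso_right (g := P.map (map (f ≫ g)))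
      (h := P.map (map f) ≫ P.map (map g))
      ((nat (f ≫ g)).some ≪≫ whiskerLeftIso (e X) (K.mapComp f g) ≪≫ (α_ _ _ _).symm ≪≫
        whiskerRightIso (nat f).some.symm (K.map g) ≪≫ α_ _ _ _ ≪≫
          whiskerLeftIso (P.map (map f)) (nat g).some.symm ≪≫ (α_ _ _ _).symm)
    obtain ⟨φ, hφ⟩ := hP.exists_iso (f := map (f ≫ g)) (g := map f ≫ map g)
      (ψ ≪≫ (P.mapComp _ _).symm)
    refine ⟨φ, ?_⟩
    simp only [Iso.trans_hom, PrelaxFunctor.map₂Iso_hom, hφ, Iso.symm_hom, Category.assoc,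
      Iso.inv_hom_id, Category.comp_id, hψ, whiskerLeftIso_hom, Iso.inv_hom_id_assoc,
      whiskerRightIso_hom, whiskerLeft_inv_hom_assoc, Iso.hom_inv_id_assoc,
      inv_hom_whiskerRight_assoc]
  choose mapComp mapComp_e using @h4
  exact ⟨⟨obj, e, he, map, fun f => (nat f).some, map₂, map₂_e, mapId, mapId_e, mapComp,
    mapComp_e⟩⟩

end LocalLift

section LiftTransformation

variable {A : Type*} [Bicategory A] {B : Type*} [Bicategory B]

/-- The hypotheses spell out a pseudonatural transformation from the composite of `T` and `P` to
`P`, without the identities that composition of pseudofunctors would add. Its components are lifted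
up to isomorphisms `κ`, its comparison cells are conjugated by `κ` and lifted, and the laws are
reflected by `P`. -/
lemma exists_trans_of_isLocalEquivalence {P : A ⥤ᵖ B} (hP : IsLocalEquivalence P) {T : A ⥤ᵖ A}
    (app : ∀ X : A, P.obj (T.obj X) ⟶ P.obj X)
    (nat : ∀ {X Y : A} (f : X ⟶ Y), P.map (T.map f) ≫ app Y ≅ app X ≫ P.map f)
    (nat_nat : ∀ {X Y : A} {f g : X ⟶ Y} (μ : f ⟶ g),
      P.map₂ (T.map₂ μ) ▷ app Y ≫ (nat g).hom = (nat f).hom ≫ app X ◁ P.map₂ μ)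
    (nat_id : ∀ X : A, (nat (𝟙 X)).hom ≫ app X ◁ (P.mapId X).hom =
      P.map₂ (T.mapId X).hom ▷ app X ≫ (P.mapId _).hom ▷ app X ≫ (λ_ (app X)).hom ≫
        (ρ_ (app X)).inv)
    (nat_comp : ∀ {X Y Z : A} (f : X ⟶ Y) (g : Y ⟶ Z),
      (nat (f ≫ g)).hom ≫ app X ◁ (P.mapComp f g).hom =
        P.map₂ (T.mapComp f g).hom ▷ app Z ≫ (P.mapComp _ _).hom ▷ app Z ≫ (α_ _ _ _).hom ≫
          P.map (T.map f) ◁ (nat g).hom ≫ (α_ _ _ _).inv ≫ (nat f).hom ▷ P.map g ≫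
            (α_ _ _ _).hom) :
    ∃ α : T ⟶ Pseudofunctor.id A, ∀ X, Nonempty (P.map (α.app X) ≅ app X) := by
  choose a ha using fun X => hP.essSurj (app X)
  have κ : ∀ X, P.map (a X) ≅ app X := fun X => (ha X).some
  have h1 : ∀ {X Y : A} (f : X ⟶ Y), ∃ n : T.map f ≫ a Y ≅ a X ≫ f, P.map₂ n.hom =
      (P.mapComp _ _).hom ≫ P.map (T.map f) ◁ (κ Y).hom ≫ (nat f).hom ≫
        (κ X).inv ▷ P.map f ≫ (P.mapComp _ _).inv := by
    intro X Y f
    obtain ⟨n, hn⟩ := hP.exists_iso (f := T.map f ≫ a Y) (g := a X ≫ f)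
      (P.mapComp _ _ ≪≫ whiskerLeftIso (P.map (T.map f)) (κ Y) ≪≫ nat f ≪≫
        whiskerRightIso (κ X).symm (P.map f) ≪≫ (P.mapComp _ _).symm)
    exact ⟨n, by simpa using hn⟩
  choose n hn using @h1
  have n_nat : ∀ {X Y : A} {f g : X ⟶ Y} (μ : f ⟶ g),
      T.map₂ μ ▷ a Y ≫ (n g).hom = (n f).hom ≫ a X ◁ μ := by
    intro X Y f g μ
    apply hP.faithful
    have h1 := whisker_exchange (P.map₂ (T.map₂ μ)) (κ Y).hom
    have h2 := whisker_exchange (κ X).inv (P.map₂ μ)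
    simp only [P.map₂_comp, hn, P.map₂_whisker_right, P.map₂_whisker_left, Category.assoc,
      Iso.inv_hom_id_assoc, ← reassoc_of% h2, ← reassoc_of% h1, reassoc_of% (nat_nat μ)]
  have n_id : ∀ X : A, (n (𝟙 X)).hom = (T.mapId X).hom ▷ a X ≫ (λ_ (a X)).hom ≫
      (ρ_ (a X)).inv := by
    intro X
    apply hP.faithful
    have h2 : (nat (𝟙 X)).hom = P.map₂ (T.mapId X).hom ▷ app X ≫ (P.mapId _).hom ▷ app X ≫
        (λ_ (app X)).hom ≫ (ρ_ (app X)).inv ≫ app X ◁ (P.mapId X).inv := by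
      rw [← cancel_mono (app X ◁ (P.mapId X).hom), nat_id]; simp
    have h3 := P.map₂_left_unitor (a X)
    have h4 : P.map₂ (ρ_ (a X)).inv = (ρ_ _).inv ≫ P.map (a X) ◁ (P.mapId X).inv ≫
        (P.mapComp _ _).inv := by
      rw [← cancel_epi (P.map₂ (ρ_ (a X)).hom), ← P.map₂_comp, P.map₂_right_unitor]
      simp
    have h5 := whisker_exchange (P.map₂ (T.mapId X).hom) (κ X).hom
    have h6 := whisker_exchange (P.mapId (T.obj X)).hom (κ X).hom
    have h7 := whisker_exchange (κ X).inv (P.mapId X).inv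
    simp only [P.map₂_comp, hn, P.map₂_whisker_right, h2, h3, h4, Category.assoc,
      reassoc_of% h5, reassoc_of% h6, reassoc_of% h7, Iso.inv_hom_id_assoc]
    simp
  have n_comp : ∀ {X Y Z : A} (f : X ⟶ Y) (g : Y ⟶ Z), (n (f ≫ g)).hom =
      (T.mapComp f g).hom ▷ a Z ≫ (α_ _ _ _).hom ≫ T.map f ◁ (n g).hom ≫ (α_ _ _ _).inv ≫
        (n f).hom ▷ g ≫ (α_ _ _ _).hom := by
    intro X Y Z f g
    apply hP.faithful
    have h2 : (nat (f ≫ g)).hom = P.map₂ (T.mapComp f g).hom ▷ app Z ≫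
        (P.mapComp _ _).hom ▷ app Z ≫ (α_ _ _ _).hom ≫ P.map (T.map f) ◁ (nat g).hom ≫
          (α_ _ _ _).inv ≫ (nat f).hom ▷ P.map g ≫ (α_ _ _ _).hom ≫
            app X ◁ (P.mapComp f g).inv := by
      rw [← cancel_mono (app X ◁ (P.mapComp f g).hom), nat_comp]; simp
    have h5 := whisker_exchange (P.map₂ (T.mapComp f g).hom) (κ Z).hom
    have h6 := whisker_exchange (P.mapComp (T.map f) (T.map g)).hom (κ Z).hom
    have h7 := whisker_exchange (κ X).inv (P.mapComp f g).inv
    have h8 : P.map₂ (α_ (T.map f) (a Y) g).inv = (P.mapComp _ _).hom ≫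
        P.map (T.map f) ◁ (P.mapComp _ _).hom ≫ (α_ _ _ _).inv ≫
          (P.mapComp _ _).inv ▷ P.map g ≫ (P.mapComp _ _).inv := by
      rw [← cancel_epi (P.map₂ (α_ (T.map f) (a Y) g).hom), ← P.map₂_comp, P.map₂_associator]
      simp
    simp only [P.map₂_comp, hn, P.map₂_whisker_right, P.map₂_whisker_left, P.map₂_associator, h2,
      h8, Category.assoc, reassoc_of% h5, reassoc_of% h6, reassoc_of% h7, Iso.inv_hom_id_assoc,
      Bicategory.whiskerLeft_comp, comp_whiskerRight]
    simp
  exact ⟨{  app := a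
            naturality := n
            naturality_naturality := n_nat
            naturality_id := fun X =>
              (congrArg ((n (𝟙 X)).hom ≫ ·) (whiskerLeft_id (a X) (𝟙 X))).trans
                ((Category.comp_id _).trans (n_id X))
            naturality_comp := fun {X _ _} f g =>
              (congrArg ((n (f ≫ g)).hom ≫ ·) (whiskerLeft_id (a X) (f ≫ g))).trans
                ((Category.comp_id _).trans (n_comp f g)) }, fun X => ⟨κ X⟩⟩

lemma map₂_comp_whiskerRight (P : A ⥤ᵖ B) {X Y : A} {f g h : X ⟶ Y} (x : f ⟶ g) (y : g ⟶ h)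
    {k : P.obj X ⟶ P.obj Y} (z : P.map h ⟶ k) {Z : B} (e : P.obj Y ⟶ Z) {l : P.obj X ⟶ Z}
    (r : k ≫ e ⟶ l) : (P.map₂ x ≫ P.map₂ y ≫ z) ▷ e ≫ r =
      P.map₂ (x ≫ y) ▷ e ≫ z ▷ e ≫ r := by
  simp

/-- A local equivalence which is surjective on objects up to equivalence is a pseudoequivalence. -/
theorem IsLocalEquivalence.isPseudoequivalence {A : Type u} [Bicategory.{w, v} A]
    {B : Type u₁} [Bicategory.{w₁, v₁} B] {P : A ⥤ᵖ B} (hP : IsLocalEquivalence P)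
    (h : ∀ X : B, ∃ (Y : A) (e : P.obj Y ⟶ X), IsEquiv e) : IsPseudoequivalence P := by
  -- A lift of the identity of `B` along `P` is a candidate inverse together with `β`. The
  -- components of `β` at the objects `P.obj X` lie over `P`, so they lift to the other comparison
  -- `α`.
  obtain ⟨L⟩ := exists_localLift hP (Pseudofunctor.id B) h
  let β := L.trans hP
  obtain ⟨α, hα⟩ := exists_trans_of_isLocalEquivalence hP (T := P.comp (L.pseudofunctor hP))
    (fun X => β.app (P.obj X)) (fun f => β.naturality (P.map f))
    (fun μ => β.naturality_naturality (P.map₂ μ))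
    (fun X => by
      have h : (β.naturality (P.map (𝟙 X))).hom ≫ β.app (P.obj X) ◁ ((P.mapId X).hom ≫ 𝟙 _) =
          (P.map₂ (L.map₂ (P.mapId X).hom) ≫ P.map₂ (L.mapId _).hom ≫ (P.mapId _).hom) ▷
            β.app (P.obj X) ≫ (λ_ _).hom ≫ (ρ_ _).inv := (precompTrans P β).naturality_id X
      have h' : (β.naturality (P.map (𝟙 X))).hom ≫ β.app (P.obj X) ◁ (P.mapId X).hom =
          P.map₂ (L.map₂ (P.mapId X).hom ≫ (L.mapId _).hom) ▷ β.app (P.obj X) ≫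
            (P.mapId _).hom ▷ β.app (P.obj X) ≫ (λ_ _).hom ≫ (ρ_ _).inv := by
        exact (congrArg (fun z => (β.naturality (P.map (𝟙 X))).hom ≫ β.app (P.obj X) ◁ z)
          (Category.comp_id (P.mapId X).hom).symm).trans
            (h.trans (map₂_comp_whiskerRight _ _ _ _ _ _))
      exact h')
    (fun {X Y Z} f g => by
      have h : (β.naturality (P.map (f ≫ g))).hom ≫
          β.app (P.obj X) ◁ ((P.mapComp f g).hom ≫ 𝟙 _) =
          (P.map₂ (L.map₂ (P.mapComp f g).hom) ≫ P.map₂ (L.mapComp _ _).hom ≫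
            (P.mapComp _ _).hom) ▷ β.app (P.obj Z) ≫ (α_ _ _ _).hom ≫
              P.map (L.map (P.map f)) ◁ (β.naturality (P.map g)).hom ≫ (α_ _ _ _).inv ≫
                (β.naturality (P.map f)).hom ▷ P.map g ≫ (α_ _ _ _).hom :=
        (precompTrans P β).naturality_comp f g
      have h' : (β.naturality (P.map (f ≫ g))).hom ≫ β.app (P.obj X) ◁ (P.mapComp f g).hom =
          P.map₂ (L.map₂ (P.mapComp f g).hom ≫ (L.mapComp _ _).hom) ▷ β.app (P.obj Z) ≫
            (P.mapComp _ _).hom ▷ β.app (P.obj Z) ≫ (α_ _ _ _).hom ≫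
              P.map (L.map (P.map f)) ◁ (β.naturality (P.map g)).hom ≫ (α_ _ _ _).inv ≫
                (β.naturality (P.map f)).hom ▷ P.map g ≫ (α_ _ _ _).hom := by
        exact (congrArg (fun z => (β.naturality (P.map (f ≫ g))).hom ≫ β.app (P.obj X) ◁ z)
          (Category.comp_id (P.mapComp f g).hom).symm).trans
            (h.trans (map₂_comp_whiskerRight _ _ _ _ _ _))
      exact h')
  -- The image under `P` of a component of `α` is isomorphic to a component of `β`, so it is an
  -- equivalence, and `P` reflects equivalences.
  exact ⟨L.pseudofunctor hP, ⟨α, isEquiv_of_app α fun X => hP.isEquiv_of_map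
      ((L.isEquiv_e (P.obj X)).of_iso (hα X).some.symm)⟩,
    ⟨β, isEquiv_of_app β L.isEquiv_e⟩⟩

end LiftTransformation

/-! ### Conclusion: `r^*` is a pseudoequivalence. -/

namespace ModelStructure.ReplacementPseudofunctor

variable {C : Type u} [Bicategory.{w, v} C] {M : ModelStructure C}
  {Q : M.CofibrantReplacement} {R : M.FibrantReplacement}

/-- Full faithfulness on 2-cells is the existence and uniqueness of modifications, and essential
surjectivity is the statement on transformations; `HomInv` is full, so both apply unchanged. -/
lemma isLocalEquivalence_precompInv (S : ReplacementPseudofunctor Q R) (hr : Inverts M.W S.r)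
    (D : Type u₁) [Bicategory.{w₁, v₁} D] : IsLocalEquivalence (precompInv hr D) where
  faithful {_ _ _ _ Γ Γ'} h := by
    have h₁ : ((precompInv hr D).map₂ Γ).hom = ((precompInv hr D).map₂ Γ').hom := by rw [h]
    have h' : precompMod S.r Γ = precompMod S.r Γ' := h₁
    exact (S.existsUnique_modification (precompMod S.r Γ')).unique h' rfl
  full κ := by
    obtain ⟨Γ, hΓ, -⟩ := S.existsUnique_modification κ.hom
    exact ⟨Γ, InducedBicategory.hom₂_ext hΓ⟩
  essSurj k := by
    obtain ⟨θ, ⟨φ⟩⟩ := S.exists_restriction_iso k.hom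
    exact ⟨θ, ⟨InducedBicategory.isoMk φ⟩⟩

/-- Precomposition with the replacement pseudofunctor is a pseudoequivalence. -/
theorem isPseudoequivalence_precompInv (S : ReplacementPseudofunctor Q R)
    (hr : Inverts M.W S.r) (D : Type u₁) [Bicategory.{w₁, v₁} D] :
    IsPseudoequivalence (precompInv hr D) := by
  refine (S.isLocalEquivalence_precompInv hr D).isPseudoequivalence fun F => ?_
  obtain ⟨F', e, e', ⟨a⟩, ⟨b⟩⟩ := S.exists_factorization F.1 F.2
  exact ⟨F', InducedBicategory.mkHom e, InducedBicategory.mkHom e',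
    ⟨InducedBicategory.isoMk a⟩, ⟨InducedBicategory.isoMk b⟩⟩

end ModelStructure.ReplacementPseudofunctor

end ModelBicat

theorem theorem5p1 {C : Type u} [Bicategory.{w, v} C] (M : ModelBicat.ModelStructure C) :
    Nonempty M.CofibrantReplacement ∧ Nonempty M.FibrantReplacement ∧
    ∀ (Q : M.CofibrantReplacement) (R : M.FibrantReplacement),
      Nonempty (ModelBicat.ModelStructure.ReplacementPseudofunctor Q R) ∧
      ∀ S : ModelBicat.ModelStructure.ReplacementPseudofunctor Q R,
        ∃ hr : ModelBicat.Inverts M.W S.r,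
          ∀ (D : Type u₁) [Bicategory.{w₁, v₁} D],
            ModelBicat.IsPseudoequivalence (ModelBicat.precompInv hr D) ∧
            (∀ F : C ⥤ᵖ D, ModelBicat.Inverts M.W F →
              ∃ (F' : M.Ho ⥤ᵖ D) (e : S.r.comp F' ⟶ F), ModelBicat.IsEquiv e) ∧
            (∀ (F G : M.Ho ⥤ᵖ D) (θ : S.r.comp F ⟶ S.r.comp G),
              ∃ θ' : F ⟶ G, Nonempty (ModelBicat.precompTrans S.r θ' ≅ θ)) ∧
            (∀ (F G : M.Ho ⥤ᵖ D) (θ η : F ⟶ G)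
              (ρ : ModelBicat.precompTrans S.r θ ⟶ ModelBicat.precompTrans S.r η),
              ∃! ρ' : θ ⟶ η, ModelBicat.precompMod S.r ρ' = ρ) := by
  refine ⟨M.nonempty_cofibrantReplacement, M.nonempty_fibrantReplacement, fun Q R =>
    ⟨ModelBicat.ModelStructure.nonempty_replacementPseudofunctor Q R, fun S =>
      ⟨S.inverts, fun D _ => ⟨S.isPseudoequivalence_precompInv S.inverts D, ?_, ?_, ?_⟩⟩⟩⟩
  · exact fun F hF => S.exists_factorization F hF
  · exact fun F G θ => S.exists_restriction_iso θ
  · exact fun F G θ η ρ => S.existsUnique_modification ρ
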